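/- **Engine.** All Hilbert spaces are finite-dimensional, entropies are in nats, $H(P|K)=H(PK)-H(K)$, $I(P\!:\!Q|K)=H(P|K)-H(P|QK)$. Let $k_B,T_h,T_c,T_m>0$. The engine consists of a reference $R$, a system $S$, an ancilla $A$ with energy eigenbasis $\{|\varepsilon_x\rangle\}_x$, a hot bath $B_h$, a cold bath $B_c=A'C$ ($A'$ a copy of $A$ with the same Hamiltonian, $C$ arbitrary), a measurement apparatus $M$, and classical registers $X$, $Y$; write $E=RSAB_hB_c$. The initial state is $|\psi\rangle\langle\psi|^{RS}\otimes\tau_c^A\otimes\tau_h^{B_h}\otimes\tau_c^{B_c}\otimes|0\rangle\langle 0|^X\otimes|0\rangle\langle 0|^Y$ with $\psi^{RS}$ an arbitrary pure state and thermal states at temperatures $T_c,T_h,T_c$; the Hamiltonian of $R$ is zero and $|0\rangle^Y$ is a ground state of $H^Y=\sum_y e_y|y\rangle\langle y|$. One cycle is: (0) $A$ is measured in its energy basis, with outcome $x$ of probability $p_X(x)=e^{-\varepsilon_x/k_BT_c}/Z$, recorded in $X$; (enc) a unitary $U^{SA}_{\mathrm{enc},x}$; (1) a unitary on $SAB_h$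 that commutes with the total Hamiltonian of $SA$ and $B_h$; this gives the states $\sigma^E_{1,x}$; (2) an instrument $\{\mathcal N_{y|x}\}_y$ on $SA$, with $y$ recorded in $Y$, implemented as $\mathcal N_{y|x}(\rho)=\mathrm{Tr}_M[U_x(\rho\otimes\tau_m^M)U_x^\dagger P^M_{y|x}]$ with $\tau^M_m$ thermal at $T_m$, $U_x$ unitary on $SAM$ and $\{P^M_{y|x}\}_y$ a complete set of projectors, followed by the controlled unitary $\sum_yP^M_{y|x}\otimes V_y$ on $MY$ with $V_y|0\rangle=|y\rangle$; (3) a unitary $U^{SA}_{\mathrm{dec},xy}$; (f) $A$ and $A'$ are swapped. Then $X$ and $Y$ are discarded and $Y$ is erased to $|0\rangle$. Write $\sigma_k$ for the state after stage $k$ ($\sigma_2$ includes $M$ where $M$ appears), $\langle\cdot\rangle_k$ for expectations in it, with $k=i$ the initial state, and $U_k$ for the internal energy of $RSAY$ in it. The Hamiltonian of $SA$ is $H^S+H^A$ at stages $i,0,3,f$ and a fixed $H'^{SA}$ at stages enc, 1, 2. **Quantities.** Put - $Q_h=\langle H^{B_h}\rangle_i-\langle H^{B_h}\rangle_f$, $Q_{\mathrm{meas}}=\langle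 H^M\rangle_1-\langle H^M\rangle_2$, $Q^Y_{\mathrm{erase}}=\langle H^Y\rangle_i-\langle H^Y\rangle_f$; - $Q^Y_{\mathrm{meas}}=k_BT_m[\Delta H(Y|X)-I(Y\!:\!M|X)_{\sigma_2}]$ and $Q^{RSA|Y}_{\mathrm{meas}}=k_BT_m[\Delta H(RSA|XY)-I(RSA\!:\!M|XY)_{\sigma_2}]$, with $\Delta$ the change from $\sigma_1$ to $\sigma_2$; - $Q_{\mathrm{input}}=Q_h+Q^Y_{\mathrm{meas}}$, $W_{\mathrm{tot}}=(U_{\mathrm{enc}}-U_0)+(U_2-U_1-Q_{\mathrm{meas}})+(U_3-U_2)$, $\eta=-W_{\mathrm{tot}}/Q_{\mathrm{input}}$, $\eta_C=1-T_c/T_h$; - $\Delta\mathscr U$, the change of the internal energy of $RSAY$ over the whole cycle, erasure included; - $F_e=\langle\psi|\sigma_f^{RS}|\psi\rangle$, $S_e=H(RS)_{\sigma_f}$, $d=\dim(\mathcal H_R\otimes\mathcal H_S)$, $H(F)=-F\ln F-(1-F)\ln(1-F)$, and $F_e^\star$, the largest $F\in[0,1]$ with $H(F)+(1-F)\ln(d^2-1)\ge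 S_e$ (for $d=1$ the logarithmic term is read as $0$); - $\mathscr E(\mathcal N_{|x};\sigma^E_{1,x})=\mathrm{Tr}[\mathcal N_{|x}^\dagger\circ\mathcal N_{|x}(\sigma^E_{1,x})]$, the efficacy of $\mathcal N_{|x}(\cdot)=\sum_y\mathcal N_{y|x}(\cdot)\otimes|y\rangle\langle y|^Y$, where $\mathcal N_{y|x}$ acts as the identity on the rest of $E$. **Corollary (triple trade-off).** Suppose that $Q_{\mathrm{input}}>0$, that $Q^{RSA|Y}_{\mathrm{meas}}\le 0$, and that for real numbers $\varepsilon_1,\varepsilon_2,\varepsilon_3$ the following hold. 1. (High fidelity, $|\Delta\mathscr U|\ll Q_{\mathrm{input}}$.) $|\Delta\mathscr U|\le\varepsilon_1Q_{\mathrm{input}}$. 2. ($H(X|E)_{\sigma_f}\ll H(Y|EX)_{\sigma_f}$.) $H(X|E)_{\sigma_f}\le\varepsilon_2H(Y|EX)_{\sigma_f}$. 3. (The Landauer bound is approximately reached.) $\bigl||Q^Y_{\mathrm{erase}}|-k_BT_cH(Y|X)_{\sigma_2}\bigr|\le\varepsilon_3k_BT_cH(Y|X)_{\sigma_2}$. 4.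 $|Q^{RSA|Y}_{\mathrm{meas}}|\ge\frac{T_c}{T_h}Q^Y_{\mathrm{meas}}$. Then $$H(F_e)+(1-F_e)\ln(d^2-1)\ \ge\ \frac{Q_{\mathrm{input}}}{k_BT_h}\left(\frac{\eta-\eta_C}{1-\eta_C}\right)+\sum_xp_X(x)\left[-\ln\mathscr E(\mathcal N_{|x};\sigma^E_{1,x})\right]-\delta,$$ $$\delta=\varepsilon_1\frac{Q_{\mathrm{input}}}{k_BT_c}+\varepsilon_2H(Y|EX)_{\sigma_f}+\varepsilon_3H(Y|X)_{\sigma_2}.$$ Moreover $F_e\le F_e^\star$, and the same inequality holds with $F_e^\star$ in place of $F_e$. In particular, when the approximations in 1–3 are exact ($\varepsilon_1=\varepsilon_2=\varepsilon_3=0$), the inequality holds without the error $\delta$. -/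

import Mathlib

open scoped Matrix Kronecker ComplexOrder

noncomputable section

namespace QEC

/-! ### Finite-dimensional quantum information -/

section General

variable {T P Q K n m : Type*}
variable [Fintype T] [Fintype P] [Fintype Q] [Fintype K] [Fintype n] [Fintype m]
variable [DecidableEq T] [DecidableEq P] [DecidableEq Q] [DecidableEq K]
variable [DecidableEq n] [DecidableEq m]

/-- Expectation value `Tr[ρ H]` of the observable `H` in the state `ρ`. -/
def expect (ρ H : Matrix n n ℂ) : ℝ := (ρ * H).trace.re

/-- Von Neumann entropy `-Tr[ρ ln ρ]` in nats; `ln ρ` is taken in the functional calculus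
of the Hermitian matrix `ρ`, with `0 ln 0 = 0`. -/
def entropy (ρ : Matrix n n ℂ) : ℝ := -(ρ * cfc Real.log ρ).trace.re

/-- Partial trace. `glue p q` identifies the basis `P × Q` with the basis `T` (it is a
bijection in each use below); the factor `Q` is traced out. -/
def ptrace (glue : P → Q → T) (ρ : Matrix T T ℂ) : Matrix P P ℂ :=
  Matrix.of fun p p' => ∑ q, ρ (glue p q) (glue p' q)

/-- The operator `u` on the factor `P` of the space with basis `T`, tensored with the identity
on the other factor `Q`; `split` identifies `T` with `P × Q`. -/
def lift (split : T → P × Q) (u : Matrix P P ℂ) : Matrix T T ℂ :=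
  (u ⊗ₖ (1 : Matrix Q Q ℂ)).submatrix split split

/-- Conditional entropy `H(P|K) = H(PK) - H(K)`. -/
def condEntropy (ρ : Matrix (P × K) (P × K) ℂ) : ℝ :=
  entropy ρ - entropy (ptrace (fun (k : K) (p : P) => (p, k)) ρ)

/-- Conditional mutual information `I(P:Q|K) = H(P|K) - H(P|QK)`. -/
def condMutualInfo (ρ : Matrix ((P × Q) × K) ((P × Q) × K) ℂ) : ℝ :=
  condEntropy (ptrace (fun (t : P × K) (q : Q) => ((t.1, q), t.2)) ρ)
    - condEntropy (ptrace (fun (t : P × (Q × K)) (_ : Unit) => ((t.1, t.2.1), t.2.2)) ρ)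

/-- The thermal state `exp(-β H) / Tr exp(-β H)`. -/
def thermal (β : ℝ) (H : Matrix n n ℂ) : Matrix n n ℂ :=
  (NormedSpace.exp (-(β : ℂ) • H)).trace⁻¹ • NormedSpace.exp (-(β : ℂ) • H)

/-- The adjoint of a linear map `N` between matrix spaces, determined by
`Tr[X N(Z)] = Tr[N†(X) Z]`: its `(i, j)` entry is obtained with `Z = |j⟩⟨i|`. -/
def adjointMap (N : Matrix n n ℂ → Matrix m m ℂ) (X : Matrix m m ℂ) : Matrix n n ℂ :=
  Matrix.of fun i j => (X * N (Matrix.single j i 1)).trace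

/-- The efficacy `Tr[(N† ∘ N)(ρ)]` of the map `N` with respect to `ρ`. -/
def efficacy (N : Matrix n n ℂ → Matrix m m ℂ) (ρ : Matrix n n ℂ) : ℝ :=
  (adjointMap N (N ρ)).trace.re

/-- The function `F ↦ H(F) + (1 - F) ln(d² - 1)` of the quantum Fano inequality
(binary entropy in nats). -/
def fano (d : ℕ) (F : ℝ) : ℝ := Real.binEntropy F + (1 - F) * Real.log ((d : ℝ) ^ 2 - 1)

/-- The largest `F` in `[0, 1]` that the quantum Fano inequality allows for the entropy
exchange `s`. -/
def maxFidelity (d : ℕ) (s : ℝ) : ℝ := sSup {F : ℝ | F ∈ Set.Icc 0 1 ∧ s ≤ fano d F}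

end General

/-- Basis of `E = R S A B_h B_c`. The cold bath is `B_c = A' C`, where `A'` is a subsystem of
the same dimension as the ancilla `A` and `C` is the rest of the bath. -/
abbrev EIdx (R S A B C : Type*) := (((R × S) × A) × B) × (A × C)

/-- A shortcut for instance search. -/
instance {R S A B C : Type*} [DecidableEq R] [DecidableEq S] [DecidableEq A] [DecidableEq B]
    [DecidableEq C] : DecidableEq (EIdx R S A B C) := inferInstance

/-- A quantum error-correcting engine. `R`, `S`, `A`, `B`, `C`, `M`, `Y` index orthonormal bases
of the reference, the system, the ancilla, the hot bath, the cold bath without the copy of the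
ancilla that is swapped in, the measurement apparatus, and the classical memory `Y`.
The basis of `A` is its energy basis, which also labels the outcomes `x` of the initial
measurement (hence the register `X`). The outcome set of the syndrome measurement may depend on
`x`: an outcome that does not occur for a given `x` has the zero projector. -/
structure Engine (R S A B C M Y : Type*)
    [Fintype R] [Fintype S] [Fintype A] [Fintype B] [Fintype C] [Fintype M] [Fintype Y]
    [DecidableEq R] [DecidableEq S] [DecidableEq A] [DecidableEq B] [DecidableEq C]
    [DecidableEq M] [DecidableEq Y] where
  /-- Boltzmann constant -/
  kB : ℝ
  /-- temperature of the hot bath -/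
  Th : ℝ
  /-- temperature of the cold bath -/
  Tc : ℝ
  /-- temperature of the measurement apparatus -/
  Tm : ℝ
  kB_pos : 0 < kB
  Th_pos : 0 < Th
  Tc_pos : 0 < Tc
  Tm_pos : 0 < Tm
  /-- the purification of the initial state of `S` -/
  ψ : R × S → ℂ
  ψ_norm : ∑ i, ‖ψ i‖ ^ 2 = 1
  /-- Hamiltonian of `S` at the beginning and at the end of the cycle -/
  HS : Matrix S S ℂ
  HS_herm : HS.IsHermitian
  /-- energy levels of `A` -/
  εA : A → ℝ
  /-- Hamiltonian of the hot bath -/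
  HB : Matrix B B ℂ
  HB_herm : HB.IsHermitian
  /-- Hamiltonian of the part `C` of the cold bath -/
  HC : Matrix C C ℂ
  HC_herm : HC.IsHermitian
  /-- Hamiltonian of the measurement apparatus -/
  HM : Matrix M M ℂ
  HM_herm : HM.IsHermitian
  /-- energies of the memory states `|y⟩` -/
  εY : Y → ℝ
  /-- the initial state `|0⟩` of the memory, a ground state -/
  y0 : Y
  y0_ground : ∀ y, εY y0 ≤ εY y
  /-- encoding unitaries -/
  Uenc : A → Matrix.unitaryGroup (S × A) ℂ
  /-- Hamiltonian of the encoded system `SA` from the end of the encoding to the end of the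
  syndrome measurement (possibly `HS + HA`) -/
  Hmid : Matrix (S × A) (S × A) ℂ
  Hmid_herm : Hmid.IsHermitian
  /-- interaction with the hot bath: a thermal operation, commuting with the total Hamiltonian -/
  Uh : Matrix.unitaryGroup ((S × A) × B) ℂ
  Uh_comm : Commute (Uh : Matrix ((S × A) × B) ((S × A) × B) ℂ)
    (Hmid ⊗ₖ (1 : Matrix B B ℂ) + (1 : Matrix (S × A) (S × A) ℂ) ⊗ₖ HB)
  /-- interaction of `SA` with the measurement apparatus -/
  Umeas : A → Matrix.unitaryGroup ((S × A) × M) ℂ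
  /-- projective measurement of the apparatus -/
  proj : A → Y → Matrix M M ℂ
  proj_herm : ∀ x y, (proj x y).IsHermitian
  proj_mul : ∀ x y y', proj x y * proj x y' = if y = y' then proj x y else 0
  proj_sum : ∀ x, ∑ y, proj x y = 1
  /-- decoding unitaries -/
  Udec : A → Y → Matrix.unitaryGroup (S × A) ℂ

namespace Engine

variable {R S A B C M Y : Type*}
  [Fintype R] [Fintype S] [Fintype A] [Fintype B] [Fintype C] [Fintype M] [Fintype Y]
  [DecidableEq R] [DecidableEq S] [DecidableEq A] [DecidableEq B] [DecidableEq C]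
  [DecidableEq M] [DecidableEq Y]
  (G : Engine R S A B C M Y)

/-! ### Hamiltonians and thermal states -/

def HA : Matrix A A ℂ := Matrix.diagonal fun a => (G.εA a : ℂ)

def HY : Matrix Y Y ℂ := Matrix.diagonal fun y => (G.εY y : ℂ)

/-- Hamiltonian of `SA` outside the encoded part of the cycle. -/
def HSA : Matrix (S × A) (S × A) ℂ :=
  G.HS ⊗ₖ (1 : Matrix A A ℂ) + (1 : Matrix S S ℂ) ⊗ₖ G.HA

/-- Hamiltonian of the cold bath `B_c = A' C`. -/
def HBc : Matrix (A × C) (A × C) ℂ :=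
  G.HA ⊗ₖ (1 : Matrix C C ℂ) + (1 : Matrix A A ℂ) ⊗ₖ G.HC

/-- The Gibbs weights `p_X(x) = exp(-β_c ε_x) / Z`. -/
def pX (x : A) : ℝ :=
  Real.exp (-(G.εA x) / (G.kB * G.Tc)) / ∑ x', Real.exp (-(G.εA x') / (G.kB * G.Tc))

/-- The thermal state of the ancilla at temperature `T_c`. -/
def τA : Matrix A A ℂ := Matrix.diagonal fun x => (G.pX x : ℂ)

def τB : Matrix B B ℂ := thermal (1 / (G.kB * G.Th)) G.HB

def τC : Matrix C C ℂ := thermal (1 / (G.kB * G.Tc)) G.HC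

/-- The thermal state of the cold bath `B_c = A' C`. -/
def τBc : Matrix (A × C) (A × C) ℂ := G.τA ⊗ₖ G.τC

def τM : Matrix M M ℂ := thermal (1 / (G.kB * G.Tm)) G.HM

/-- `|ψ⟩⟨ψ|` on `RS`. -/
def ψψ : Matrix (R × S) (R × S) ℂ := Matrix.vecMulVec G.ψ (star G.ψ)

/-- `|y⟩⟨y|` on the memory `Y`. -/
def ketbra (y : Y) : Matrix Y Y ℂ := Matrix.single y y 1

/-! ### Operators on subsystems of `E` -/

/-- An operator on `SA`, as an operator on `E`. -/
def liftSA (u : Matrix (S × A) (S × A) ℂ) :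
    Matrix (EIdx R S A B C) (EIdx R S A B C) ℂ :=
  lift (fun t : EIdx R S A B C =>
    ((t.1.1.1.2, t.1.1.2), (t.1.1.1.1, t.1.2, t.2))) u

/-- An operator on `S A B_h`, as an operator on `E`. -/
def liftSAB (u : Matrix ((S × A) × B) ((S × A) × B) ℂ) :
    Matrix (EIdx R S A B C) (EIdx R S A B C) ℂ :=
  lift (fun t : EIdx R S A B C =>
    (((t.1.1.1.2, t.1.1.2), t.1.2), (t.1.1.1.1, t.2))) u

/-- An operator on `S A M`, as an operator on `E M`. -/
def liftSAM (u : Matrix ((S × A) × M) ((S × A) × M) ℂ) :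
    Matrix (EIdx R S A B C × M) (EIdx R S A B C × M) ℂ :=
  lift (fun t : EIdx R S A B C × M =>
    (((t.1.1.1.1.2, t.1.1.1.2), t.2), (t.1.1.1.1.1, t.1.1.2, t.1.2))) u

/-- The exchange of `A` with the subsystem `A'` of the cold bath, on basis labels of `E Y`. -/
def swapAA (t : EIdx R S A B C × Y) : EIdx R S A B C × Y :=
  ((((t.1.1.1.1, t.1.2.1), t.1.1.2), (t.1.1.1.2, t.1.2.2)), t.2)

/-! ### The states of the cycle

A state with argument `x` is the state of `E` (or of `E Y`) conditioned on the outcome `x` of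
the initial measurement. -/

/-- Initial state of `E`. -/
def eI : Matrix (EIdx R S A B C) (EIdx R S A B C) ℂ :=
  G.ψψ ⊗ₖ G.τA ⊗ₖ G.τB ⊗ₖ G.τBc

/-- State of `E` after the measurement of the energy of `A` with outcome `x`. -/
def e0 (x : A) : Matrix (EIdx R S A B C) (EIdx R S A B C) ℂ :=
  G.ψψ ⊗ₖ Matrix.single x x 1 ⊗ₖ G.τB ⊗ₖ G.τBc

/-- State of `E` after the encoding. -/
def eEnc (x : A) : Matrix (EIdx R S A B C) (EIdx R S A B C) ℂ :=
  liftSA (G.Uenc x).1 * G.e0 x * (liftSA (G.Uenc x).1)ᴴ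

/-- State of `E` after the interaction with the hot bath. -/
def e1 (x : A) : Matrix (EIdx R S A B C) (EIdx R S A B C) ℂ :=
  liftSAB G.Uh.1 * G.eEnc x * (liftSAB G.Uh.1)ᴴ

/-- Joint state of `E` and the apparatus `M` after their unitary interaction, from the state
`ρ` of `E` and the thermal state of `M`. -/
def interact (x : A) (ρ : Matrix (EIdx R S A B C) (EIdx R S A B C) ℂ) :
    Matrix (EIdx R S A B C × M) (EIdx R S A B C × M) ℂ :=
  liftSAM (G.Umeas x).1 * (ρ ⊗ₖ G.τM) * (liftSAM (G.Umeas x).1)ᴴ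

/-- The instrument element `N_{y|x}`, acting on the factor `SA` of `E`:
`Tr_M [U (ρ ⊗ τ_M) U† P_{y|x}]`. -/
def instrElem (x : A) (y : Y) (ρ : Matrix (EIdx R S A B C) (EIdx R S A B C) ℂ) :
    Matrix (EIdx R S A B C) (EIdx R S A B C) ℂ :=
  ptrace (fun (e : EIdx R S A B C) (k : M) => (e, k))
    (G.interact x ρ * ((1 : Matrix (EIdx R S A B C) (EIdx R S A B C) ℂ) ⊗ₖ G.proj x y))

/-- The joint action `N_{|x}(ρ) = ∑_y N_{y|x}(ρ) ⊗ |y⟩⟨y|` of the instrument on system and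
memory. -/
def instr (x : A) (ρ : Matrix (EIdx R S A B C) (EIdx R S A B C) ℂ) :
    Matrix (EIdx R S A B C × Y) (EIdx R S A B C × Y) ℂ :=
  ∑ y, G.instrElem x y ρ ⊗ₖ ketbra y

/-- State of `E Y` before the syndrome measurement. -/
def s1 (x : A) : Matrix (EIdx R S A B C × Y) (EIdx R S A B C × Y) ℂ :=
  G.e1 x ⊗ₖ ketbra G.y0

/-- State of `E Y` after the syndrome measurement. -/
def s2 (x : A) : Matrix (EIdx R S A B C × Y) (EIdx R S A B C × Y) ℂ := G.instr x (G.e1 x)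

/-- State of `E Y` after the error correction. -/
def s3 (x : A) : Matrix (EIdx R S A B C × Y) (EIdx R S A B C × Y) ℂ :=
  ∑ y, (liftSA (G.Udec x y).1 * G.instrElem x y (G.e1 x) * (liftSA (G.Udec x y).1)ᴴ)
    ⊗ₖ ketbra y

/-- State of `E Y` after the exchange of `A` with its copy in the cold bath. -/
def sF (x : A) : Matrix (EIdx R S A B C × Y) (EIdx R S A B C × Y) ℂ :=
  (G.s3 x).submatrix swapAA swapAA

/-- The controlled unitary `∑_y P_{y|x} ⊗ V_y` from `M` to the memory, with `V_y |0⟩ = |y⟩`. -/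
def Vmem (x : A) : Matrix ((EIdx R S A B C × M) × Y) ((EIdx R S A B C × M) × Y) ℂ :=
  ∑ y, ((1 : Matrix (EIdx R S A B C) (EIdx R S A B C) ℂ) ⊗ₖ G.proj x y) ⊗ₖ
    (Equiv.swap G.y0 y).permMatrix ℂ

/-- State of `E M Y` after the unitary model of the syndrome measurement. -/
def m2 (x : A) : Matrix ((EIdx R S A B C × M) × Y) ((EIdx R S A B C × M) × Y) ℂ :=
  G.Vmem x * (G.interact x (G.e1 x) ⊗ₖ ketbra G.y0) * (G.Vmem x)ᴴ

/-- Average over the outcome of the initial measurement. -/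
def avg {T : Type*} (s : A → Matrix T T ℂ) : Matrix T T ℂ := ∑ x, (G.pX x : ℂ) • s x

/-- The state `∑_x p_X(x) s_x ⊗ |x⟩⟨x|` that includes the register `X`. -/
def withX {T : Type*} (s : A → Matrix (T × Y) (T × Y) ℂ) :
    Matrix (T × (A × Y)) (T × (A × Y)) ℂ :=
  Matrix.of fun i j =>
    if i.2.1 = j.2.1 then (G.pX i.2.1 : ℂ) * s i.2.1 (i.1, i.2.2) (j.1, j.2.2) else 0

/-! ### Reduced states -/

def redSA (ρ : Matrix (EIdx R S A B C × Y) (EIdx R S A B C × Y) ℂ) :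
    Matrix (S × A) (S × A) ℂ :=
  ptrace (fun (p : S × A) (q : R × B × (A × C) × Y) =>
    (((((q.1, p.1), p.2), q.2.1), q.2.2.1), q.2.2.2)) ρ

def redY (ρ : Matrix (EIdx R S A B C × Y) (EIdx R S A B C × Y) ℂ) : Matrix Y Y ℂ :=
  ptrace (fun (y : Y) (e : EIdx R S A B C) => (e, y)) ρ

def redRS (ρ : Matrix (EIdx R S A B C × Y) (EIdx R S A B C × Y) ℂ) :
    Matrix (R × S) (R × S) ℂ :=
  ptrace (fun (p : R × S) (q : A × B × (A × C) × Y) =>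
    ((((p, q.1), q.2.1), q.2.2.1), q.2.2.2)) ρ

def redBh (ρ : Matrix (EIdx R S A B C × Y) (EIdx R S A B C × Y) ℂ) : Matrix B B ℂ :=
  ptrace (fun (b : B) (q : ((R × S) × A) × (A × C) × Y) => (((q.1, b), q.2.1), q.2.2)) ρ

def redBc (ρ : Matrix (EIdx R S A B C × Y) (EIdx R S A B C × Y) ℂ) :
    Matrix (A × C) (A × C) ℂ :=
  ptrace (fun (p : A × C) (q : (((R × S) × A) × B) × Y) => ((q.1, p), q.2)) ρ

def redM (ρ : Matrix ((EIdx R S A B C × M) × Y) ((EIdx R S A B C × M) × Y) ℂ) :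
    Matrix M M ℂ :=
  ptrace (fun (k : M) (q : EIdx R S A B C × Y) => ((q.1, k), q.2)) ρ

/-- Reduced state of `Y X`. -/
def redYX (ρ : Matrix (EIdx R S A B C × (A × Y)) (EIdx R S A B C × (A × Y)) ℂ) :
    Matrix (Y × A) (Y × A) ℂ :=
  ptrace (fun (p : Y × A) (e : EIdx R S A B C) => (e, (p.2, p.1))) ρ

/-- Reduced state of `X E`. -/
def redXE (ρ : Matrix (EIdx R S A B C × (A × Y)) (EIdx R S A B C × (A × Y)) ℂ) :
    Matrix (A × EIdx R S A B C) (A × EIdx R S A B C) ℂ :=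
  ptrace (fun (p : A × EIdx R S A B C) (y : Y) => (p.2, (p.1, y))) ρ

/-- The state of `E X Y` with its factors in the order `Y (E X)`. -/
def redYEX (ρ : Matrix (EIdx R S A B C × (A × Y)) (EIdx R S A B C × (A × Y)) ℂ) :
    Matrix (Y × (EIdx R S A B C × A)) (Y × (EIdx R S A B C × A)) ℂ :=
  ptrace (fun (p : Y × (EIdx R S A B C × A)) (_ : Unit) => (p.2.1, (p.2.2, p.1))) ρ

/-- Reduced state of `RSA (XY)`. -/
def redRSA (ρ : Matrix (EIdx R S A B C × (A × Y)) (EIdx R S A B C × (A × Y)) ℂ) :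
    Matrix (((R × S) × A) × (A × Y)) (((R × S) × A) × (A × Y)) ℂ :=
  ptrace (fun (p : ((R × S) × A) × (A × Y)) (q : B × (A × C)) =>
    (((p.1, q.1), q.2), p.2)) ρ

/-- Reduced state of `(YM) X`. -/
def redYMX (ρ : Matrix ((EIdx R S A B C × M) × (A × Y)) ((EIdx R S A B C × M) × (A × Y)) ℂ) :
    Matrix ((Y × M) × A) ((Y × M) × A) ℂ :=
  ptrace (fun (p : (Y × M) × A) (e : EIdx R S A B C) => ((e, p.1.2), (p.2, p.1.1))) ρ

/-- Reduced state of `(RSA M) (XY)`. -/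
def redRSAM (ρ : Matrix ((EIdx R S A B C × M) × (A × Y)) ((EIdx R S A B C × M) × (A × Y)) ℂ) :
    Matrix ((((R × S) × A) × M) × (A × Y)) ((((R × S) × A) × M) × (A × Y)) ℂ :=
  ptrace (fun (p : (((R × S) × A) × M) × (A × Y)) (q : B × (A × C)) =>
    ((((p.1.1, q.1), q.2), p.1.2), p.2)) ρ

/-! ### Information-theoretic quantities -/

/-- Entanglement fidelity `⟨ψ|σ_f^{RS}|ψ⟩`. -/
def Fe : ℝ := (star G.ψ ⬝ᵥ (redRS (G.avg G.sF) *ᵥ G.ψ)).re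

/-- Entropy exchange `H(RS)` of the final state. -/
def Se : ℝ := entropy (redRS (G.avg G.sF))

/-- `H(Y|X)` after the syndrome measurement. -/
def HYX : ℝ := condEntropy (redYX (G.withX G.s2))

/-- `H(X|E)` in the final state, before the registers are discarded. -/
def HXE : ℝ := condEntropy (redXE (G.withX G.sF))

/-- `H(Y|EX)` in the final state, before the registers are discarded. -/
def HYEX : ℝ := condEntropy (redYEX (G.withX G.sF))

/-! ### Heat, work and efficiency -/

/-- Heat absorbed from the hot bath. -/
def Qh : ℝ := expect G.τB G.HB - expect (redBh (G.avg G.sF)) G.HB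

/-- Heat absorbed from the cold bath. -/
def Qc : ℝ := expect G.τBc G.HBc - expect (redBc (G.avg G.sF)) G.HBc

/-- Heat absorbed from the measurement apparatus. -/
def Qmeas : ℝ := expect G.τM G.HM - expect (redM (G.avg G.m2)) G.HM

/-- The part of the measurement heat that is absorbed by the memory:
`Q_meas^Y = k_B T_m (ΔH(Y|X) - I(Y:M|X))`. -/
def QmeasY : ℝ :=
  G.kB * G.Tm * (condEntropy (redYX (G.withX G.s2)) - condEntropy (redYX (G.withX G.s1))
    - condMutualInfo (redYMX (G.withX G.m2)))

/-- The part of the measurement heat that is absorbed by `RSA`: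
`Q_meas^{RSA|Y} = k_B T_m (ΔH(RSA|XY) - I(RSA:M|XY))`. -/
def QmeasRSA : ℝ :=
  G.kB * G.Tm * (condEntropy (redRSA (G.withX G.s2)) - condEntropy (redRSA (G.withX G.s1))
    - condMutualInfo (redRSAM (G.withX G.m2)))

/-- Heat absorbed by the memory `Y` when it is erased, `⟨H^Y⟩_i - ⟨H^Y⟩_f`. -/
def Qerase : ℝ := expect (ketbra G.y0) G.HY - expect (redY (G.avg G.sF)) G.HY

/-- Internal energy of `RSAY` in the state `ρ` of `E Y`, for the Hamiltonian `H` of `SA`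
(the Hamiltonian of `R` is zero). -/
def energy (H : Matrix (S × A) (S × A) ℂ)
    (ρ : Matrix (EIdx R S A B C × Y) (EIdx R S A B C × Y) ℂ) : ℝ :=
  expect (redSA ρ) H + expect (redY ρ) G.HY

def Ui : ℝ := G.energy G.HSA (G.eI ⊗ₖ ketbra G.y0)
def U0 : ℝ := G.energy G.HSA (G.avg fun x => G.e0 x ⊗ₖ ketbra G.y0)
def Uen : ℝ := G.energy G.Hmid (G.avg fun x => G.eEnc x ⊗ₖ ketbra G.y0)
def U1 : ℝ := G.energy G.Hmid (G.avg G.s1)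
def U2 : ℝ := G.energy G.Hmid (G.avg G.s2)
def U3 : ℝ := G.energy G.HSA (G.avg G.s3)

/-- Internal energy of `RSAY` after the erasure of the memory. -/
def Uerase : ℝ := expect (redSA (G.avg G.sF)) G.HSA + expect (ketbra G.y0) G.HY

/-- Net change of the internal energy of `RSAY` over the cycle. -/
def ΔU : ℝ := G.Uerase - G.Ui

def Wenc : ℝ := G.Uen - G.U0

/-- Work of the measurement stage, by the first law `U_2 - U_1 = W_meas + Q_meas`. -/
def Wmeas : ℝ := G.U2 - G.U1 - G.Qmeas

def Wdec : ℝ := G.U3 - G.U2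

def Wtot : ℝ := G.Wenc + G.Wmeas + G.Wdec

/-- Input heat. -/
def Qinput : ℝ := G.Qh + G.QmeasY

/-- Thermodynamic efficiency of the engine. -/
def η : ℝ := -G.Wtot / G.Qinput

/-- Carnot efficiency. -/
def ηC : ℝ := 1 - G.Tc / G.Th

end Engine

end QEC

end

open scoped Matrix Kronecker ComplexOrder

set_option linter.unusedSectionVars false

/-! The inequality is a first law and a second law combined, with the entropy exchange `Se` as the
meeting point; the quantum Fano inequality then turns `Se` into a fidelity. Write β_c, β_h for the
inverse temperatures 1/(k_B T_c), 1/(k_B T_h).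

Second law (`second_law`). Given x, the state of E before the syndrome measurement is unitarily
equivalent to pure states tensored with thermal baths, so its entropy is that of the baths. A
positive trace-preserving map changes the entropy by at least minus the logarithm of its efficacy
(`entropy_sub_log_efficacy_le`), decoding and swap preserve the entropy of EY, and subadditivity
splits off Y. Averaging over x replaces the entropies of E given x by the entropy of the mean state,
at the cost of H(X|E) and the Shannon entropy of p_X; the latter equals the entropy of the thermal
ancilla, because p_X is its spectrum. Finally the entropy of E is at most `Se` plus the entropies of
A, B_h, A' and C, and the Gibbs variational principle (`thermal_facts`) bounds these by thermal
entropies minus β times the heat supplied. The swap matters here: A ends with its initial mean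
energy and contributes no heat. All thermal entropies cancel and leave β_c Q_c + β_h Q_h - H(Y|X) -
H(X|E) + Σ p_X(x)(-ln efficacy) ≤ `Se`.

First law (`first_law`). Energy is exchanged with the hot bath only through a unitary that conserves
the total energy, and A' leaves the cold bath only in the swap, so ΔU = W + Q_h + Q_meas + Q_c +
Q_erase. The efficiency term of the trade-off is the linear expression β_c(-W - Q_input) + β_h
Q_input. Eliminating W leaves the heats of the second law plus corrections controlled by the
assumptions and by `Qmeas_le`: the apparatus gives off at most k_B T_m times its entropy decrease,
and chain rules identify this bound with the sum of the Y and RSA parts of the measurement heat.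

All the entropy inequalities reduce to ln t ≤ t - 1 after passing to eigenbases: entropy is at most
the cross entropy of the diagonal in any orthonormal basis (`entropy_le_cross`). Subadditivity, the
variational principle and Fano differ only in the basis and the reference distribution; strong
subadditivity is not needed. -/

namespace QEC

/-! ### Entropy as a function of the spectrum -/

section Spectral

variable {n m : Type*} [Fintype n] [Fintype m] [DecidableEq n] [DecidableEq m]

open Polynomial in
/-- The entropy of `U diag(d) U†` is the Shannon expression of the spectrum `d`. -/
theorem entropy_eq_sum_of_charpoly {ρ : Matrix n n ℂ} (h : ρ.IsHermitian) (d : m → ℝ)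
    (hd : ρ.charpoly = ∏ i, (X - C (d i : ℂ))) : entropy ρ = ∑ i, Real.negMulLog (d i) := by
  have h1 : entropy ρ = ∑ i, Real.negMulLog (h.eigenvalues i) := by
    have h3 : h.cfc id = ρ := h.spectral_theorem.symm
    have h2 : ρ * h.cfc Real.log = h.cfc (fun x => x * Real.log x) := by
      refine (congrArg (· * h.cfc Real.log) h3.symm).trans ?_
      simp only [Matrix.IsHermitian.cfc]
      rw [← map_mul, Matrix.diagonal_mul_diagonal]
      simp [Function.comp_def]
    rw [entropy, h.cfc_eq, h2, Matrix.IsHermitian.cfc, Unitary.conjStarAlgAut_apply,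
      Matrix.trace_mul_comm, ← mul_assoc]
    simp [Matrix.trace_diagonal, Real.negMulLog]
  -- Both lists of eigenvalues are the multiset of roots of one polynomial. Comparing multisets
  -- avoids a bijection between the index types, which may differ.
  have h2 := h.roots_charpoly_eq_eigenvalues
  have h4 : (∏ i, (X - C (d i : ℂ))).roots = Finset.univ.val.map (fun i => (d i : ℂ)) := by
    have h5 := Polynomial.roots_multiset_prod_X_sub_C (Finset.univ.val.map fun i => (d i : ℂ))
    rw [Multiset.map_map] at h5
    exact h5
  rw [hd, h4] at h2
  have h5 := congrArg (fun s : Multiset ℂ => (s.map fun z => Real.negMulLog z.re).sum) h2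
  simp only [Multiset.map_map, Function.comp_def] at h5
  rw [h1]
  simpa using h5.symm

theorem entropy_eq_sum_eigenvalues {ρ : Matrix n n ℂ} (h : ρ.IsHermitian) :
    entropy ρ = ∑ i, Real.negMulLog (h.eigenvalues i) :=
  entropy_eq_sum_of_charpoly h _ h.charpoly_eq

/-- The characteristic polynomial determines the spectrum with multiplicities. This form compares
matrices over different index types, so unitary conjugation and relabelling of the basis become
identities of polynomials. -/
theorem entropy_eq_of_charpoly {ρ : Matrix n n ℂ} {σ : Matrix m m ℂ} (hρ : ρ.IsHermitian)
    (hσ : σ.IsHermitian) (h : ρ.charpoly = σ.charpoly) : entropy ρ = entropy σ := by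
  rw [entropy_eq_sum_eigenvalues hσ]
  exact entropy_eq_sum_of_charpoly hρ _ (h.trans hσ.charpoly_eq)

theorem entropy_conj {ρ U : Matrix n n ℂ} (hρ : ρ.IsHermitian) (hU : Uᴴ * U = 1) :
    entropy (U * ρ * Uᴴ) = entropy ρ := by
  refine entropy_eq_of_charpoly (Matrix.isHermitian_mul_mul_conjTranspose U hρ) hρ ?_
  rw [Matrix.charpoly_mul_comm, ← mul_assoc, hU, one_mul]

theorem entropy_submatrix {ρ : Matrix n n ℂ} (hρ : ρ.IsHermitian) (e : m ≃ n) :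
    entropy (ρ.submatrix e e) = entropy ρ :=
  entropy_eq_of_charpoly (hρ.submatrix e) hρ (Matrix.charpoly_reindex e.symm ρ)

theorem entropy_diagonal (d : n → ℝ) :
    entropy (Matrix.diagonal fun i => (d i : ℂ)) = ∑ i, Real.negMulLog (d i) :=
  entropy_eq_sum_of_charpoly (by
    rw [Matrix.isHermitian_diagonal_iff]; intro i; simp [IsSelfAdjoint])
    _ (Matrix.charpoly_diagonal _)

/-- Spectral decomposition `ρ = U diag(d) U†`. -/
theorem exists_diagonalization {ρ : Matrix n n ℂ} (h : ρ.IsHermitian) :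
    ∃ (U : Matrix n n ℂ) (d : n → ℝ), Uᴴ * U = 1 ∧ U * Uᴴ = 1 ∧
      ρ = U * Matrix.diagonal (fun i => (d i : ℂ)) * Uᴴ ∧
      entropy ρ = ∑ i, Real.negMulLog (d i) := by
  refine ⟨h.eigenvectorUnitary.1, h.eigenvalues, ?_, ?_, ?_, entropy_eq_sum_eigenvalues h⟩
  · exact Matrix.mem_unitaryGroup_iff'.1 h.eigenvectorUnitary.2
  · exact Matrix.mem_unitaryGroup_iff.1 h.eigenvectorUnitary.2
  · conv_lhs => rw [h.spectral_theorem]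
    rfl

/-- Each eigenvalue satisfies d² = d, and -t ln t vanishes at 0 and at 1. No rank assumption is
needed. -/
theorem entropy_of_idempotent {ρ : Matrix n n ℂ} (h : ρ.IsHermitian) (h2 : ρ * ρ = ρ) :
    entropy ρ = 0 := by
  obtain ⟨U, d, hU, hU', hρ, hS⟩ := exists_diagonalization h
  have hD : Matrix.diagonal (fun i => (d i : ℂ)) = Uᴴ * ρ * U := by
    rw [hρ]
    simp only [mul_assoc, hU, mul_one]
    rw [← mul_assoc, hU, one_mul]
  have h3 : Matrix.diagonal (fun i => (d i : ℂ)) * Matrix.diagonal (fun i => (d i : ℂ))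
      = Matrix.diagonal (fun i => (d i : ℂ)) := by
    rw [hD]
    calc Uᴴ * ρ * U * (Uᴴ * ρ * U) = Uᴴ * ρ * (U * Uᴴ) * ρ * U := by simp only [mul_assoc]
      _ = Uᴴ * (ρ * ρ) * U := by rw [hU', mul_one]; simp only [mul_assoc]
      _ = _ := by rw [h2]
  rw [Matrix.diagonal_mul_diagonal] at h3
  have h4 := Matrix.diagonal_injective h3
  rw [hS]
  refine Finset.sum_eq_zero fun i _ => ?_
  have h5 := congrFun h4 i
  have h6 : d i * d i = d i := by exact_mod_cast h5
  have h7 : d i = 0 ∨ d i = 1 := by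
    rcases eq_or_ne (d i) 0 with h | h
    · exact Or.inl h
    · exact Or.inr (mul_left_cancel₀ h (by rw [h6, mul_one]))
  rcases h7 with h | h <;> simp [h]

end Spectral

/-! ### Shannon entropy: Gibbs' inequality and the classical efficacy bound -/

section Classical

variable {ι κ : Type*} [Fintype ι] [Fintype κ]

/-- This is ln t ≤ t - 1 at t = q/P, multiplied by P. The support condition is essential because
`Real.log 0 = 0`: without it the cross term would silently vanish where it should be infinite. -/
theorem negMulLog_le_of_pos {P q : ℝ} (hP : 0 ≤ P) (hq : 0 ≤ q) (h : q = 0 → P = 0) :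
    Real.negMulLog P ≤ -(P * Real.log q) + q - P := by
  rcases hP.eq_or_lt with rfl | hP
  · simpa using hq
  have hq : 0 < q := lt_of_le_of_ne hq fun h0 => hP.ne' (h h0.symm)
  have := Real.log_le_sub_one_of_pos (div_pos hq hP)
  rw [Real.log_div hq.ne' hP.ne'] at this
  have h2 := mul_le_mul_of_nonneg_left this hP.le
  have h3 : P * (q / P - 1) = q - P := by field_simp
  rw [h3] at h2
  rw [Real.negMulLog]
  linarith

/-- Gibbs' inequality. -/
theorem gibbs {P q : ι → ℝ} (hP : ∀ i, 0 ≤ P i) (hq : ∀ i, 0 ≤ q i)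
    (h : ∀ i, q i = 0 → P i = 0) (hs : ∑ i, q i ≤ ∑ i, P i) :
    ∑ i, Real.negMulLog (P i) ≤ -∑ i, P i * Real.log (q i) := by
  have : ∑ i, Real.negMulLog (P i) ≤ ∑ i, (-(P i * Real.log (q i)) + q i - P i) :=
    Finset.sum_le_sum fun i _ => negMulLog_le_of_pos (hP i) (hq i) (h i)
  rw [Finset.sum_sub_distrib, Finset.sum_add_distrib, Finset.sum_neg_distrib] at this
  linarith

/-- Entropy gain of a stochastic map, bounded by the classical efficacy. -/
theorem sum_negMulLog_sub_log_le {p : ι → ℝ} {T : ι → κ → ℝ} {s : κ → ℝ} (hp : ∀ i, 0 ≤ p i)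
    (hT : ∀ i j, 0 ≤ T i j) (hT1 : ∀ i, ∑ j, T i j = 1) (hp1 : ∑ i, p i = 1)
    (hs : ∀ j, s j = ∑ i, p i * T i j) :
    ∑ i, Real.negMulLog (p i) - Real.log (∑ i, ∑ j, T i j * s j)
      ≤ ∑ j, Real.negMulLog (s j) := by
  set c := ∑ i, ∑ j, T i j * s j with hc
  have hs0 : ∀ j, 0 ≤ s j := fun j => by
    rw [hs]; exact Finset.sum_nonneg fun i _ => mul_nonneg (hp i) (hT i j)
  have hs1 : ∑ j, s j = 1 := by
    simp_rw [hs]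
    rw [Finset.sum_comm]
    simp_rw [← Finset.mul_sum, hT1, mul_one, hp1]
  have hple : ∀ i, p i ≤ 1 := fun i => by
    rw [← hp1]; exact Finset.single_le_sum (fun i _ => hp i) (Finset.mem_univ i)
  -- Since every p_i is at most 1, c dominates Σ s_j², which is positive because s sums to 1.
  have hcpos : 0 < c := by
    have h1 : ∑ j, s j * s j ≤ c := by
      calc ∑ j, s j * s j = ∑ j, ∑ i, p i * T i j * s j := by
            refine Finset.sum_congr rfl fun j _ => ?_
            rw [← Finset.sum_mul, ← hs]
        _ ≤ ∑ j, ∑ i, T i j * s j := by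
            refine Finset.sum_le_sum fun j _ => Finset.sum_le_sum fun i _ => ?_
            have := mul_le_mul_of_nonneg_right (hple i) (mul_nonneg (hT i j) (hs0 j))
            linarith
        _ = c := Finset.sum_comm
    refine lt_of_lt_of_le ?_ h1
    obtain ⟨j, -, hj⟩ := Finset.exists_ne_zero_of_sum_ne_zero (by rw [hs1]; exact one_ne_zero)
    exact Finset.sum_pos' (fun j _ => mul_self_nonneg _) ⟨j, Finset.mem_univ j, mul_self_pos.2 hj⟩
  -- the joint distribution against the subnormalised one `T s / c`
  have key : ∀ i j, -(p i * T i j * Real.log (p i)) + p i * T i j * Real.log (s j)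
      - p i * T i j * Real.log c ≤ T i j * s j / c - p i * T i j := by
    intro i j
    rcases (hp i).eq_or_lt with h0 | hpi
    · simp [← h0]; exact div_nonneg (mul_nonneg (hT i j) (hs0 j)) hcpos.le
    rcases (hT i j).eq_or_lt with h0 | hTi
    · simp [← h0]
    have hsj : 0 < s j := by
      rw [hs]
      exact Finset.sum_pos' (fun i _ => mul_nonneg (hp i) (hT i j))
        ⟨i, Finset.mem_univ i, mul_pos hpi hTi⟩
    have h1 := Real.log_le_sub_one_of_pos (div_pos hsj (mul_pos hpi hcpos))
    rw [Real.log_div hsj.ne' (mul_pos hpi hcpos).ne', Real.log_mul hpi.ne' hcpos.ne'] at h1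
    have h2 := mul_le_mul_of_nonneg_left h1 (mul_pos hpi hTi).le
    have h3 : p i * T i j * (s j / (p i * c) - 1) = T i j * s j / c - p i * T i j := by
      field_simp
    rw [h3] at h2
    linarith
  -- Summed over all pairs, the right-hand side is 1 - 1: the subnormalised weights T s were divided
  -- by their total c.
  have sum := Finset.sum_le_sum fun i (_ : i ∈ Finset.univ) =>
    Finset.sum_le_sum fun j (_ : j ∈ Finset.univ) => key i j
  simp only [Finset.sum_sub_distrib, Finset.sum_add_distrib, Finset.sum_neg_distrib,
    ← Finset.sum_div] at sum
  rw [← hc, div_self hcpos.ne'] at sum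
  have e1 : ∑ i, ∑ j, p i * T i j = 1 := by
    simp_rw [← Finset.mul_sum, hT1, mul_one, hp1]
  have e2 : ∑ i, ∑ j, p i * T i j * Real.log (p i) = -∑ i, Real.negMulLog (p i) := by
    rw [← Finset.sum_neg_distrib]
    refine Finset.sum_congr rfl fun i _ => ?_
    rw [← Finset.sum_mul, ← Finset.mul_sum, hT1]
    simp [Real.negMulLog]
  have e3 : ∑ i, ∑ j, p i * T i j * Real.log (s j) = -∑ j, Real.negMulLog (s j) := by
    rw [Finset.sum_comm, ← Finset.sum_neg_distrib]
    refine Finset.sum_congr rfl fun j _ => ?_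
    rw [← Finset.sum_mul, ← hs]
    simp [Real.negMulLog]
  have e4 : ∑ i, ∑ j, p i * T i j * Real.log c = Real.log c := by
    simp_rw [← Finset.sum_mul]; rw [e1, one_mul]
  rw [e1, e2, e3, e4] at sum
  linarith

end Classical

end QEC

/-! ### Density matrices and partial traces -/

namespace QEC

/-- Density matrices. -/
def IsState {n : Type*} [Fintype n] (ρ : Matrix n n ℂ) : Prop :=
  ρ.PosSemidef ∧ ρ.trace = 1

section Ptrace

variable {T P Q n m : Type*}
variable [Fintype T] [Fintype P] [Fintype Q] [Fintype n] [Fintype m]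
variable [DecidableEq T] [DecidableEq P] [DecidableEq Q] [DecidableEq n] [DecidableEq m]

/-- Partial trace over the second factor. -/
abbrev trRight (ρ : Matrix (P × Q) (P × Q) ℂ) : Matrix P P ℂ :=
  ptrace (fun p q => (p, q)) ρ

/-- Partial trace over the first factor. -/
abbrev trLeft (ρ : Matrix (P × Q) (P × Q) ℂ) : Matrix Q Q ℂ :=
  ptrace (fun q p => (p, q)) ρ

theorem trRight_kron_one_mul (u : Matrix P P ℂ) (ρ : Matrix (P × Q) (P × Q) ℂ) :
    trRight ((u ⊗ₖ (1 : Matrix Q Q ℂ)) * ρ) = u * trRight ρ := by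
  ext i j
  simp only [ptrace, Matrix.of_apply, Matrix.mul_apply, Fintype.sum_prod_type,
    Matrix.kroneckerMap_apply, Matrix.one_apply, mul_ite, mul_one, mul_zero, ite_mul, zero_mul,
    Finset.sum_ite_eq, Finset.mem_univ, if_true, Finset.mul_sum]
  exact Finset.sum_comm

theorem trRight_mul_kron_one (u : Matrix P P ℂ) (ρ : Matrix (P × Q) (P × Q) ℂ) :
    trRight (ρ * (u ⊗ₖ (1 : Matrix Q Q ℂ))) = trRight ρ * u := by
  ext i j
  simp only [ptrace, Matrix.of_apply, Matrix.mul_apply, Fintype.sum_prod_type,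
    Matrix.kroneckerMap_apply, Matrix.one_apply, mul_ite, mul_one, mul_zero,
    Finset.sum_ite_eq', Finset.mem_univ, if_true, Finset.sum_mul]
  exact Finset.sum_comm

/-- Cyclicity of the partial trace, valid only for operators on the factor that is traced out. It
moves the apparatus projectors from one side of a state to the other. -/
theorem trRight_one_kron_comm (w : Matrix Q Q ℂ) (ρ : Matrix (P × Q) (P × Q) ℂ) :
    trRight (((1 : Matrix P P ℂ) ⊗ₖ w) * ρ) = trRight (ρ * ((1 : Matrix P P ℂ) ⊗ₖ w)) := by
  ext i j
  simp only [ptrace, Matrix.of_apply, Matrix.mul_apply, Fintype.sum_prod_type,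
    Matrix.kroneckerMap_apply, Matrix.one_apply, ite_mul, mul_ite, one_mul, zero_mul, mul_zero]
  rw [Finset.sum_congr rfl fun q _ => Finset.sum_comm]
  simp only [Finset.sum_ite_eq, Finset.mem_univ, if_true]
  rw [Finset.sum_comm]
  conv_rhs => rw [Finset.sum_congr rfl fun q _ => Finset.sum_comm]
  simp only [Finset.sum_ite_eq', Finset.mem_univ, if_true]
  exact Finset.sum_congr rfl fun _ _ => Finset.sum_congr rfl fun _ _ => mul_comm _ _

theorem trLeft_eq (ρ : Matrix (P × Q) (P × Q) ℂ) :
    trLeft ρ = trRight (ρ.submatrix Prod.swap Prod.swap) := rfl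

theorem trace_submatrix_equiv (e : n ≃ m) (ρ : Matrix m m ℂ) :
    (ρ.submatrix e e).trace = ρ.trace :=
  Equiv.sum_comp e fun i => ρ i i

theorem trace_trRight (ρ : Matrix (P × Q) (P × Q) ℂ) : (trRight ρ).trace = ρ.trace := by
  simp [ptrace, Matrix.trace, Fintype.sum_prod_type]

theorem ptrace_eq_trRight (e : P × Q ≃ T) (ρ : Matrix T T ℂ) :
    ptrace (fun p q => e (p, q)) ρ = trRight (ρ.submatrix e e) := rfl

theorem trace_ptrace (e : P × Q ≃ T) (ρ : Matrix T T ℂ) :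
    (ptrace (fun p q => e (p, q)) ρ).trace = ρ.trace := by
  rw [ptrace_eq_trRight, trace_trRight, trace_submatrix_equiv]

/-- A partial trace is a sum of submatrices, and each one stays positive whatever the gluing map is;
bijectivity matters only for the trace. -/
theorem posSemidef_ptrace (g : P → Q → T) {ρ : Matrix T T ℂ} (h : ρ.PosSemidef) :
    (ptrace g ρ).PosSemidef := by
  have : ptrace g ρ = ∑ q, ρ.submatrix (fun p => g p q) (fun p => g p q) := by
    ext i j; simp [ptrace, Matrix.sum_apply]
  rw [this]
  exact Matrix.posSemidef_sum _ fun q _ => h.submatrix _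

theorem IsState.ptrace {ρ : Matrix T T ℂ} (h : IsState ρ) (e : P × Q ≃ T) :
    IsState (ptrace (fun p q => e (p, q)) ρ) :=
  ⟨posSemidef_ptrace _ h.1, by rw [trace_ptrace, h.2]⟩

theorem IsState.trRight {ρ : Matrix (P × Q) (P × Q) ℂ} (h : IsState ρ) : IsState (trRight ρ) :=
  h.ptrace (Equiv.refl _)

theorem IsState.trLeft {ρ : Matrix (P × Q) (P × Q) ℂ} (h : IsState ρ) : IsState (trLeft ρ) :=
  h.ptrace (Equiv.prodComm _ _)

theorem IsState.submatrix {ρ : Matrix n n ℂ} (h : IsState ρ) (e : m ≃ n) :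
    IsState (ρ.submatrix e e) := ⟨h.1.submatrix e, by rw [trace_submatrix_equiv, h.2]⟩

theorem IsState.conj {ρ U : Matrix n n ℂ} (h : IsState ρ) (hU : Uᴴ * U = 1) :
    IsState (U * ρ * Uᴴ) :=
  ⟨h.1.mul_mul_conjTranspose_same U, by
    rw [Matrix.trace_mul_comm, ← mul_assoc, hU, one_mul, h.2]⟩

theorem IsState.kron {ρ : Matrix P P ℂ} {σ : Matrix Q Q ℂ} (h : IsState ρ) (h' : IsState σ) :
    IsState (ρ ⊗ₖ σ) :=
  ⟨h.1.kronecker h'.1, by rw [Matrix.trace_kronecker, h.2, h'.2, one_mul]⟩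

theorem IsState.herm {ρ : Matrix n n ℂ} (h : IsState ρ) : ρ.IsHermitian := h.1.isHermitian

theorem isState_single (i : n) : IsState (Matrix.single i i (1 : ℂ)) := by
  constructor
  · rw [← Matrix.diagonal_single]
    refine Matrix.PosSemidef.diagonal fun j => ?_
    by_cases h : j = i
    · subst h; simp
    · simp [h]
  · simp

/-- Average of states over a probability distribution. -/
theorem isState_sum {ι : Type*} [Fintype ι] {p : ι → ℝ} (hp : ∀ i, 0 ≤ p i) (h1 : ∑ i, p i = 1)
    {s : ι → Matrix n n ℂ} (hs : ∀ i, IsState (s i)) : IsState (∑ i, (p i : ℂ) • s i) := by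
  constructor
  · exact Matrix.posSemidef_sum _ fun i _ => (hs i).1.smul (by exact_mod_cast hp i)
  · simp only [Matrix.trace_sum, Matrix.trace_smul, (hs _).2, smul_eq_mul, mul_one]
    exact_mod_cast h1

theorem isState_diagonal {p : n → ℝ} (hp : ∀ i, 0 ≤ p i) (h1 : ∑ i, p i = 1) :
    IsState (Matrix.diagonal fun i => (p i : ℂ)) := by
  constructor
  · exact Matrix.PosSemidef.diagonal fun i => by simpa using hp i
  · rw [Matrix.trace_diagonal]; exact_mod_cast h1

theorem expect_trRight (ρ : Matrix (P × Q) (P × Q) ℂ) (H : Matrix P P ℂ) :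
    expect (trRight ρ) H = expect ρ (H ⊗ₖ (1 : Matrix Q Q ℂ)) := by
  rw [expect, expect, ← trRight_mul_kron_one, trace_trRight]

theorem expect_submatrix (e : n ≃ m) (ρ H : Matrix m m ℂ) :
    expect (ρ.submatrix e e) (H.submatrix e e) = expect ρ H := by
  rw [expect, expect, Matrix.submatrix_mul_equiv, trace_submatrix_equiv]

theorem expect_ptrace (e : P × Q ≃ T) (ρ : Matrix T T ℂ) (H : Matrix P P ℂ) :
    expect (ptrace (fun p q => e (p, q)) ρ) H = expect ρ (lift e.symm H) := by
  rw [ptrace_eq_trRight, expect_trRight, ← expect_submatrix e ρ]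
  congr 1
  ext i j
  simp [lift]

theorem expect_sum {ι : Type*} [Fintype ι] (p : ι → ℝ) (s : ι → Matrix n n ℂ)
    (H : Matrix n n ℂ) :
    expect (∑ i, (p i : ℂ) • s i) H = ∑ i, p i * expect (s i) H := by
  simp [expect, Finset.sum_mul, Matrix.trace_sum]

theorem expect_add (ρ H H' : Matrix n n ℂ) : expect ρ (H + H') = expect ρ H + expect ρ H' := by
  simp [expect, mul_add]

end Ptrace

/-! ### Entropy of product states and of classical-quantum states -/

section Entropy

variable {T P Q n m : Type*}
variable [Fintype T] [Fintype P] [Fintype Q] [Fintype n] [Fintype m]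
variable [DecidableEq T] [DecidableEq P] [DecidableEq Q] [DecidableEq n] [DecidableEq m]

theorem entropy_conj_diagonal {U : Matrix n n ℂ} (hU : Uᴴ * U = 1) (d : n → ℝ) :
    entropy (U * Matrix.diagonal (fun i => (d i : ℂ)) * Uᴴ) = ∑ i, Real.negMulLog (d i) := by
  rw [entropy_conj ?_ hU, entropy_diagonal]
  rw [Matrix.isHermitian_diagonal_iff]; intro i; simp [IsSelfAdjoint]

theorem sum_eigenvalues {U : Matrix n n ℂ} (hU : Uᴴ * U = 1) (d : n → ℝ)
    (h : (U * Matrix.diagonal (fun i => (d i : ℂ)) * Uᴴ).trace = 1) : ∑ i, d i = 1 := by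
  rw [Matrix.trace_mul_comm, ← mul_assoc, hU, one_mul, Matrix.trace_diagonal] at h
  exact_mod_cast h

/-- The spectrum of the product consists of the products d_i c_j; the product rule for -t ln t
together with both traces being 1 separates the sum. -/
theorem entropy_kron {ρ : Matrix P P ℂ} {σ : Matrix Q Q ℂ} (h : IsState ρ) (h' : IsState σ) :
    entropy (ρ ⊗ₖ σ) = entropy ρ + entropy σ := by
  obtain ⟨U, d, hU, -, hρ, hS⟩ := exists_diagonalization h.herm
  obtain ⟨V, c, hV, -, hσ, hS'⟩ := exists_diagonalization h'.herm
  have hd : ∑ i, d i = 1 := sum_eigenvalues hU d (hρ ▸ h.2)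
  have hc : ∑ i, c i = 1 := sum_eigenvalues hV c (hσ ▸ h'.2)
  have e : ρ ⊗ₖ σ = (U ⊗ₖ V) * Matrix.diagonal (fun i : P × Q => ((d i.1 * c i.2 : ℝ) : ℂ)) *
      (U ⊗ₖ V)ᴴ := by
    rw [hρ, hσ, Matrix.conjTranspose_kronecker, Matrix.mul_kronecker_mul,
      Matrix.mul_kronecker_mul, Matrix.diagonal_kronecker_diagonal]
    simp
  rw [e, entropy_conj_diagonal, hS, hS', Fintype.sum_prod_type]
  · simp_rw [Real.negMulLog_mul, Finset.sum_add_distrib, ← Finset.sum_mul, ← Finset.mul_sum]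
    rw [← Finset.sum_mul, hd, hc]
    ring
  · rw [Matrix.conjTranspose_kronecker, ← Matrix.mul_kronecker_mul, hU, hV,
      Matrix.one_kronecker_one]

/-- The classical-quantum operator with blocks `p x • s x`. -/
def block (p : P → ℝ) (s : P → Matrix T T ℂ) : Matrix (T × P) (T × P) ℂ :=
  Matrix.of fun i j => if i.2 = j.2 then (p i.2 : ℂ) * s i.2 i.1 j.1 else 0

theorem block_mul (p q : P → ℝ) (s t : P → Matrix T T ℂ) :
    block p s * block q t = block (fun x => p x * q x) (fun x => s x * t x) := by
  ext ⟨i, x⟩ ⟨j, z⟩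
  simp only [block, Matrix.mul_apply, Fintype.sum_prod_type, Matrix.of_apply]
  rw [Finset.sum_comm]
  by_cases h : x = z
  · subst h
    rw [Finset.sum_eq_single x]
    · simp [Finset.mul_sum]
      exact Finset.sum_congr rfl fun _ _ => by ring
    · intro b _ hb; simp [Ne.symm hb]
    · simp
  · simp only [h, if_false]
    refine Finset.sum_eq_zero fun w _ => Finset.sum_eq_zero fun _ _ => ?_
    by_cases hw : x = w
    · subst hw; simp [h]
    · simp [hw]

theorem block_conjTranspose (p : P → ℝ) (s : P → Matrix T T ℂ) :
    (block p s)ᴴ = block p fun x => (s x)ᴴ := by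
  ext ⟨i, x⟩ ⟨j, z⟩
  simp only [block, Matrix.conjTranspose_apply, Matrix.of_apply]
  by_cases h : x = z
  · subst h; simp
  · simp [h, Ne.symm h]

/-- The blocks are diagonalised by one block unitary, so the spectrum is p_x times that of s_x. The
product rule for -t ln t holds for all reals, hence no positivity or normalisation of p enters. -/
theorem entropy_block {p : P → ℝ} {s : P → Matrix T T ℂ} (hs : ∀ x, IsState (s x)) :
    entropy (block p s) = ∑ x, Real.negMulLog (p x) + ∑ x, p x * entropy (s x) := by
  choose U d hU hU' hρ hS using fun x => exists_diagonalization (hs x).herm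
  have hd : ∀ x, ∑ i, d x i = 1 := fun x => sum_eigenvalues (hU x) (d x) ((hρ x) ▸ (hs x).2)
  have e : block p s = block (fun _ => 1) U *
      Matrix.diagonal (fun i : T × P => ((p i.2 * d i.2 i.1 : ℝ) : ℂ)) *
      (block (fun _ => 1) U)ᴴ := by
    have : Matrix.diagonal (fun i : T × P => ((p i.2 * d i.2 i.1 : ℝ) : ℂ))
        = block p fun x => Matrix.diagonal fun i => (d x i : ℂ) := by
      ext ⟨i, x⟩ ⟨j, z⟩
      simp only [block, Matrix.diagonal_apply, Matrix.of_apply, Prod.mk.injEq]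
      by_cases h : x = z <;> by_cases h' : i = j <;> simp [h, h']
    rw [this, block_conjTranspose, block_mul, block_mul]
    simp only [one_mul, mul_one]
    congr 1
    exact funext hρ
  rw [e, entropy_conj_diagonal, Fintype.sum_prod_type, Finset.sum_comm, ← Finset.sum_add_distrib]
  · refine Finset.sum_congr rfl fun x _ => ?_
    simp_rw [Real.negMulLog_mul, Finset.sum_add_distrib, ← Finset.sum_mul, ← Finset.mul_sum]
    rw [hd, hS]
    ring
  · rw [block_conjTranspose, block_mul]
    ext ⟨i, x⟩ ⟨j, z⟩
    by_cases h : x = z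
    · subst h; simp [block, hU, Matrix.one_apply]
    · simp [block, h]

theorem isState_block {p : P → ℝ} {s : P → Matrix T T ℂ} (hp : ∀ i, 0 ≤ p i)
    (h1 : ∑ i, p i = 1) (hs : ∀ x, IsState (s x)) : IsState (block p s) := by
  have : block p s = ∑ x, (p x : ℂ) • (s x ⊗ₖ Matrix.single x x (1 : ℂ)) := by
    ext ⟨i, x⟩ ⟨j, z⟩
    simp only [block, Matrix.of_apply, Matrix.sum_apply, Matrix.smul_apply,
      Matrix.kroneckerMap_apply, Matrix.single_apply, smul_eq_mul]
    by_cases h : x = z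
    · subst h
      simp
    · simp only [h, if_false]
      refine (Finset.sum_eq_zero fun w _ => ?_).symm
      by_cases hw : w = x
      · subst hw; simp [h]
      · simp [hw]
  rw [this]
  exact isState_sum hp h1 fun x => (hs x).kron (isState_single x)

end Entropy

end QEC

namespace QEC

/-! ### Entropy inequalities: efficacy, subadditivity, Gibbs states, Fano -/

section Inequalities

variable {P Q n m : Type*}
variable [Fintype P] [Fintype Q] [Fintype n] [Fintype m]
variable [DecidableEq P] [DecidableEq Q] [DecidableEq n] [DecidableEq m]

theorem re_diag_nonneg {ρ : Matrix n n ℂ} (h : ρ.PosSemidef) (i : n) : 0 ≤ (ρ i i).re :=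
  (Complex.nonneg_iff.1 h.diag_nonneg).1

theorem ofReal_re_diag {ρ : Matrix n n ℂ} (h : ρ.IsHermitian) (i : n) :
    ((ρ i i).re : ℂ) = ρ i i := h.coe_re_apply_self i

theorem conj_diagonal_eq_sum (U : Matrix n n ℂ) (d : n → ℝ) :
    U * Matrix.diagonal (fun i => (d i : ℂ)) * Uᴴ
      = ∑ i, (d i : ℂ) • (U * Matrix.single i i 1 * Uᴴ) := by
  have : Matrix.diagonal (fun i => (d i : ℂ)) = ∑ i, (d i : ℂ) • Matrix.single i i (1 : ℂ) := by
    ext a b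
    simp only [Matrix.diagonal_apply, Matrix.sum_apply, Matrix.smul_apply, Matrix.single_apply,
      smul_eq_mul]
    by_cases h : a = b
    · subst h; simp
    · simp only [h, if_false]
      refine (Finset.sum_eq_zero fun w _ => ?_).symm
      by_cases hw : w = a
      · subst hw; simp [h]
      · simp [hw]
  rw [this, Matrix.mul_sum, Matrix.sum_mul]
  simp only [Matrix.mul_smul, Matrix.smul_mul]

/-- The diagonal entries of the adjoint pair its argument with N(|i⟩⟨i|), and these images add up to
N(1). In this form any orthonormal basis can resolve the identity, in particular an eigenbasis of ρ.
-/
theorem efficacy_eq (N : Matrix n n ℂ →ₗ[ℂ] Matrix m m ℂ) (ρ : Matrix n n ℂ) :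
    efficacy N ρ = (N ρ * N 1).trace.re := by
  have h1 : (1 : Matrix n n ℂ) = ∑ i, Matrix.single i i 1 := by
    rw [← Matrix.diagonal_one]
    exact (Matrix.sum_single_eq_diagonal _).symm
  conv_rhs => rw [h1]
  rw [efficacy, map_sum, Matrix.mul_sum, Matrix.trace_sum]
  rfl

theorem conj_cancel {U : Matrix n n ℂ} (hU : Uᴴ * U = 1) (X : Matrix n n ℂ) :
    Uᴴ * (U * X * Uᴴ) * U = X := by
  calc Uᴴ * (U * X * Uᴴ) * U = (Uᴴ * U) * X * (Uᴴ * U) := by simp only [mul_assoc]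
    _ = X := by rw [hU, one_mul, mul_one]

/-- The operator b on the discarded factor cycles round the partial trace and meets its adjoint; a
may be arbitrary. -/
theorem trRight_kron_conj (a : Matrix P P ℂ) {b : Matrix Q Q ℂ} (hb : b * bᴴ = 1)
    (X : Matrix (P × Q) (P × Q) ℂ) :
    trRight ((aᴴ ⊗ₖ bᴴ) * X * (a ⊗ₖ b)) = aᴴ * trRight X * a := by
  have e1 : aᴴ ⊗ₖ bᴴ = (aᴴ ⊗ₖ (1 : Matrix Q Q ℂ)) * ((1 : Matrix P P ℂ) ⊗ₖ bᴴ) := by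
    rw [← Matrix.mul_kronecker_mul, mul_one, one_mul]
  have e2 : a ⊗ₖ b = ((1 : Matrix P P ℂ) ⊗ₖ b) * (a ⊗ₖ (1 : Matrix Q Q ℂ)) := by
    rw [← Matrix.mul_kronecker_mul, mul_one, one_mul]
  rw [e1, e2, ← mul_assoc, trRight_mul_kron_one, mul_assoc, mul_assoc, trRight_kron_one_mul,
    trRight_one_kron_comm, mul_assoc, mul_assoc, ← Matrix.mul_kronecker_mul, hb, one_mul,
    Matrix.one_kronecker_one, mul_one, ← mul_assoc]

/-- The entropy gain of a positive trace-preserving map is at least minus the logarithm of its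
efficacy. -/
theorem entropy_sub_log_efficacy_le (N : Matrix n n ℂ →ₗ[ℂ] Matrix m m ℂ)
    (hpos : ∀ ρ : Matrix n n ℂ, ρ.PosSemidef → (N ρ).PosSemidef)
    (htr : ∀ ρ : Matrix n n ℂ, (N ρ).trace = ρ.trace) {ρ : Matrix n n ℂ} (h : IsState ρ) :
    entropy ρ - Real.log (efficacy N ρ) ≤ entropy (N ρ) := by
  have hN : IsState (N ρ) := ⟨hpos _ h.1, by rw [htr, h.2]⟩
  obtain ⟨U, p, hU, hU', hρ, hS⟩ := exists_diagonalization h.herm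
  obtain ⟨V, s, hV, hV', hσ, hS'⟩ := exists_diagonalization hN.herm
  have hp1 : ∑ i, p i = 1 := sum_eigenvalues hU p (hρ ▸ h.2)
  set E : n → Matrix n n ℂ := fun i => U * Matrix.single i i 1 * Uᴴ with hE
  have hEst : ∀ i, IsState (E i) := fun i => (isState_single i).conj hU
  have hρE : ρ = ∑ i, (p i : ℂ) • E i := by rw [← conj_diagonal_eq_sum]; exact hρ
  have hE1 : ∑ i, E i = 1 := by
    have := conj_diagonal_eq_sum U fun _ => 1
    simp only [Complex.ofReal_one, one_smul] at this
    rw [← this, show Matrix.diagonal (fun _ : n => (1 : ℂ)) = 1 from Matrix.diagonal_one,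
      mul_one, hU']
  have hp : ∀ i, 0 ≤ p i := fun i => by
    have h1 : (Uᴴ * ρ * U).PosSemidef := h.1.conjTranspose_mul_mul_same U
    rw [hρ, conj_cancel hU] at h1
    simpa using re_diag_nonneg h1 i
  have hVps : ∀ X : Matrix m m ℂ, X.PosSemidef → (Vᴴ * X * V).PosSemidef := fun X hX =>
    hX.conjTranspose_mul_mul_same V
  have hVtr : ∀ X : Matrix m m ℂ, (Vᴴ * X * V).trace = X.trace := fun X => by
    rw [Matrix.trace_mul_comm, ← mul_assoc, hV', one_mul]
  have hDV : Vᴴ * N ρ * V = Matrix.diagonal fun j => (s j : ℂ) := by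
    rw [hσ]
    exact conj_cancel hV _
  -- The classical channel sends the i-th eigenprojector of ρ through N and measures in an
  -- eigenbasis of N(ρ). It maps the spectrum p to the spectrum s, and its classical efficacy is the
  -- quantum one. Only positivity of N is used, not complete positivity.
  have key := sum_negMulLog_sub_log_le (p := p) (T := fun i j => ((Vᴴ * N (E i) * V) j j).re)
    (s := s) hp (fun i j => re_diag_nonneg (hVps _ (hpos _ (hEst i).1)) j) ?_ hp1 ?_
  · have he : efficacy N ρ = ∑ i, ∑ j, ((Vᴴ * N (E i) * V) j j).re * s j := by
      rw [efficacy_eq, ← hE1, map_sum, Matrix.mul_sum, Matrix.trace_sum, Complex.re_sum]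
      refine Finset.sum_congr rfl fun i _ => ?_
      rw [Matrix.trace_mul_comm, ← hVtr]
      have : Vᴴ * (N (E i) * N ρ) * V
          = (Vᴴ * N (E i) * V) * Matrix.diagonal fun j => (s j : ℂ) := by
        rw [← hDV]
        calc Vᴴ * (N (E i) * N ρ) * V = Vᴴ * N (E i) * 1 * N ρ * V := by
              simp only [mul_assoc, one_mul]
          _ = _ := by rw [← hV']; simp only [mul_assoc]
      rw [this, Matrix.trace, Complex.re_sum]
      refine Finset.sum_congr rfl fun j _ => ?_
      simp [Matrix.mul_diagonal]
    rw [hS, hS', he]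
    exact key
  · intro i
    rw [← Complex.re_sum]
    have := hVtr (N (E i))
    rw [htr, (hEst i).2] at this
    exact (congrArg Complex.re this).trans Complex.one_re
  · intro j
    have h1 := congrFun (congrFun hDV j) j
    rw [hρE, map_sum, Matrix.mul_sum, Matrix.sum_mul] at h1
    simp only [map_smul, Matrix.mul_smul, Matrix.smul_mul, Matrix.sum_apply, Matrix.smul_apply,
      Matrix.diagonal_apply_eq, smul_eq_mul] at h1
    have h2 := congrArg Complex.re h1
    simp only [Complex.re_sum, Complex.re_ofReal_mul, Complex.ofReal_re] at h2
    exact h2.symm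

/-- Measuring in an orthonormal basis does not decrease the entropy. -/
theorem entropy_le_sum_diag {ρ V : Matrix n n ℂ} (h : IsState ρ) (hV : Vᴴ * V = 1) :
    entropy ρ ≤ ∑ j, Real.negMulLog ((Vᴴ * ρ * V) j j).re := by
  have hV' : V * Vᴴ = 1 := mul_eq_one_comm.1 hV
  -- The measurement in the basis V, with the outcome written as a diagonal matrix. It is unital, so
  -- the efficacy of a state is 1 and the logarithm drops out.
  let N : Matrix n n ℂ →ₗ[ℂ] Matrix n n ℂ :=
    { toFun := fun X => Matrix.diagonal fun j => (Vᴴ * X * V) j j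
      map_add' := fun X Y => by
        rw [Matrix.diagonal_add]; simp [mul_add, add_mul]
      map_smul' := fun c X => by
        ext i j; simp [Matrix.diagonal_apply] }
  have hN : ∀ X, N X = Matrix.diagonal fun j => (Vᴴ * X * V) j j := fun X => rfl
  have htr : ∀ X, (N X).trace = X.trace := fun X => by
    rw [hN, Matrix.trace_diagonal]
    change (Vᴴ * X * V).trace = _
    rw [Matrix.trace_mul_comm, ← mul_assoc, hV', one_mul]
  have key := entropy_sub_log_efficacy_le N (fun X hX => ?_) htr h
  · have h1 : efficacy N ρ = 1 := by
      have : N 1 = 1 := by rw [hN, mul_one, hV]; simp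
      rw [efficacy_eq, this, mul_one, htr, h.2, Complex.one_re]
    have h2 : N ρ = Matrix.diagonal fun j => (((Vᴴ * ρ * V) j j).re : ℂ) := by
      rw [hN]; congr 1; funext j
      exact (ofReal_re_diag (h.1.conjTranspose_mul_mul_same V).isHermitian j).symm
    rw [h1, Real.log_one, sub_zero, h2, entropy_diagonal] at key
    exact key
  · exact Matrix.PosSemidef.diagonal fun j => (hX.conjTranspose_mul_mul_same V).diag_nonneg

theorem sum_re_diag {ρ V : Matrix n n ℂ} (h : IsState ρ) (hV : Vᴴ * V = 1) :
    ∑ j, ((Vᴴ * ρ * V) j j).re = 1 := by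
  have hV' : V * Vᴴ = 1 := mul_eq_one_comm.1 hV
  rw [← Complex.re_sum]
  have : (Vᴴ * ρ * V).trace = 1 := by
    rw [Matrix.trace_mul_comm, ← mul_assoc, hV', one_mul, h.2]
  exact (congrArg Complex.re this).trans Complex.one_re

/-- Upper bound on the entropy from a probability distribution on an orthonormal basis. -/
theorem entropy_le_cross {ρ V : Matrix n n ℂ} (h : IsState ρ) (hV : Vᴴ * V = 1) {q : n → ℝ}
    (hq : ∀ i, 0 ≤ q i) (hq1 : ∑ i, q i ≤ 1)
    (h0 : ∀ i, q i = 0 → ((Vᴴ * ρ * V) i i).re = 0) :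
    entropy ρ ≤ -∑ i, ((Vᴴ * ρ * V) i i).re * Real.log (q i) :=
  (entropy_le_sum_diag h hV).trans <|
    gibbs (fun i => re_diag_nonneg (h.1.conjTranspose_mul_mul_same V) i) hq h0
      (by rw [sum_re_diag h hV]; exact hq1)

/-- In the product of the eigenbases of the two marginals, the cross entropy against the product
distribution c_i d_j is exactly the sum of the marginal entropies, because the diagonal of ρ in that
basis has marginals c and d. -/
theorem entropy_subadditive {ρ : Matrix (P × Q) (P × Q) ℂ} (h : IsState ρ) :
    entropy ρ ≤ entropy (trRight ρ) + entropy (trLeft ρ) := by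
  obtain ⟨U, c, hU, hU', hρ, hS⟩ := exists_diagonalization h.trRight.herm
  obtain ⟨V, d, hV, hV', hσ, hS'⟩ := exists_diagonalization h.trLeft.herm
  have hc1 : ∑ i, c i = 1 := sum_eigenvalues hU c (hρ ▸ h.trRight.2)
  have hd1 : ∑ i, d i = 1 := sum_eigenvalues hV d (hσ ▸ h.trLeft.2)
  have hW : (U ⊗ₖ V)ᴴ * (U ⊗ₖ V) = 1 := by
    rw [Matrix.conjTranspose_kronecker, ← Matrix.mul_kronecker_mul, hU, hV,
      Matrix.one_kronecker_one]
  set Z := (U ⊗ₖ V)ᴴ * ρ * (U ⊗ₖ V) with hZ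
  have hZp : Z.PosSemidef := h.1.conjTranspose_mul_mul_same _
  have hZ1 : trRight Z = Matrix.diagonal fun i => (c i : ℂ) := by
    rw [hZ, Matrix.conjTranspose_kronecker, trRight_kron_conj U hV', hρ]
    exact conj_cancel hU _
  have hZ2 : trLeft Z = Matrix.diagonal fun i => (d i : ℂ) := by
    have hsw : Z.submatrix Prod.swap Prod.swap
        = (Vᴴ ⊗ₖ Uᴴ) * ρ.submatrix Prod.swap Prod.swap * (V ⊗ₖ U) := by
      have e : ∀ X : Matrix (P × Q) (P × Q) ℂ, X.submatrix Prod.swap Prod.swap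
          = X.submatrix (Equiv.prodComm Q P) (Equiv.prodComm Q P) := fun _ => rfl
      rw [hZ, e, ← Matrix.submatrix_mul_equiv _ _ _ (Equiv.prodComm Q P),
        ← Matrix.submatrix_mul_equiv _ _ _ (Equiv.prodComm Q P), Matrix.conjTranspose_kronecker]
      congr 1
      · congr 1
        ext i j; simp [mul_comm]
      · ext i j; simp [mul_comm]
    rw [trLeft_eq, hsw, trRight_kron_conj V hU', ← trLeft_eq, hσ]
    exact conj_cancel hV _
  have hm1 : ∀ i, ∑ j, (Z (i, j) (i, j)).re = c i := fun i => by
    have := congrArg Complex.re (congrFun (congrFun hZ1 i) i)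
    simpa [ptrace] using this
  have hm2 : ∀ j, ∑ i, (Z (i, j) (i, j)).re = d j := fun j => by
    have := congrArg Complex.re (congrFun (congrFun hZ2 j) j)
    simpa [ptrace] using this
  have hZ0 : ∀ i j, 0 ≤ (Z (i, j) (i, j)).re := fun i j => re_diag_nonneg hZp (i, j)
  have hc0 : ∀ i, 0 ≤ c i := fun i => by
    rw [← hm1]; exact Finset.sum_nonneg fun j _ => hZ0 i j
  have hd0 : ∀ i, 0 ≤ d i := fun i => by
    rw [← hm2]; exact Finset.sum_nonneg fun j _ => hZ0 j i
  have hzc : ∀ i j, c i = 0 → (Z (i, j) (i, j)).re = 0 := fun i j h0 =>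
    (Finset.sum_eq_zero_iff_of_nonneg fun j _ => hZ0 i j).1 ((hm1 i).trans h0) j
      (Finset.mem_univ j)
  have hzd : ∀ i j, d j = 0 → (Z (i, j) (i, j)).re = 0 := fun i j h0 =>
    (Finset.sum_eq_zero_iff_of_nonneg fun i _ => hZ0 i j).1 ((hm2 j).trans h0) i
      (Finset.mem_univ i)
  have key := entropy_le_cross h hW (q := fun i => c i.1 * d i.2)
    (fun i => mul_nonneg (hc0 _) (hd0 _)) ?_ ?_
  · refine key.trans_eq ?_
    rw [hS, hS', Fintype.sum_prod_type]
    have e : ∀ i j, (Z (i, j) (i, j)).re * Real.log (c i * d j)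
        = (Z (i, j) (i, j)).re * Real.log (c i) + (Z (i, j) (i, j)).re * Real.log (d j) := by
      intro i j
      by_cases h1 : c i = 0
      · rw [hzc i j h1]; ring
      by_cases h2 : d j = 0
      · rw [hzd i j h2]; ring
      rw [Real.log_mul h1 h2]; ring
    simp_rw [← hZ, e, Finset.sum_add_distrib]
    rw [Finset.sum_comm (f := fun i j => (Z (i, j) (i, j)).re * Real.log (d j))]
    simp_rw [← Finset.sum_mul, hm1, hm2, Real.negMulLog, neg_mul, Finset.sum_neg_distrib]
    ring
  · rw [Fintype.sum_prod_type]
    simp_rw [← Finset.mul_sum, hd1, mul_one, hc1, le_refl]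
  · rintro ⟨i, j⟩ h0
    rcases mul_eq_zero.1 h0 with h0 | h0
    · exact hzc i j h0
    · exact hzd i j h0

/-- Logarithm of the partition function. -/
noncomputable def logZ (β : ℝ) (H : Matrix n n ℂ) : ℝ :=
  Real.log (NormedSpace.exp (-(β : ℂ) • H)).trace.re

theorem exp_conj_diagonal {V : Matrix n n ℂ} (hV : Vᴴ * V = 1) (β : ℝ) (h : n → ℝ) :
    NormedSpace.exp (-(β : ℂ) • (V * Matrix.diagonal (fun i => (h i : ℂ)) * Vᴴ))
      = V * Matrix.diagonal (fun i => ((Real.exp (-(β * h i)) : ℝ) : ℂ)) * Vᴴ := by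
  have hV' : V * Vᴴ = 1 := mul_eq_one_comm.1 hV
  have hinv : Vᴴ = V⁻¹ := (Matrix.inv_eq_left_inv hV).symm
  have hu : IsUnit V := ⟨⟨V, Vᴴ, hV', hV⟩, rfl⟩
  rw [show -(β : ℂ) • (V * Matrix.diagonal (fun i => (h i : ℂ)) * Vᴴ)
      = V * Matrix.diagonal (fun i => ((-(β * h i) : ℝ) : ℂ)) * V⁻¹ from ?_,
    Matrix.exp_conj _ _ hu, Matrix.exp_diagonal, hinv]
  · congr 3
    funext i
    rw [Pi.coe_exp, ← Complex.exp_eq_exp_ℂ, Complex.ofReal_exp]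
  · rw [← hinv, ← Matrix.smul_mul, ← Matrix.mul_smul, ← Matrix.diagonal_smul]
    congr 3
    funext i
    simp

theorem expect_conj_diagonal {V : Matrix n n ℂ} (ρ : Matrix n n ℂ) (h : n → ℝ) :
    expect ρ (V * Matrix.diagonal (fun i => (h i : ℂ)) * Vᴴ)
      = ∑ i, ((Vᴴ * ρ * V) i i).re * h i := by
  rw [expect, ← mul_assoc, Matrix.trace_mul_comm, ← mul_assoc, ← mul_assoc, Matrix.trace,
    Complex.re_sum]
  exact Finset.sum_congr rfl fun i _ => by simp [Matrix.mul_diagonal]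

/-- The Gibbs variational principle. In an eigenbasis of H the logarithm of a Boltzmann weight is
affine in the energy, so the cross entropy of any state against these weights is β times its mean
energy plus ln Z. The thermal state is diagonal there with exactly these weights, hence equality. -/
theorem thermal_facts [Nonempty n] {H : Matrix n n ℂ} (hH : H.IsHermitian) (β : ℝ) :
    IsState (thermal β H) ∧ entropy (thermal β H) = β * expect (thermal β H) H + logZ β H ∧
      ∀ ρ : Matrix n n ℂ, IsState ρ → entropy ρ ≤ β * expect ρ H + logZ β H := by
  obtain ⟨V, e, hV, hV', hHV, -⟩ := exists_diagonalization hH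
  have hexp : NormedSpace.exp (-(β : ℂ) • H)
      = V * Matrix.diagonal (fun i => ((Real.exp (-(β * e i)) : ℝ) : ℂ)) * Vᴴ := by
    conv_lhs => rw [hHV]
    exact exp_conj_diagonal hV β e
  set Z := ∑ i, Real.exp (-(β * e i)) with hZ
  have hZpos : 0 < Z := Finset.sum_pos (fun i _ => Real.exp_pos _) Finset.univ_nonempty
  have htr : (NormedSpace.exp (-(β : ℂ) • H)).trace = (Z : ℂ) := by
    rw [hexp, Matrix.trace_mul_comm, ← mul_assoc, hV, one_mul, Matrix.trace_diagonal, hZ]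
    push_cast; rfl
  have hlog : logZ β H = Real.log Z := by rw [logZ, htr, Complex.ofReal_re]
  set q : n → ℝ := fun i => Real.exp (-(β * e i)) / Z with hq
  have hqpos : ∀ i, 0 < q i := fun i => div_pos (Real.exp_pos _) hZpos
  have hq1 : ∑ i, q i = 1 := by rw [← Finset.sum_div, ← hZ, div_self hZpos.ne']
  have hlq : ∀ i, Real.log (q i) = -(β * e i) - Real.log Z := fun i => by
    rw [hq, Real.log_div (Real.exp_pos _).ne' hZpos.ne', Real.log_exp]
  have hth : thermal β H = V * Matrix.diagonal (fun i => (q i : ℂ)) * Vᴴ := by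
    rw [thermal, htr, hexp, ← Matrix.smul_mul, ← Matrix.mul_smul, ← Matrix.diagonal_smul]
    congr 3
    funext i
    simp [hq, div_eq_inv_mul]
  have hst : IsState (thermal β H) := by
    rw [hth]; exact (isState_diagonal (fun i => (hqpos i).le) hq1).conj hV
  refine ⟨hst, ?_, fun ρ hρ => ?_⟩
  · have hD : Vᴴ * thermal β H * V = Matrix.diagonal (fun i => (q i : ℂ)) := by
      rw [hth]
      exact conj_cancel hV _
    have h1 : expect (thermal β H) H = ∑ i, q i * e i := by
      conv_lhs => rw [hHV]
      rw [expect_conj_diagonal, ← hHV, hD]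
      simp
    rw [h1, hlog]
    conv_lhs => rw [hth]
    rw [entropy_conj_diagonal hV, Finset.mul_sum]
    have : Real.log Z = ∑ i, q i * Real.log Z := by rw [← Finset.sum_mul, hq1, one_mul]
    rw [this, ← Finset.sum_add_distrib]
    refine Finset.sum_congr rfl fun i _ => ?_
    rw [Real.negMulLog, hlq]; ring
  · have key := entropy_le_cross hρ hV (fun i => (hqpos i).le) hq1.le
      fun i hi => absurd hi (hqpos i).ne'
    refine key.trans_eq ?_
    have h1 : expect ρ H = ∑ i, ((Vᴴ * ρ * V) i i).re * e i := by
      rw [hHV, expect_conj_diagonal]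
    have : Real.log Z = ∑ i, ((Vᴴ * ρ * V) i i).re * Real.log Z := by
      rw [← Finset.sum_mul, sum_re_diag hρ hV, one_mul]
    rw [h1, hlog, this, Finset.mul_sum, ← Finset.sum_add_distrib, ← Finset.sum_neg_distrib]
    refine Finset.sum_congr rfl fun i _ => ?_
    rw [hlq]; ring

/-- Quantum Fano inequality. -/
theorem entropy_le_fano {ρ : Matrix n n ℂ} (h : IsState ρ) {ψ : n → ℂ}
    (hψ : ∑ i, ‖ψ i‖ ^ 2 = 1) :
    (star ψ ⬝ᵥ (ρ *ᵥ ψ)).re ∈ Set.Icc (0 : ℝ) 1 ∧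
      entropy ρ ≤ fano (Fintype.card n) (star ψ ⬝ᵥ (ρ *ᵥ ψ)).re := by
  set Pψ := Matrix.vecMulVec ψ (star ψ) with hP
  have hψ' : star ψ ⬝ᵥ ψ = 1 := by
    rw [dotProduct]
    have : ∀ i, star ψ i * ψ i = ((‖ψ i‖ ^ 2 : ℝ) : ℂ) := fun i => by
      rw [Pi.star_apply, Complex.star_def, Complex.conj_mul']; push_cast; rfl
    simp_rw [this]
    exact_mod_cast hψ
  have hherm : Pψ.IsHermitian := by
    ext i j; simp [hP, Matrix.vecMulVec_apply, mul_comm]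
  have hPP : Pψ * Pψ = Pψ := by
    rw [hP, Matrix.vecMulVec_mul_vecMulVec, hψ']; simp
  have htr : Pψ.trace = 1 := by
    rw [hP, Matrix.trace_vecMulVec, dotProduct_comm, hψ']
  obtain ⟨V, d, hV, hV', hPV, -⟩ := exists_diagonalization hherm
  have hd01 : ∀ i, d i = 0 ∨ d i = 1 := by
    have hD : Vᴴ * Pψ * V = Matrix.diagonal (fun i => (d i : ℂ)) := by
      rw [hPV]
      exact conj_cancel hV _
    intro i
    have h1 : (Vᴴ * Pψ * V) * (Vᴴ * Pψ * V) = Vᴴ * Pψ * V := by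
      calc (Vᴴ * Pψ * V) * (Vᴴ * Pψ * V) = Vᴴ * (Pψ * (V * Vᴴ) * Pψ) * V := by
            simp only [mul_assoc]
        _ = _ := by rw [hV', mul_one, hPP]
    rw [hD, Matrix.diagonal_mul_diagonal] at h1
    have h5 := congrFun (Matrix.diagonal_injective h1) i
    have h6 : d i * d i = d i := by exact_mod_cast h5
    rcases eq_or_ne (d i) 0 with h | h
    · exact Or.inl h
    · exact Or.inr (mul_left_cancel₀ h (by rw [h6, mul_one]))
  have hd1 : ∑ i, d i = 1 := sum_eigenvalues hV d (hPV ▸ htr)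
  set p : n → ℝ := fun i => ((Vᴴ * ρ * V) i i).re with hp
  have hp0 : ∀ i, 0 ≤ p i := fun i => re_diag_nonneg (h.1.conjTranspose_mul_mul_same V) i
  have hp1 : ∑ i, p i = 1 := sum_re_diag h hV
  have hF : (star ψ ⬝ᵥ (ρ *ᵥ ψ)).re = ∑ i, p i * d i := by
    rw [← expect_conj_diagonal, ← hPV, expect, hP, Matrix.mul_vecMulVec, Matrix.trace_vecMulVec,
      dotProduct_comm]
  rw [hF]
  set F := ∑ i, p i * d i with hFd
  have hF' : ∑ i, p i * (1 - d i) = 1 - F := by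
    simp_rw [mul_sub, mul_one, Finset.sum_sub_distrib, hp1, hFd]
  have hd0 : ∀ i, 0 ≤ d i := fun i => by rcases hd01 i with h | h <;> simp [h]
  have hd0' : ∀ i, 0 ≤ 1 - d i := fun i => by rcases hd01 i with h | h <;> simp [h]
  have hF0 : 0 ≤ F := Finset.sum_nonneg fun i _ => mul_nonneg (hp0 i) (hd0 i)
  have hF1 : 0 ≤ 1 - F := by
    rw [← hF']; exact Finset.sum_nonneg fun i _ => mul_nonneg (hp0 i) (hd0' i)
  refine ⟨⟨hF0, by linarith⟩, ?_⟩
  -- The dimension of the orthogonal complement of ψ, obtained by counting the zero eigenvalues of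
  -- the projector onto ψ. It is 0 in dimension one, where F is forced to be 1.
  set D : ℝ := Fintype.card n - 1 with hD
  have hsD : ∑ i, (1 - d i) = D := by
    rw [Finset.sum_sub_distrib, hd1]; simp [hD]
  have hD0 : 0 ≤ D := by rw [← hsD]; exact Finset.sum_nonneg fun i _ => hd0' i
  -- The reference distribution gives weight F to ψ and spreads 1 - F uniformly over the complement.
  -- If D = 0, the quotient has the default value 0, and its coefficient 1 - d_i vanishes as well.
  set q : n → ℝ := fun i => d i * F + (1 - d i) * ((1 - F) / D) with hq
  have hdiv : 0 ≤ (1 - F) / D := div_nonneg hF1 hD0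
  have hpF : ∀ i, d i = 1 → F = 0 → p i = 0 := fun i h1 h2 => by
    have := (Finset.sum_eq_zero_iff_of_nonneg fun i _ => mul_nonneg (hp0 i) (hd0 i)).1 h2 i
      (Finset.mem_univ i)
    simpa [h1] using this
  have hpF' : ∀ i, d i = 0 → 1 - F = 0 → p i = 0 := fun i h1 h2 => by
    have := (Finset.sum_eq_zero_iff_of_nonneg fun i _ => mul_nonneg (hp0 i) (hd0' i)).1
      (hF'.trans h2) i (Finset.mem_univ i)
    simpa [h1] using this
  have hDne : ∀ i, d i = 0 → D ≠ 0 := fun i h1 h2 => by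
    have := (Finset.sum_eq_zero_iff_of_nonneg fun i _ => hd0' i).1 (hsD.trans h2) i
      (Finset.mem_univ i)
    rw [h1] at this; norm_num at this
  have hDF : D = 0 → 1 - F = 0 := fun h2 => by
    have h3 : ∀ i, 1 - d i = 0 := fun i =>
      (Finset.sum_eq_zero_iff_of_nonneg fun i _ => hd0' i).1 (hsD.trans h2) i (Finset.mem_univ i)
    rw [← hF']; simp [h3]
  have key := entropy_le_cross h hV (q := q)
    (fun i => add_nonneg (mul_nonneg (hd0 i) hF0) (mul_nonneg (hd0' i) hdiv)) ?_ ?_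
  · have e : ∀ i, p i * Real.log (q i)
        = p i * d i * Real.log F + p i * (1 - d i) * (Real.log (1 - F) - Real.log D) := by
      intro i
      rcases hd01 i with h1 | h1
      · by_cases h2 : 1 - F = 0
        · simp [hpF' i h1 h2]
        · simp only [hq, h1]
          rw [zero_mul, zero_add, sub_zero, one_mul, Real.log_div h2 (hDne i h1)]
          ring
      · simp [hq, h1]
    refine key.trans ?_
    change -∑ i, p i * Real.log (q i) ≤ _
    simp_rw [e, Finset.sum_add_distrib, ← Finset.sum_mul]
    rw [hF', ← hFd, fano, Real.binEntropy_eq_negMulLog_add_negMulLog_one_sub, Real.negMulLog,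
      Real.negMulLog]
    -- The argument yields the sharper constant ln(card - 1); it is relaxed to ln(card² - 1). For D
    -- = 0 both sides carry the factor 1 - F = 0.
    have hlog : (1 - F) * Real.log D ≤ (1 - F) * Real.log ((Fintype.card n : ℝ) ^ 2 - 1) := by
      rcases hD0.eq_or_lt with h0 | h0
      · rw [hDF h0.symm]; simp
      · refine mul_le_mul_of_nonneg_left (Real.log_le_log h0 ?_) hF1
        have : (Fintype.card n : ℝ) = D + 1 := by rw [hD]; ring
        rw [this]; nlinarith
    linarith
  · simp only [hq, Finset.sum_add_distrib, ← Finset.sum_mul]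
    rw [hd1, hsD]
    by_cases h0 : D = 0
    · rw [h0]; linarith
    · rw [mul_div_cancel₀ _ h0]; linarith
  · intro i hi
    rcases hd01 i with h1 | h1
    · refine hpF' i h1 ?_
      have : (1 - F) / D = 0 := by simpa [hq, h1] using hi
      exact (div_eq_zero_iff.1 this).resolve_right (hDne i h1)
    · exact hpF i h1 (by simpa [hq, h1] using hi)

/-- The largest fidelity allowed by the Fano inequality is attained. -/
theorem maxFidelity_spec {d : ℕ} {s F : ℝ} (hF : F ∈ Set.Icc (0 : ℝ) 1) (h : s ≤ fano d F) :
    F ≤ maxFidelity d s ∧ s ≤ fano d (maxFidelity d s) := by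
  have hb : BddAbove {F : ℝ | F ∈ Set.Icc 0 1 ∧ s ≤ fano d F} := ⟨1, fun x hx => hx.1.2⟩
  have hc : IsClosed {F : ℝ | F ∈ Set.Icc 0 1 ∧ s ≤ fano d F} := by
    have hf : Continuous (fano d) := by
      unfold fano
      exact Real.binEntropy_continuous.add (by fun_prop)
    exact isClosed_Icc.inter (isClosed_le continuous_const hf)
  exact ⟨le_csSup hb ⟨hF, h⟩, (hc.csSup_mem ⟨F, hF, h⟩ hb).2⟩

end Inequalities

end QEC

namespace QEC

/-! ### Operators on subsystems -/

section Lift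

variable {T P P' Q Q' K n : Type*}
variable [Fintype T] [Fintype P] [Fintype P'] [Fintype Q] [Fintype Q'] [Fintype K] [Fintype n]
variable [DecidableEq T] [DecidableEq P] [DecidableEq P'] [DecidableEq Q] [DecidableEq Q']
variable [DecidableEq K] [DecidableEq n]

theorem lift_apply (split : T → P × Q) (u : Matrix P P ℂ) (t t' : T) :
    lift split u t t'
      = if (split t).2 = (split t').2 then u (split t).1 (split t').1 else 0 := by
  simp [lift, Matrix.one_apply]

/-- The complementary factor enters only through the question whether two labels agree on it, so its
bracketing and ordering, and even its type, are immaterial. -/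
theorem lift_congr {split : T → P × Q} {split' : T → P × Q'} (u : Matrix P P ℂ)
    (h1 : ∀ t, (split t).1 = (split' t).1)
    (h2 : ∀ t t', (split t).2 = (split t').2 ↔ (split' t).2 = (split' t').2) :
    lift split u = lift split' u := by
  ext t t'
  rw [lift_apply, lift_apply, h1, h1]
  simp only [h2]

theorem lift_mul (e : T ≃ P × Q) (u v : Matrix P P ℂ) :
    lift e u * lift e v = lift e (u * v) := by
  rw [lift, lift, lift, Matrix.submatrix_mul_equiv, ← Matrix.mul_kronecker_mul, mul_one]

theorem lift_add (split : T → P × Q) (u v : Matrix P P ℂ) :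
    lift split (u + v) = lift split u + lift split v := by
  ext t t'
  rw [Matrix.add_apply, lift_apply, lift_apply, lift_apply]
  split_ifs <;> simp

theorem lift_conjTranspose (split : T → P × Q) (u : Matrix P P ℂ) :
    (lift split u)ᴴ = lift split uᴴ := by
  ext t t'
  simp only [Matrix.conjTranspose_apply, lift_apply, eq_comm]
  split_ifs <;> simp

theorem lift_one (e : T ≃ P × Q) : lift e (1 : Matrix P P ℂ) = 1 := by
  rw [lift, Matrix.one_kronecker_one, Matrix.submatrix_one_equiv]

theorem lift_unitary (e : T ≃ P × Q) (u : Matrix.unitaryGroup P ℂ) :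
    (lift e u.1)ᴴ * lift e u.1 = 1 := by
  rw [lift_conjTranspose, lift_mul, ← Matrix.star_eq_conjTranspose,
    Matrix.mem_unitaryGroup_iff'.1 u.2, lift_one]

/-- Operators on disjoint factors commute. -/
theorem lift_commute {split : T → P × Q} {split' : T → P' × Q'} (e : T ≃ P × (P' × K))
    (h1 : ∀ t, (split t).1 = (e t).1)
    (h2 : ∀ t t', (split t).2 = (split t').2 ↔ (e t).2 = (e t').2)
    (h1' : ∀ t, (split' t).1 = (e t).2.1)
    (h2' : ∀ t t', (split' t).2 = (split' t').2 ↔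
      (e t).1 = (e t').1 ∧ (e t).2.2 = (e t').2.2)
    (u : Matrix P P ℂ) (v : Matrix P' P' ℂ) :
    lift split u * lift split' v = lift split' v * lift split u := by
  have a1 : lift split u = (u ⊗ₖ ((1 : Matrix P' P' ℂ) ⊗ₖ (1 : Matrix K K ℂ))).submatrix e e := by
    rw [lift_congr (split' := e) u h1 h2, lift, Matrix.one_kronecker_one]
  have a2 : lift split' v
      = ((1 : Matrix P P ℂ) ⊗ₖ (v ⊗ₖ (1 : Matrix K K ℂ))).submatrix e e := by
    ext t t'
    rw [lift_apply, h1', h1']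
    simp only [h2', Matrix.submatrix_apply, Matrix.kroneckerMap_apply, Matrix.one_apply]
    split_ifs <;> simp_all
  rw [a1, a2, Matrix.submatrix_mul_equiv, Matrix.submatrix_mul_equiv]
  simp only [← Matrix.mul_kronecker_mul, mul_one, one_mul]

theorem expect_trLeft (ρ : Matrix (P × Q) (P × Q) ℂ) (H : Matrix Q Q ℂ) :
    expect (trLeft ρ) H = expect ρ ((1 : Matrix P P ℂ) ⊗ₖ H) := by
  rw [trLeft_eq, expect_trRight]
  have := expect_submatrix (Equiv.prodComm Q P) ρ ((1 : Matrix P P ℂ) ⊗ₖ H)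
  rw [← this]
  congr 1
  ext ⟨i, k⟩ ⟨j, l⟩
  simp [mul_comm]

theorem ptrace_sum (g : P → Q → T) (p : K → ℝ) (s : K → Matrix T T ℂ) :
    ptrace g (∑ x, (p x : ℂ) • s x) = ∑ x, (p x : ℂ) • ptrace g (s x) := by
  ext i j
  simp only [ptrace, Matrix.of_apply, Matrix.sum_apply, Matrix.smul_apply, smul_eq_mul,
    Finset.mul_sum]
  exact Finset.sum_comm

/-- Conjugation by an operator on the traced-in factor passes through a partial trace. -/
theorem ptrace_conj (e : P × Q ≃ T) {L : Matrix T T ℂ} {l : Matrix P P ℂ}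
    (hL : L.submatrix e e = l ⊗ₖ (1 : Matrix Q Q ℂ)) (ρ : Matrix T T ℂ) :
    ptrace (fun p q => e (p, q)) (L * ρ * Lᴴ) = l * ptrace (fun p q => e (p, q)) ρ * lᴴ := by
  have h2 : Lᴴ.submatrix e e = lᴴ ⊗ₖ (1 : Matrix Q Q ℂ) := by
    rw [← Matrix.conjTranspose_submatrix, hL, Matrix.conjTranspose_kronecker,
      Matrix.conjTranspose_one]
  rw [ptrace_eq_trRight, ptrace_eq_trRight, ← Matrix.submatrix_mul_equiv _ _ _ e,
    ← Matrix.submatrix_mul_equiv _ _ _ e, hL, h2, trRight_mul_kron_one, trRight_kron_one_mul]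

theorem expect_conj_of_commute {ρ U O : Matrix n n ℂ} (hU : Uᴴ * U = 1)
    (h : U * O = O * U) : expect (U * ρ * Uᴴ) O = expect ρ O := by
  rw [expect, expect, mul_assoc, Matrix.trace_mul_comm, ← mul_assoc]
  have h2 : Uᴴ * O * U = O := by rw [mul_assoc, ← h, ← mul_assoc, hU, one_mul]
  rw [mul_assoc, ← mul_assoc, mul_assoc Uᴴ, ← mul_assoc Uᴴ, h2, Matrix.trace_mul_comm]

theorem sum_kron_single (F : P → Matrix T T ℂ) :
    ∑ y, F y ⊗ₖ Matrix.single y y (1 : ℂ) = block (fun _ => 1) F := by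
  ext ⟨i, x⟩ ⟨j, z⟩
  simp only [block, Matrix.of_apply, Matrix.sum_apply, Matrix.kroneckerMap_apply,
    Matrix.single_apply]
  by_cases h : x = z
  · subst h; simp
  · simp only [h, if_false]
    refine Finset.sum_eq_zero fun w _ => ?_
    by_cases hw : w = x
    · subst hw; simp [h]
    · simp [hw]

theorem trRight_block (F : P → Matrix T T ℂ) : trRight (block (fun _ => 1) F) = ∑ y, F y := by
  ext i j
  simp [ptrace, block, Matrix.sum_apply]

theorem expect_block_kron_one (F : P → Matrix T T ℂ) (O : Matrix T T ℂ) :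
    expect (block (fun _ => 1) F) (O ⊗ₖ (1 : Matrix P P ℂ)) = ∑ y, expect (F y) O := by
  rw [← expect_trRight, trRight_block]
  simp [expect, Finset.sum_mul, Matrix.trace_sum]

end Lift

namespace Engine

variable {R S A B C M Y : Type*}
  [Fintype R] [Fintype S] [Fintype A] [Fintype B] [Fintype C] [Fintype M] [Fintype Y]
  [DecidableEq R] [DecidableEq S] [DecidableEq A] [DecidableEq B] [DecidableEq C]
  [DecidableEq M] [DecidableEq Y]
  (G : Engine R S A B C M Y)

/-! ### Density matrices of the cycle -/

section States

theorem pX_nonneg (x : A) : 0 ≤ G.pX x :=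
  div_nonneg (Real.exp_pos _).le (Finset.sum_nonneg fun _ _ => (Real.exp_pos _).le)

theorem sum_pX [Nonempty A] : ∑ x, G.pX x = 1 := by
  simp only [pX, ← Finset.sum_div]
  exact div_self (Finset.sum_pos (fun _ _ => Real.exp_pos _) Finset.univ_nonempty).ne'

theorem HA_herm : G.HA.IsHermitian := by
  rw [HA, Matrix.isHermitian_diagonal_iff]; intro i; simp [IsSelfAdjoint]

theorem τA_eq_thermal : G.τA = thermal (1 / (G.kB * G.Tc)) G.HA := by
  have h := exp_conj_diagonal (V := (1 : Matrix A A ℂ)) (by simp) (1 / (G.kB * G.Tc)) G.εA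
  simp only [one_mul, Matrix.conjTranspose_one, mul_one] at h
  rw [thermal, HA, h, Matrix.trace_diagonal, τA, ← Matrix.diagonal_smul]
  congr 1
  funext x
  have e : ∀ x, -(G.εA x) / (G.kB * G.Tc) = -(1 / (G.kB * G.Tc) * G.εA x) := fun x => by ring
  simp only [pX, e, Pi.smul_apply, smul_eq_mul]
  push_cast
  rw [div_eq_inv_mul]

variable [Nonempty A]

theorem isState_τA : IsState G.τA := isState_diagonal G.pX_nonneg G.sum_pX

theorem isState_τB [Nonempty B] : IsState G.τB := (thermal_facts G.HB_herm _).1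

theorem isState_τC [Nonempty C] : IsState G.τC := (thermal_facts G.HC_herm _).1

theorem isState_τM [Nonempty M] : IsState G.τM := (thermal_facts G.HM_herm _).1

theorem star_ψ_dot : star G.ψ ⬝ᵥ G.ψ = 1 := by
  rw [dotProduct]
  have : ∀ i, star G.ψ i * G.ψ i = ((‖G.ψ i‖ ^ 2 : ℝ) : ℂ) := fun i => by
    rw [Pi.star_apply, Complex.star_def, Complex.conj_mul']; push_cast; rfl
  simp_rw [this]
  exact_mod_cast G.ψ_norm

theorem isState_ψψ : IsState G.ψψ :=
  ⟨Matrix.posSemidef_vecMulVec_self_star _, by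
    rw [ψψ, Matrix.trace_vecMulVec, dotProduct_comm, star_ψ_dot]⟩

theorem entropy_ψψ : entropy G.ψψ = 0 :=
  entropy_of_idempotent G.isState_ψψ.herm (by
    rw [ψψ, Matrix.vecMulVec_mul_vecMulVec, star_ψ_dot]; simp)

theorem entropy_single {n : Type*} [Fintype n] [DecidableEq n] (i : n) :
    entropy (Matrix.single i i (1 : ℂ)) = 0 :=
  entropy_of_idempotent (isState_single i).herm (by simp)

variable [Nonempty B] [Nonempty C]

theorem isState_e0 (x : A) : IsState (G.e0 x) :=
  ((G.isState_ψψ.kron (isState_single x)).kron G.isState_τB).kron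
    (G.isState_τA.kron G.isState_τC)

/-- Regrouping of `E` as `SA` and the rest. -/
def splitSA : EIdx R S A B C ≃ (S × A) × (R × B × (A × C)) where
  toFun t := ((t.1.1.1.2, t.1.1.2), (t.1.1.1.1, t.1.2, t.2))
  invFun t := (((((t.2.1, t.1.1), t.1.2), t.2.2.1), t.2.2.2))
  left_inv _ := rfl
  right_inv _ := rfl

/-- Regrouping of `E` as `S A B_h` and the rest. -/
def splitSAB : EIdx R S A B C ≃ ((S × A) × B) × (R × (A × C)) where
  toFun t := (((t.1.1.1.2, t.1.1.2), t.1.2), (t.1.1.1.1, t.2))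
  invFun t := (((((t.2.1, t.1.1.1), t.1.1.2), t.1.2), t.2.2))
  left_inv _ := rfl
  right_inv _ := rfl

/-- Regrouping of `E M` as `S A M` and the rest. -/
def splitSAM : EIdx R S A B C × M ≃ ((S × A) × M) × (R × B × (A × C)) where
  toFun t := (((t.1.1.1.1.2, t.1.1.1.2), t.2), (t.1.1.1.1.1, t.1.1.2, t.1.2))
  invFun t := ((((((t.2.1, t.1.1.1), t.1.1.2), t.2.2.1), t.2.2.2)), t.1.2)
  left_inv _ := rfl
  right_inv _ := rfl

theorem liftSA_unitary (u : Matrix.unitaryGroup (S × A) ℂ) :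
    (liftSA (R := R) (B := B) (C := C) u.1)ᴴ * liftSA u.1 = 1 :=
  lift_unitary splitSA u

theorem liftSAB_unitary (u : Matrix.unitaryGroup ((S × A) × B) ℂ) :
    (liftSAB (R := R) (C := C) u.1)ᴴ * liftSAB u.1 = 1 :=
  lift_unitary splitSAB u

theorem liftSAM_unitary (u : Matrix.unitaryGroup ((S × A) × M) ℂ) :
    (liftSAM (R := R) (B := B) (C := C) u.1)ᴴ * liftSAM u.1 = 1 :=
  lift_unitary splitSAM u

theorem isState_eEnc (x : A) : IsState (G.eEnc x) := (G.isState_e0 x).conj (liftSA_unitary _)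

theorem isState_e1 (x : A) : IsState (G.e1 x) := (G.isState_eEnc x).conj (liftSAB_unitary _)

variable [Nonempty M]

theorem trace_interact (x : A) (ρ : Matrix (EIdx R S A B C) (EIdx R S A B C) ℂ) :
    (G.interact x ρ).trace = ρ.trace := by
  rw [interact, Matrix.trace_mul_comm, ← mul_assoc, liftSAM_unitary, one_mul,
    Matrix.trace_kronecker, G.isState_τM.2, mul_one]

theorem posSemidef_interact (x : A) {ρ : Matrix (EIdx R S A B C) (EIdx R S A B C) ℂ}
    (h : ρ.PosSemidef) : (G.interact x ρ).PosSemidef :=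
  (h.kronecker G.isState_τM.1).mul_mul_conjTranspose_same _

theorem isState_interact (x : A) {ρ : Matrix (EIdx R S A B C) (EIdx R S A B C) ℂ}
    (h : IsState ρ) : IsState (G.interact x ρ) :=
  ⟨G.posSemidef_interact x h.1, by rw [trace_interact, h.2]⟩

/-- Idempotence and cyclicity over M put a projector on each side of the state, a form in which
positivity is visible. -/
theorem instrElem_eq (x : A) (y : Y) (ρ : Matrix (EIdx R S A B C) (EIdx R S A B C) ℂ) :
    G.instrElem x y ρ
      = trRight (((1 : Matrix (EIdx R S A B C) (EIdx R S A B C) ℂ) ⊗ₖ G.proj x y)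
        * G.interact x ρ * ((1 : Matrix _ _ ℂ) ⊗ₖ G.proj x y)ᴴ) := by
  rw [mul_assoc, trRight_one_kron_comm, mul_assoc, Matrix.conjTranspose_kronecker,
    Matrix.conjTranspose_one, (G.proj_herm x y).eq, ← Matrix.mul_kronecker_mul, one_mul,
    G.proj_mul, if_pos rfl]
  rfl

theorem posSemidef_instrElem (x : A) (y : Y) {ρ : Matrix (EIdx R S A B C) (EIdx R S A B C) ℂ}
    (h : ρ.PosSemidef) : (G.instrElem x y ρ).PosSemidef := by
  rw [instrElem_eq]
  exact posSemidef_ptrace _ ((G.posSemidef_interact x h).mul_mul_conjTranspose_same _)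

theorem sum_instrElem (x : A) (ρ : Matrix (EIdx R S A B C) (EIdx R S A B C) ℂ) :
    ∑ y, G.instrElem x y ρ = trRight (G.interact x ρ) := by
  have h : G.interact x ρ = ∑ y, G.interact x ρ *
      ((1 : Matrix (EIdx R S A B C) (EIdx R S A B C) ℂ) ⊗ₖ G.proj x y) := by
    rw [← Matrix.mul_sum]
    have : ∑ y, (1 : Matrix (EIdx R S A B C) (EIdx R S A B C) ℂ) ⊗ₖ G.proj x y
        = (1 : Matrix (EIdx R S A B C) (EIdx R S A B C) ℂ) ⊗ₖ ∑ y, G.proj x y := by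
      ext i j
      simp [Matrix.sum_apply, Finset.mul_sum]
    rw [this, G.proj_sum, Matrix.one_kronecker_one, mul_one]
  conv_rhs => rw [h]
  ext i j
  simp only [instrElem, ptrace, Matrix.sum_apply, Matrix.of_apply]
  exact Finset.sum_comm

theorem instr_eq_block (x : A) (ρ : Matrix (EIdx R S A B C) (EIdx R S A B C) ℂ) :
    G.instr x ρ = block (fun _ => 1) fun y => G.instrElem x y ρ :=
  sum_kron_single _

theorem posSemidef_instr (x : A) {ρ : Matrix (EIdx R S A B C) (EIdx R S A B C) ℂ}
    (h : ρ.PosSemidef) : (G.instr x ρ).PosSemidef :=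
  Matrix.posSemidef_sum _ fun y _ => (G.posSemidef_instrElem x y h).kronecker (isState_single y).1

theorem trace_instr (x : A) (ρ : Matrix (EIdx R S A B C) (EIdx R S A B C) ℂ) :
    (G.instr x ρ).trace = ρ.trace := by
  rw [instr_eq_block, ← trace_trRight, trRight_block, sum_instrElem, trace_trRight,
    trace_interact]

/-- The instrument as a linear map. -/
noncomputable def instrLin (x : A) :
    Matrix (EIdx R S A B C) (EIdx R S A B C) ℂ →ₗ[ℂ]
      Matrix (EIdx R S A B C × Y) (EIdx R S A B C × Y) ℂ where
  toFun := G.instr x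
  map_add' ρ σ := by
    have h : ∀ y, G.instrElem x y (ρ + σ) = G.instrElem x y ρ + G.instrElem x y σ := by
      intro y
      rw [instrElem, interact, Matrix.add_kronecker, mul_add, add_mul, add_mul]
      ext i j
      simp [instrElem, interact, ptrace, Finset.sum_add_distrib]
    simp only [instr, h, Matrix.add_kronecker, Finset.sum_add_distrib]
  map_smul' c ρ := by
    have h : ∀ y, G.instrElem x y (c • ρ) = c • G.instrElem x y ρ := by
      intro y
      rw [instrElem, interact, Matrix.smul_kronecker, Matrix.mul_smul, Matrix.smul_mul,
        Matrix.smul_mul]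
      ext i j
      simp [instrElem, interact, ptrace, Finset.mul_sum]
    simp only [instr, h, Matrix.smul_kronecker, Finset.smul_sum, RingHom.id_apply]

theorem isState_s2 (x : A) : IsState (G.s2 x) :=
  ⟨G.posSemidef_instr x (G.isState_e1 x).1, by rw [s2, trace_instr, (G.isState_e1 x).2]⟩

/-- The error correction as one unitary controlled by the memory. -/
theorem s3_eq_conj (x : A) :
    ∃ W : Matrix (EIdx R S A B C × Y) (EIdx R S A B C × Y) ℂ, Wᴴ * W = 1 ∧
      G.s3 x = W * G.s2 x * Wᴴ := by
  refine ⟨block (fun _ => 1) fun y => liftSA (G.Udec x y).1, ?_, ?_⟩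
  · rw [block_conjTranspose, block_mul]
    simp only [liftSA_unitary, mul_one]
    rw [← sum_kron_single]
    have : ∑ y : Y, (1 : Matrix (EIdx R S A B C) (EIdx R S A B C) ℂ) ⊗ₖ Matrix.single y y (1 : ℂ)
        = (1 : Matrix (EIdx R S A B C) (EIdx R S A B C) ℂ) ⊗ₖ
          ∑ y : Y, Matrix.single y y (1 : ℂ) := by
      ext i j
      simp [Matrix.sum_apply, Finset.mul_sum]
    rw [this, Matrix.sum_single_eq_diagonal, Matrix.diagonal_one, Matrix.one_kronecker_one]
  · rw [s2, instr_eq_block, block_conjTranspose, block_mul, block_mul]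
    simp only [mul_one]
    exact sum_kron_single _

theorem isState_s3 (x : A) : IsState (G.s3 x) := by
  obtain ⟨W, hW, h⟩ := G.s3_eq_conj x
  rw [h]
  exact (G.isState_s2 x).conj hW

/-- The exchange of `A` with `A'` as a permutation of the basis. -/
def swapEquiv : EIdx R S A B C × Y ≃ EIdx R S A B C × Y where
  toFun := swapAA
  invFun := swapAA
  left_inv _ := rfl
  right_inv _ := rfl

theorem isState_sF (x : A) : IsState (G.sF x) := (G.isState_s3 x).submatrix swapEquiv

/-- After the syndrome measurement only a unitary controlled by Y and a permutation of the basis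
act. -/
theorem entropy_sF (x : A) : entropy (G.sF x) = entropy (G.s2 x) := by
  obtain ⟨W, hW, h⟩ := G.s3_eq_conj x
  have h1 : entropy (G.sF x) = entropy (G.s3 x) :=
    entropy_submatrix (G.isState_s3 x).herm swapEquiv
  rw [h1, h, entropy_conj (G.isState_s2 x).herm hW]

theorem isState_avg {n : Type*} [Fintype n] [DecidableEq n] {s : A → Matrix n n ℂ} (h : ∀ x, IsState (s x)) :
    IsState (G.avg s) := isState_sum G.pX_nonneg G.sum_pX h

end States

end Engine

end QEC

namespace QEC.Engine

variable {R S A B C M Y : Type*}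
  [Fintype R] [Fintype S] [Fintype A] [Fintype B] [Fintype C] [Fintype M] [Fintype Y]
  [DecidableEq R] [DecidableEq S] [DecidableEq A] [DecidableEq B] [DecidableEq C]
  [DecidableEq M] [DecidableEq Y]
  (G : Engine R S A B C M Y)

/-! ### Energy balance -/

section Energy

/-- An observable of the two baths, as an operator on `E`. -/
def liftBath (o : Matrix (B × (A × C)) (B × (A × C)) ℂ) :
    Matrix (EIdx R S A B C) (EIdx R S A B C) ℂ :=
  lift (fun t : EIdx R S A B C => ((t.1.2, t.2), (t.1.1.1.1, (t.1.1.1.2, t.1.1.2)))) o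

/-- An observable of the cold bath, as an operator on `E`. -/
def liftCold (o : Matrix (A × C) (A × C) ℂ) :
    Matrix (EIdx R S A B C) (EIdx R S A B C) ℂ :=
  lift (fun t : EIdx R S A B C => (t.2, t.1)) o

/-- An observable of the hot bath, as an operator on `E`. -/
def liftHot (o : Matrix B B ℂ) : Matrix (EIdx R S A B C) (EIdx R S A B C) ℂ :=
  lift (fun t : EIdx R S A B C => (t.1.2, (t.1.1, t.2))) o

theorem liftCold_eq_liftBath (o : Matrix (A × C) (A × C) ℂ) :
    liftCold o = liftBath (R := R) (S := S) ((1 : Matrix B B ℂ) ⊗ₖ o) := by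
  ext t t'
  simp only [liftCold, liftBath, lift_apply, Matrix.kroneckerMap_apply, Matrix.one_apply,
    Prod.ext_iff]
  split_ifs <;> simp_all

theorem liftHot_eq_liftBath (o : Matrix B B ℂ) :
    liftHot o = liftBath (R := R) (S := S) (o ⊗ₖ (1 : Matrix (A × C) (A × C) ℂ)) := by
  ext t t'
  simp only [liftHot, liftBath, lift_apply, Matrix.kroneckerMap_apply, Matrix.one_apply,
    Prod.ext_iff]
  split_ifs <;> simp_all

theorem liftSA_commute_liftBath (u : Matrix (S × A) (S × A) ℂ)
    (o : Matrix (B × (A × C)) (B × (A × C)) ℂ) :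
    liftSA (R := R) u * liftBath o = liftBath o * liftSA u := by
  let e : EIdx R S A B C ≃ (S × A) × ((B × (A × C)) × R) :=
    { toFun := fun t => ((t.1.1.1.2, t.1.1.2), ((t.1.2, t.2), t.1.1.1.1))
      invFun := fun t => ((((t.2.2, t.1.1), t.1.2), t.2.1.1), t.2.1.2)
      left_inv := fun _ => rfl
      right_inv := fun _ => rfl }
  unfold liftSA liftBath
  refine lift_commute e ?_ ?_ ?_ ?_ u o <;> intros <;>
    simp only [e, Equiv.coe_fn_mk, Prod.ext_iff] <;> tauto

theorem liftSAB_commute_liftCold (u : Matrix ((S × A) × B) ((S × A) × B) ℂ)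
    (o : Matrix (A × C) (A × C) ℂ) :
    liftSAB (R := R) u * liftCold o = liftCold o * liftSAB u := by
  let e : EIdx R S A B C ≃ ((S × A) × B) × ((A × C) × R) :=
    { toFun := fun t => (((t.1.1.1.2, t.1.1.2), t.1.2), (t.2, t.1.1.1.1))
      invFun := fun t => ((((t.2.2, t.1.1.1), t.1.1.2), t.1.2), t.2.1)
      left_inv := fun _ => rfl
      right_inv := fun _ => rfl }
  unfold liftSAB liftCold
  refine lift_commute e ?_ ?_ ?_ ?_ u o <;> intros <;>
    simp only [e, Equiv.coe_fn_mk, Prod.ext_iff] <;> tauto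

theorem liftSAM_commute_liftBath (u : Matrix ((S × A) × M) ((S × A) × M) ℂ)
    (o : Matrix (B × (A × C)) (B × (A × C)) ℂ) :
    liftSAM (R := R) u * (liftBath o ⊗ₖ (1 : Matrix M M ℂ))
      = (liftBath o ⊗ₖ (1 : Matrix M M ℂ)) * liftSAM u := by
  let e : EIdx R S A B C × M ≃ ((S × A) × M) × ((B × (A × C)) × R) :=
    { toFun := fun t => (((t.1.1.1.1.2, t.1.1.1.2), t.2), ((t.1.1.2, t.1.2), t.1.1.1.1.1))
      invFun := fun t => (((((t.2.2, t.1.1.1), t.1.1.2), t.2.1.1), t.2.1.2), t.1.2)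
      left_inv := fun _ => rfl
      right_inv := fun _ => rfl }
  have h : (liftBath o ⊗ₖ (1 : Matrix M M ℂ) : Matrix (EIdx R S A B C × M) _ ℂ)
      = lift (fun t : EIdx R S A B C × M =>
        ((t.1.1.2, t.1.2), ((t.1.1.1.1.1, (t.1.1.1.1.2, t.1.1.1.2)), t.2))) o := by
    ext t t'
    simp only [liftBath, lift_apply, Matrix.kroneckerMap_apply, Matrix.one_apply, Prod.ext_iff]
    split_ifs <;> simp_all
  rw [h]
  unfold liftSAM
  refine lift_commute e ?_ ?_ ?_ ?_ u o <;> intros <;>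
    simp only [e, Equiv.coe_fn_mk, Prod.ext_iff] <;> tauto

/-- The heat exchanged with the hot bath is taken from `SA`. -/
theorem liftSAB_commute_total :
    liftSAB (R := R) (C := C) G.Uh.1 * (liftSA G.Hmid + liftHot G.HB)
      = (liftSA G.Hmid + liftHot G.HB) * liftSAB G.Uh.1 := by
  have h : (liftSA G.Hmid + liftHot G.HB : Matrix (EIdx R S A B C) (EIdx R S A B C) ℂ)
      = liftSAB (G.Hmid ⊗ₖ (1 : Matrix B B ℂ) + (1 : Matrix (S × A) (S × A) ℂ) ⊗ₖ G.HB) := by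
    ext t t'
    simp only [liftSAB, liftSA, liftHot, lift_apply, Matrix.kroneckerMap_apply,
      Matrix.add_apply, Matrix.one_apply, Prod.ext_iff]
    split_ifs <;> simp_all
  rw [h]
  have := lift_mul (splitSAB (R := R) (S := S) (A := A) (B := B) (C := C))
  exact (this _ _).trans ((congrArg _ G.Uh_comm.eq).trans (this _ _).symm)

variable [Nonempty A] [Nonempty B] [Nonempty C]

theorem expect_eEnc_liftBath (x : A) (o : Matrix (B × (A × C)) (B × (A × C)) ℂ) :
    expect (G.eEnc x) (liftBath o) = expect (G.e0 x) (liftBath o) :=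
  expect_conj_of_commute (liftSA_unitary _) (liftSA_commute_liftBath _ _)

theorem expect_e1_liftCold (x : A) (o : Matrix (A × C) (A × C) ℂ) :
    expect (G.e1 x) (liftCold o) = expect (G.e0 x) (liftCold o) := by
  rw [e1, expect_conj_of_commute (liftSAB_unitary _) (liftSAB_commute_liftCold _ _),
    liftCold_eq_liftBath, expect_eEnc_liftBath]

theorem expect_e0_liftCold (x : A) (o : Matrix (A × C) (A × C) ℂ) :
    expect (G.e0 x) (liftCold o) = expect G.τBc o := by
  have h : trLeft (G.e0 x) = G.τBc := by
    ext i j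
    have h1 := ((G.isState_ψψ.kron (isState_single x)).kron G.isState_τB).2
    simp only [ptrace, e0, Matrix.of_apply]
    simp only [Matrix.kroneckerMap_apply (f := fun a b : ℂ => a * b) (A := _ ⊗ₖ G.τB)]
    rw [← Finset.sum_mul]
    exact (congrArg (· * _) h1).trans (one_mul _)
  rw [← h, expect_trLeft]
  congr 1
  ext t t'
  simp only [liftCold, lift_apply, Matrix.kroneckerMap_apply, Matrix.one_apply]
  split_ifs <;> simp_all

theorem expect_e0_liftHot (x : A) (o : Matrix B B ℂ) :
    expect (G.e0 x) (liftHot o) = expect G.τB o := by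
  have h1 : trRight (G.e0 x) = G.ψψ ⊗ₖ Matrix.single x x 1 ⊗ₖ G.τB := by
    ext i j
    have h1 := (G.isState_τA.kron G.isState_τC).2
    simp only [ptrace, e0, Matrix.of_apply]
    simp only [Matrix.kroneckerMap_apply (f := fun a b : ℂ => a * b) (A := _ ⊗ₖ G.τB)]
    rw [← Finset.mul_sum]
    exact (congrArg (_ * ·) h1).trans (mul_one _)
  have h2 : trLeft (G.ψψ ⊗ₖ Matrix.single x x 1 ⊗ₖ G.τB) = G.τB := by
    ext i j
    have h1 := (G.isState_ψψ.kron (isState_single x)).2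
    simp only [ptrace, Matrix.of_apply]
    simp only [Matrix.kroneckerMap_apply (f := fun a b : ℂ => a * b) (B := G.τB)]
    rw [← Finset.sum_mul]
    exact (congrArg (· * _) h1).trans (one_mul _)
  rw [← h2, expect_trLeft, ← h1, expect_trRight]
  congr 1
  ext t t'
  simp only [liftHot, lift_apply, Matrix.kroneckerMap_apply, Matrix.one_apply, Prod.ext_iff]
  split_ifs <;> simp_all

/-- The interaction commutes with the sum of the two energies, and the encoding has not touched the
hot bath, which still has its thermal mean energy. -/
theorem expect_e1_total (x : A) :
    expect (G.e1 x) (liftSA G.Hmid) + expect (G.e1 x) (liftHot G.HB)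
      = expect (G.eEnc x) (liftSA G.Hmid) + expect G.τB G.HB := by
  rw [← expect_add, e1, expect_conj_of_commute (liftSAB_unitary _) G.liftSAB_commute_total,
    expect_add, liftHot_eq_liftBath, expect_eEnc_liftBath, ← liftHot_eq_liftBath,
    expect_e0_liftHot]

variable [Nonempty M]

/-- Neither the measurement nor the decoding touches the baths: each decoding unitary drops out, the
sum over y becomes the trace over M, and the interaction with M then drops out too. -/
theorem expect_s3_liftBath (x : A) (o : Matrix (B × (A × C)) (B × (A × C)) ℂ) :
    expect (G.s3 x) (liftBath o ⊗ₖ (1 : Matrix Y Y ℂ)) = expect (G.e1 x) (liftBath o) := by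
  have h : G.s3 x = block (fun _ => 1) fun y =>
      liftSA (G.Udec x y).1 * G.instrElem x y (G.e1 x) * (liftSA (G.Udec x y).1)ᴴ :=
    sum_kron_single _
  rw [h, expect_block_kron_one]
  simp only [expect_conj_of_commute (liftSA_unitary _) (liftSA_commute_liftBath _ _)]
  have h2 : ∑ y, expect (G.instrElem x y (G.e1 x)) (liftBath o)
      = expect (∑ y, G.instrElem x y (G.e1 x)) (liftBath o) := by
    simp [expect, Finset.sum_mul, Matrix.trace_sum]
  rw [h2, sum_instrElem, expect_trRight, interact,
    expect_conj_of_commute (liftSAM_unitary _) (liftSAM_commute_liftBath _ _), expect, expect,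
    ← Matrix.mul_kronecker_mul, Matrix.trace_kronecker, mul_one, G.isState_τM.2, mul_one]

theorem expect_s3_liftHot (x : A) (o : Matrix B B ℂ) :
    expect (G.s3 x) (liftHot o ⊗ₖ (1 : Matrix Y Y ℂ)) = expect (G.e1 x) (liftHot o) := by
  rw [liftHot_eq_liftBath, expect_s3_liftBath]

theorem expect_s3_liftCold (x : A) (o : Matrix (A × C) (A × C) ℂ) :
    expect (G.s3 x) (liftCold o ⊗ₖ (1 : Matrix Y Y ℂ)) = expect G.τBc o := by
  rw [liftCold_eq_liftBath, expect_s3_liftBath, ← liftCold_eq_liftBath, expect_e1_liftCold,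
    expect_e0_liftCold]

end Energy

end QEC.Engine

namespace QEC.Engine

variable {R S A B C M Y : Type*}
  [Fintype R] [Fintype S] [Fintype A] [Fintype B] [Fintype C] [Fintype M] [Fintype Y]
  [DecidableEq R] [DecidableEq S] [DecidableEq A] [DecidableEq B] [DecidableEq C]
  [DecidableEq M] [DecidableEq Y]
  (G : Engine R S A B C M Y)

/-! ### First law over the cycle -/

section FirstLaw

theorem expect_kron_one {T P : Type*} [Fintype T] [Fintype P] [DecidableEq P]
    (ρ O : Matrix T T ℂ) {σ : Matrix P P ℂ} (h : σ.trace = 1) :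
    expect (ρ ⊗ₖ σ) (O ⊗ₖ (1 : Matrix P P ℂ)) = expect ρ O := by
  rw [expect, expect, ← Matrix.mul_kronecker_mul, Matrix.trace_kronecker, mul_one, h, mul_one]

theorem expect_one_kron {T P : Type*} [Fintype T] [Fintype P] [DecidableEq P]
    (ρ O : Matrix T T ℂ) {σ : Matrix P P ℂ} (h : σ.trace = 1) :
    expect (σ ⊗ₖ ρ) ((1 : Matrix P P ℂ) ⊗ₖ O) = expect ρ O := by
  rw [expect, expect, ← Matrix.mul_kronecker_mul, Matrix.trace_kronecker, mul_one, h, one_mul]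

theorem expect_ptrace_avg {T P Q : Type*} [Fintype T] [Fintype P] [Fintype Q] [DecidableEq T]
    [DecidableEq P] [DecidableEq Q] (g : P → Q → T) (s : A → Matrix T T ℂ) (H : Matrix P P ℂ) :
    expect (ptrace g (G.avg s)) H = ∑ x, G.pX x * expect (ptrace g (s x)) H := by
  rw [avg, ptrace_sum, expect_sum]

/-- An observable of the ancilla, as an operator on `E Y`. -/
def liftAncilla (o : Matrix A A ℂ) : Matrix (EIdx R S A B C × Y) (EIdx R S A B C × Y) ℂ :=
  lift (fun t : EIdx R S A B C × Y => (t.1.1.1.2, (t.1.1.1.1, t.1.1.2, t.1.2, t.2))) o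

/-- An observable of the system, as an operator on `E Y`. -/
def liftSystem (o : Matrix S S ℂ) : Matrix (EIdx R S A B C × Y) (EIdx R S A B C × Y) ℂ :=
  lift (fun t : EIdx R S A B C × Y =>
    (t.1.1.1.1.2, (t.1.1.1.1.1, t.1.1.1.2, t.1.1.2, t.1.2, t.2))) o

theorem expect_redSA (ρ : Matrix (EIdx R S A B C × Y) (EIdx R S A B C × Y) ℂ)
    (H : Matrix (S × A) (S × A) ℂ) :
    expect (redSA ρ) H = expect ρ (liftSA H ⊗ₖ (1 : Matrix Y Y ℂ)) := by
  let e : (S × A) × (R × B × (A × C) × Y) ≃ EIdx R S A B C × Y :=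
    { toFun := fun t => (((((t.2.1, t.1.1), t.1.2), t.2.2.1), t.2.2.2.1), t.2.2.2.2)
      invFun := fun t => ((t.1.1.1.1.2, t.1.1.1.2), (t.1.1.1.1.1, t.1.1.2, t.1.2, t.2))
      left_inv := fun _ => rfl
      right_inv := fun _ => rfl }
  refine (expect_ptrace e ρ H).trans ?_
  congr 1
  ext t t'
  simp only [e, liftSA, lift_apply, Matrix.kroneckerMap_apply, Matrix.one_apply, Prod.ext_iff,
    Equiv.coe_fn_symm_mk]
  split_ifs <;> simp_all

theorem expect_redBh (ρ : Matrix (EIdx R S A B C × Y) (EIdx R S A B C × Y) ℂ)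
    (H : Matrix B B ℂ) :
    expect (redBh ρ) H = expect ρ (liftHot H ⊗ₖ (1 : Matrix Y Y ℂ)) := by
  let e : B × (((R × S) × A) × (A × C) × Y) ≃ EIdx R S A B C × Y :=
    { toFun := fun t => (((t.2.1, t.1), t.2.2.1), t.2.2.2)
      invFun := fun t => (t.1.1.2, (t.1.1.1, t.1.2, t.2))
      left_inv := fun _ => rfl
      right_inv := fun _ => rfl }
  refine (expect_ptrace e ρ H).trans ?_
  congr 1
  ext t t'
  simp only [e, liftHot, lift_apply, Matrix.kroneckerMap_apply, Matrix.one_apply, Prod.ext_iff,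
    Equiv.coe_fn_symm_mk]
  split_ifs <;> simp_all

theorem expect_redBc (ρ : Matrix (EIdx R S A B C × Y) (EIdx R S A B C × Y) ℂ)
    (H : Matrix (A × C) (A × C) ℂ) :
    expect (redBc ρ) H = expect ρ (liftCold H ⊗ₖ (1 : Matrix Y Y ℂ)) := by
  let e : (A × C) × ((((R × S) × A) × B) × Y) ≃ EIdx R S A B C × Y :=
    { toFun := fun t => ((t.2.1, t.1), t.2.2)
      invFun := fun t => (t.1.2, (t.1.1, t.2))
      left_inv := fun _ => rfl
      right_inv := fun _ => rfl }
  refine (expect_ptrace e ρ H).trans ?_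
  congr 1
  ext t t'
  simp only [e, liftCold, lift_apply, Matrix.kroneckerMap_apply, Matrix.one_apply, Prod.ext_iff,
    Equiv.coe_fn_symm_mk]
  split_ifs <;> simp_all

theorem expect_sF (x : A) (O : Matrix (EIdx R S A B C × Y) (EIdx R S A B C × Y) ℂ) :
    expect (G.sF x) O = expect (G.s3 x) (O.submatrix swapAA swapAA) :=
  expect_submatrix swapEquiv (G.s3 x) (O.submatrix swapAA swapAA)

theorem liftCold_add (o o' : Matrix (A × C) (A × C) ℂ) :
    (liftCold (o + o') : Matrix (EIdx R S A B C) _ ℂ) = liftCold o + liftCold o' := lift_add _ _ _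

theorem liftSA_add (o o' : Matrix (S × A) (S × A) ℂ) :
    (liftSA (o + o') : Matrix (EIdx R S A B C) _ ℂ) = liftSA o + liftSA o' := lift_add _ _ _

theorem liftSA_system (o : Matrix S S ℂ) :
    (liftSA (o ⊗ₖ (1 : Matrix A A ℂ)) ⊗ₖ (1 : Matrix Y Y ℂ) :
      Matrix (EIdx R S A B C × Y) _ ℂ) = liftSystem o := by
  ext t t'
  simp only [liftSA, liftSystem, lift_apply, Matrix.kroneckerMap_apply, Matrix.one_apply,
    Prod.ext_iff]
  split_ifs <;> simp_all

theorem liftSA_ancilla (o : Matrix A A ℂ) :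
    (liftSA ((1 : Matrix S S ℂ) ⊗ₖ o) ⊗ₖ (1 : Matrix Y Y ℂ) :
      Matrix (EIdx R S A B C × Y) _ ℂ) = liftAncilla o := by
  ext t t'
  simp only [liftSA, liftAncilla, lift_apply, Matrix.kroneckerMap_apply, Matrix.one_apply,
    Prod.ext_iff]
  split_ifs <;> simp_all

theorem liftSystem_swap (o : Matrix S S ℂ) :
    (liftSystem o : Matrix (EIdx R S A B C × Y) _ ℂ).submatrix swapAA swapAA = liftSystem o := by
  ext t t'
  simp only [liftSystem, lift_apply, Matrix.submatrix_apply, swapAA, Prod.ext_iff]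
  split_ifs <;> simp_all

theorem liftAncilla_swap (o : Matrix A A ℂ) :
    (liftAncilla o : Matrix (EIdx R S A B C × Y) _ ℂ).submatrix swapAA swapAA
      = liftCold (o ⊗ₖ (1 : Matrix C C ℂ)) ⊗ₖ (1 : Matrix Y Y ℂ) := by
  ext t t'
  simp only [liftAncilla, liftCold, lift_apply, Matrix.submatrix_apply, swapAA,
    Matrix.kroneckerMap_apply, Matrix.one_apply, Prod.ext_iff]
  split_ifs <;> simp_all

theorem liftHot_swap (o : Matrix B B ℂ) :
    (liftHot o ⊗ₖ (1 : Matrix Y Y ℂ) : Matrix (EIdx R S A B C × Y) _ ℂ).submatrix swapAA swapAA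
      = liftHot o ⊗ₖ (1 : Matrix Y Y ℂ) := by
  ext t t'
  simp only [liftHot, lift_apply, Matrix.submatrix_apply, swapAA,
    Matrix.kroneckerMap_apply, Matrix.one_apply, Prod.ext_iff]
  split_ifs <;> simp_all

theorem liftCold_C_swap (o : Matrix C C ℂ) :
    (liftCold ((1 : Matrix A A ℂ) ⊗ₖ o) ⊗ₖ (1 : Matrix Y Y ℂ) :
      Matrix (EIdx R S A B C × Y) _ ℂ).submatrix swapAA swapAA
      = liftCold ((1 : Matrix A A ℂ) ⊗ₖ o) ⊗ₖ (1 : Matrix Y Y ℂ) := by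
  ext t t'
  simp only [liftCold, lift_apply, Matrix.submatrix_apply, swapAA,
    Matrix.kroneckerMap_apply, Matrix.one_apply, Prod.ext_iff]
  split_ifs <;> simp_all

theorem liftCold_A_swap (o : Matrix A A ℂ) :
    (liftCold (o ⊗ₖ (1 : Matrix C C ℂ)) ⊗ₖ (1 : Matrix Y Y ℂ) :
      Matrix (EIdx R S A B C × Y) _ ℂ).submatrix swapAA swapAA = liftAncilla o := by
  rw [← liftAncilla_swap]; rfl

theorem redY_kron (ρ : Matrix (EIdx R S A B C) (EIdx R S A B C) ℂ) (h : ρ.trace = 1)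
    (σ : Matrix Y Y ℂ) : redY (ρ ⊗ₖ σ) = σ := by
  ext i j
  simp only [redY, ptrace, Matrix.of_apply]
  simp only [Matrix.kroneckerMap_apply (f := fun a b : ℂ => a * b) (B := σ)]
  rw [← Finset.sum_mul]
  exact (congrArg (· * _) h).trans (one_mul _)

variable [Nonempty A] [Nonempty B] [Nonempty C]

theorem expect_redSA_kron (ρ : Matrix (EIdx R S A B C) (EIdx R S A B C) ℂ)
    (H : Matrix (S × A) (S × A) ℂ) :
    expect (redSA (ρ ⊗ₖ ketbra G.y0)) H = expect ρ (liftSA H) := by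
  rw [expect_redSA, expect_kron_one]
  exact (isState_single G.y0).2

theorem energy_avg_kron (H : Matrix (S × A) (S × A) ℂ)
    {s : A → Matrix (EIdx R S A B C) (EIdx R S A B C) ℂ} (hs : ∀ x, (s x).trace = 1) :
    G.energy H (G.avg fun x => s x ⊗ₖ ketbra G.y0)
      = ∑ x, G.pX x * expect (s x) (liftSA H) + expect (ketbra G.y0) G.HY := by
  rw [energy, redSA, redY, expect_ptrace_avg, expect_ptrace_avg]
  congr 1
  · exact Finset.sum_congr rfl fun x _ => congrArg (G.pX x * ·) (G.expect_redSA_kron (s x) H)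
  · have : ∀ x, ptrace (fun (y : Y) (e : EIdx R S A B C) => (e, y)) (s x ⊗ₖ ketbra G.y0)
        = ketbra G.y0 := fun x => redY_kron _ (hs x) _
    simp_rw [this]
    rw [← Finset.sum_mul, G.sum_pX, one_mul]

/-- The thermal ancilla is diagonal in the measured basis, so averaging over the outcome restores
it. -/
theorem Ui_eq_U0 : G.Ui = G.U0 := by
  rw [Ui, U0]
  congr 1
  ext ⟨⟨⟨⟨i, a⟩, b⟩, c⟩, y⟩ ⟨⟨⟨⟨i', a'⟩, b'⟩, c'⟩, y'⟩
  simp only [eI, e0, avg, Matrix.sum_apply, Matrix.smul_apply, Matrix.kroneckerMap_apply, τA,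
    Matrix.single_apply, smul_eq_mul]
  by_cases h : a = a'
  · subst h
    rw [Finset.sum_eq_single a]
    · simp; ring
    · intro x _ hx; simp [hx]
    · simp
  · rw [Matrix.diagonal_apply_ne _ h]
    simp only [mul_zero, zero_mul]
    refine (Finset.sum_eq_zero fun x _ => ?_).symm
    by_cases hx : x = a
    · subst hx; simp [h]
    · simp [hx]

theorem expect_τBc_A (o : Matrix A A ℂ) :
    expect G.τBc (o ⊗ₖ (1 : Matrix C C ℂ)) = expect G.τA o :=
  expect_kron_one _ _ G.isState_τC.2

theorem expect_τBc_C (o : Matrix C C ℂ) :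
    expect G.τBc ((1 : Matrix A A ℂ) ⊗ₖ o) = expect G.τC o :=
  expect_one_kron _ _ G.isState_τA.2

variable [Nonempty M]

theorem expect_redBh_sF (x : A) :
    expect (redBh (G.sF x)) G.HB = expect (G.e1 x) (liftHot G.HB) := by
  rw [expect_redBh, expect_sF, liftHot_swap, expect_s3_liftHot]

theorem expect_redBc_sF (x : A) :
    expect (redBc (G.sF x)) G.HBc = expect (G.s3 x) (liftAncilla G.HA) + expect G.τC G.HC := by
  rw [expect_redBc, expect_sF, HBc, liftCold_add, Matrix.add_kronecker,
    Matrix.submatrix_add, Pi.add_apply, Pi.add_apply, expect_add, liftCold_A_swap, liftCold_C_swap, expect_s3_liftCold, expect_τBc_C]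

theorem expect_redSA_s3 (x : A) :
    expect (redSA (G.s3 x)) G.HSA
      = expect (G.s3 x) (liftSystem G.HS) + expect (G.s3 x) (liftAncilla G.HA) := by
  rw [expect_redSA, HSA, liftSA_add, Matrix.add_kronecker, expect_add, liftSA_system, liftSA_ancilla]

/-- The swap moves into A the copy A', which no earlier stage has touched. -/
theorem expect_liftAncilla_sF (x : A) :
    expect (G.sF x) (liftAncilla G.HA) = expect G.τA G.HA := by
  rw [expect_sF, liftAncilla_swap, expect_s3_liftCold, expect_τBc_A]

theorem expect_redSA_sF (x : A) :
    expect (redSA (G.sF x)) G.HSA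
      = expect (G.s3 x) (liftSystem G.HS) + expect G.τA G.HA := by
  rw [expect_redSA, HSA, liftSA_add, Matrix.add_kronecker, expect_add, liftSA_system, liftSA_ancilla, expect_liftAncilla_sF, expect_sF,
    liftSystem_swap]

theorem redY_sF (x : A) : redY (G.sF x) = redY (G.s3 x) := by
  ext y y'
  simp only [redY, ptrace, Matrix.of_apply]
  let e : EIdx R S A B C ≃ EIdx R S A B C :=
    { toFun := fun t => ((((t.1.1.1, t.2.1), t.1.2), (t.1.1.2, t.2.2)))
      invFun := fun t => ((((t.1.1.1, t.2.1), t.1.2), (t.1.1.2, t.2.2)))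
      left_inv := fun _ => rfl
      right_inv := fun _ => rfl }
  exact Equiv.sum_comp e fun t => G.s3 x (t, y) (t, y')

theorem redY_block (F : Y → Matrix (EIdx R S A B C) (EIdx R S A B C) ℂ) :
    redY (block (fun _ => 1) F) = Matrix.diagonal fun y => (F y).trace := by
  ext y y'
  by_cases h : y = y'
  · subst h; simp [redY, ptrace, block, Matrix.trace]
  · simp [redY, ptrace, block, h]

theorem redY_s3 (x : A) : redY (G.s3 x) = redY (G.s2 x) := by
  have h : G.s3 x = block (fun _ => 1) fun y =>
      liftSA (G.Udec x y).1 * G.instrElem x y (G.e1 x) * (liftSA (G.Udec x y).1)ᴴ :=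
    sum_kron_single _
  rw [h, s2, instr_eq_block, redY_block, redY_block]
  congr 1
  funext y
  rw [Matrix.trace_mul_comm, ← mul_assoc, liftSA_unitary, one_mul]

/-- The hot bath takes part in a single stage, where the total energy is conserved; what it loses is
gained by SA. -/
theorem Qh_eq : G.Qh = G.U1 - G.Uen := by
  have h1 : G.U1 = _ := G.energy_avg_kron G.Hmid fun x => (G.isState_e1 x).2
  have h2 : G.Uen = _ := G.energy_avg_kron G.Hmid fun x => (G.isState_eEnc x).2
  have h3 : expect (redBh (G.avg G.sF)) G.HB = ∑ x, G.pX x * expect (G.e1 x) (liftHot G.HB) :=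
    (G.expect_ptrace_avg _ _ _).trans
      (Finset.sum_congr rfl fun x _ => congrArg (G.pX x * ·) (G.expect_redBh_sF x))
  have h4 : expect G.τB G.HB = ∑ x, G.pX x * expect G.τB G.HB := by
    rw [← Finset.sum_mul, G.sum_pX, one_mul]
  rw [h1, h2, Qh, h3, h4, add_sub_add_right_eq_sub, ← Finset.sum_sub_distrib,
    ← Finset.sum_sub_distrib]
  refine Finset.sum_congr rfl fun x _ => ?_
  rw [← mul_sub, ← mul_sub]
  congr 1
  linarith [G.expect_e1_total x]

/-- The first law over the whole cycle. -/
theorem first_law : G.ΔU = G.Wtot + G.Qh + G.Qmeas + G.Qc + G.Qerase := by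
  have hs3 : expect (redSA (G.avg G.s3)) G.HSA
      = ∑ x, G.pX x * (expect (G.s3 x) (liftSystem G.HS)
        + expect (G.s3 x) (liftAncilla G.HA)) :=
    (G.expect_ptrace_avg _ _ _).trans
      (Finset.sum_congr rfl fun x _ => congrArg (G.pX x * ·) (G.expect_redSA_s3 x))
  have hsF : expect (redSA (G.avg G.sF)) G.HSA
      = ∑ x, G.pX x * (expect (G.s3 x) (liftSystem G.HS) + expect G.τA G.HA) :=
    (G.expect_ptrace_avg _ _ _).trans
      (Finset.sum_congr rfl fun x _ => congrArg (G.pX x * ·) (G.expect_redSA_sF x))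
  have hBc : expect (redBc (G.avg G.sF)) G.HBc
      = ∑ x, G.pX x * (expect (G.s3 x) (liftAncilla G.HA) + expect G.τC G.HC) :=
    (G.expect_ptrace_avg _ _ _).trans
      (Finset.sum_congr rfl fun x _ => congrArg (G.pX x * ·) (G.expect_redBc_sF x))
  have hY : expect (redY (G.avg G.sF)) G.HY = expect (redY (G.avg G.s3)) G.HY := by
    refine (G.expect_ptrace_avg _ _ _).trans (Eq.trans ?_ (G.expect_ptrace_avg _ _ _).symm)
    exact Finset.sum_congr rfl fun x _ => by
      have := G.redY_sF x
      rw [redY, redY] at this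
      rw [this]
  have hτ : expect G.τBc G.HBc = expect G.τA G.HA + expect G.τC G.HC := by
    rw [HBc, expect_add, expect_τBc_A, expect_τBc_C]
  simp only [mul_add, Finset.sum_add_distrib, ← Finset.sum_mul, G.sum_pX, one_mul]
    at hs3 hsF hBc
  rw [ΔU, Uerase, hsF, Ui_eq_U0, Wtot, Wenc, Wmeas, Wdec, Qh_eq, Qc, hBc, hτ, Qerase, hY, U3,
    energy, hs3]
  ring

/-- The memory is reset to a ground state, so no distribution over its levels has lower energy. This
removes the inner absolute value in the Landauer condition. -/
theorem Qerase_nonpos : G.Qerase ≤ 0 := by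
  have hst : IsState (redY (G.avg G.sF)) := (G.isState_avg G.isState_sF).trLeft
  have h1 : expect (ketbra G.y0) G.HY = G.εY G.y0 := by
    simp [expect, ketbra, HY, Matrix.trace, Matrix.single_apply, Matrix.mul_diagonal]
  have h2 : expect (redY (G.avg G.sF)) G.HY = ∑ y, ((redY (G.avg G.sF)) y y).re * G.εY y := by
    simp [expect, HY, Matrix.trace, Matrix.mul_diagonal]
  have h3 : ∑ y, ((redY (G.avg G.sF)) y y).re = 1 := by
    rw [← Complex.re_sum]
    exact (congrArg Complex.re hst.2).trans Complex.one_re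
  have h4 : G.εY G.y0 = ∑ y, ((redY (G.avg G.sF)) y y).re * G.εY G.y0 := by
    rw [← Finset.sum_mul, h3, one_mul]
  rw [Qerase, h1, h2, h4, sub_nonpos]
  exact Finset.sum_le_sum fun y _ =>
    mul_le_mul_of_nonneg_left (G.y0_ground y) (re_diag_nonneg hst.1 y)

end FirstLaw

end QEC.Engine

namespace QEC.Engine

variable {R S A B C M Y : Type*}
  [Fintype R] [Fintype S] [Fintype A] [Fintype B] [Fintype C] [Fintype M] [Fintype Y]
  [DecidableEq R] [DecidableEq S] [DecidableEq A] [DecidableEq B] [DecidableEq C]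
  [DecidableEq M] [DecidableEq Y]
  (G : Engine R S A B C M Y)

/-! ### Entropy balance -/

section EntropyBalance

theorem redYX_withX (s : A → Matrix (EIdx R S A B C × Y) (EIdx R S A B C × Y) ℂ) :
    redYX (G.withX s) = block G.pX fun x => redY (s x) := by
  ext ⟨y, x⟩ ⟨y', x'⟩
  simp only [redYX, withX, block, ptrace, redY, Matrix.of_apply]
  split_ifs with h
  · subst h; rw [Finset.mul_sum]
  · simp

theorem redXE_withX (s : A → Matrix (EIdx R S A B C × Y) (EIdx R S A B C × Y) ℂ) :
    redXE (G.withX s) = (block G.pX fun x => trRight (s x)).submatrix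
      (Equiv.prodComm _ _) (Equiv.prodComm _ _) := by
  ext ⟨x, e⟩ ⟨x', e'⟩
  simp only [redXE, withX, block, ptrace, Matrix.of_apply, Matrix.submatrix_apply,
    Equiv.prodComm_apply, Prod.swap_prod_mk]
  split_ifs with h
  · subst h; rw [Finset.mul_sum]
  · simp

theorem trLeft_block {T P : Type*} [Fintype T] [Fintype P] [DecidableEq P] (p : P → ℝ)
    {s : P → Matrix T T ℂ} (hs : ∀ x, (s x).trace = 1) :
    trLeft (block p s) = Matrix.diagonal fun x => (p x : ℂ) := by
  ext x x'
  by_cases h : x = x'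
  · subst h
    simp only [ptrace, block, Matrix.of_apply, if_true, Matrix.diagonal_apply_eq]
    rw [← Finset.mul_sum]
    exact (congrArg (_ * ·) (hs x)).trans (mul_one _)
  · simp [ptrace, block, h]

/-- The Shannon entropy of p cancels against the entropy of the classical register. -/
theorem condEntropy_block {T P : Type*} [Fintype T] [Fintype P] [DecidableEq P] [DecidableEq T]
    (p : P → ℝ) {s : P → Matrix T T ℂ} (hs : ∀ x, IsState (s x)) :
    condEntropy (block p s) = ∑ x, p x * entropy (s x) := by
  rw [condEntropy, entropy_block hs]
  change _ - entropy (trLeft _) = _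
  rw [trLeft_block p fun x => (hs x).2, entropy_diagonal]
  ring

variable [Nonempty A] [Nonempty B] [Nonempty C]

theorem entropy_e1 (x : A) :
    entropy (G.e1 x) = entropy G.τB + (entropy G.τA + entropy G.τC) := by
  rw [e1, entropy_conj (G.isState_eEnc x).herm (liftSAB_unitary _), eEnc,
    entropy_conj (G.isState_e0 x).herm (liftSA_unitary _), e0, τBc,
    entropy_kron ((G.isState_ψψ.kron (isState_single x)).kron G.isState_τB)
      (G.isState_τA.kron G.isState_τC),
    entropy_kron (G.isState_ψψ.kron (isState_single x)) G.isState_τB,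
    entropy_kron G.isState_ψψ (isState_single x), entropy_ψψ, entropy_single,
    entropy_kron G.isState_τA G.isState_τC]
  ring

variable [Nonempty M]

theorem HYX_eq : G.HYX = ∑ x, G.pX x * entropy (redY (G.s2 x)) := by
  rw [HYX, redYX_withX]
  exact condEntropy_block _ fun x => (G.isState_s2 x).trLeft

theorem entropy_τA : entropy G.τA = ∑ x, Real.negMulLog (G.pX x) := entropy_diagonal _

/-- Here `entropy G.τA` stands for the Shannon entropy of p_X. Writing it this way lets it cancel
one of the two ancilla terms, from A and A', in `entropy_final_le`. -/
theorem HXE_eq : G.HXE = entropy G.τA + ∑ x, G.pX x * entropy (trRight (G.sF x))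
    - entropy (trRight (G.avg G.sF)) := by
  have hs : ∀ x, IsState (trRight (G.sF x)) := fun x => (G.isState_sF x).trRight
  have h1 : ptrace (fun (e : EIdx R S A B C) (x : A) => (x, e)) (redXE (G.withX G.sF))
      = trRight (G.avg G.sF) := by
    rw [avg, trRight, ptrace_sum, redXE_withX]
    ext i j
    simp [ptrace, block, Matrix.sum_apply]
  rw [HXE, condEntropy, h1, redXE_withX,
    entropy_submatrix (isState_block G.pX_nonneg G.sum_pX hs).herm, entropy_block hs, entropy_τA]

/-- Conditioned on `x`, the efficacy of the instrument bounds the entropies of `E` and `Y`. -/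
theorem entropy_e1_sub_log_le (x : A) :
    entropy (G.e1 x) - Real.log (efficacy (G.instr x) (G.e1 x))
      ≤ entropy (trRight (G.sF x)) + entropy (redY (G.s2 x)) := by
  have h1 := entropy_sub_log_efficacy_le (G.instrLin x) (fun _ h => G.posSemidef_instr x h)
    (fun ρ => G.trace_instr x ρ) (G.isState_e1 x)
  have h2 := entropy_subadditive (G.isState_sF x)
  rw [G.entropy_sF] at h2
  have h3 : trLeft (G.sF x) = redY (G.s2 x) := (G.redY_sF x).trans (G.redY_s3 x)
  rw [h3] at h2
  exact le_trans h1 h2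

theorem redRS_eq (ρ : Matrix (EIdx R S A B C × Y) (EIdx R S A B C × Y) ℂ) :
    trRight (trRight (trRight (trRight ρ))) = redRS ρ := by
  ext i j
  simp only [ptrace, redRS, Matrix.of_apply, Fintype.sum_prod_type]

theorem redBh_eq (ρ : Matrix (EIdx R S A B C × Y) (EIdx R S A B C × Y) ℂ) :
    trLeft (trRight (trRight ρ)) = redBh ρ := by
  ext i j
  simp only [ptrace, redBh, Matrix.of_apply, Fintype.sum_prod_type]

theorem redBc_eq (ρ : Matrix (EIdx R S A B C × Y) (EIdx R S A B C × Y) ℂ) :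
    trLeft (trRight ρ) = redBc ρ := by
  ext i j
  simp only [ptrace, redBc, Matrix.of_apply, Fintype.sum_prod_type]

theorem expect_ancilla (ρ : Matrix (EIdx R S A B C × Y) (EIdx R S A B C × Y) ℂ)
    (o : Matrix A A ℂ) :
    expect (trLeft (trRight (trRight (trRight ρ)))) o = expect ρ (liftAncilla o) := by
  rw [expect_trLeft, expect_trRight, expect_trRight, expect_trRight]
  congr 1
  ext t t'
  simp only [liftAncilla, lift_apply, Matrix.kroneckerMap_apply, Matrix.one_apply, Prod.ext_iff]
  split_ifs <;> simp_all

/-- The second law for the baths and the ancilla in the final state. -/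
theorem entropy_final_le :
    entropy (trRight (G.avg G.sF)) ≤ G.Se + entropy G.τA
      + (entropy G.τB - 1 / (G.kB * G.Th) * G.Qh)
      + (entropy G.τA + entropy G.τC - 1 / (G.kB * G.Tc) * G.Qc) := by
  have hρ : IsState (G.avg G.sF) := G.isState_avg G.isState_sF
  have s1 := entropy_subadditive hρ.trRight
  have s2 := entropy_subadditive hρ.trRight.trRight
  have s3 := entropy_subadditive hρ.trRight.trRight.trRight
  rw [redBc_eq] at s1
  rw [redBh_eq] at s2
  rw [redRS_eq] at s3
  have hBc : IsState (redBc (G.avg G.sF)) := by rw [← redBc_eq]; exact hρ.trRight.trLeft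
  have hBh : IsState (redBh (G.avg G.sF)) := by rw [← redBh_eq]; exact hρ.trRight.trRight.trLeft
  have s4 := entropy_subadditive hBc
  obtain ⟨-, a1, a2⟩ := thermal_facts G.HA_herm (1 / (G.kB * G.Tc))
  obtain ⟨-, b1, b2⟩ := thermal_facts G.HB_herm (1 / (G.kB * G.Th))
  obtain ⟨-, c1, c2⟩ := thermal_facts G.HC_herm (1 / (G.kB * G.Tc))
  rw [← τA_eq_thermal] at a1
  have kA := a2 _ hρ.trRight.trRight.trRight.trLeft
  have kB := b2 _ hBh
  have kA' := a2 _ hBc.trRight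
  have kC := c2 _ hBc.trLeft
  -- After the swap A has the mean energy of its thermal state, so its entropy is bounded by the
  -- thermal one with no heat correction.
  have eA : expect (trLeft (trRight (trRight (trRight (G.avg G.sF))))) G.HA
      = expect G.τA G.HA := by
    rw [expect_ancilla, avg, expect_sum]
    simp only [expect_liftAncilla_sF]
    rw [← Finset.sum_mul, G.sum_pX, one_mul]
  rw [eA, ← a1] at kA
  have eBc : expect (redBc (G.avg G.sF)) G.HBc
      = expect (trRight (redBc (G.avg G.sF))) G.HA
        + expect (trLeft (redBc (G.avg G.sF))) G.HC := by
    rw [HBc, expect_add, expect_trRight, expect_trLeft]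
  have eτ : expect G.τBc G.HBc = expect G.τA G.HA + expect G.τC G.HC := by
    rw [HBc, expect_add, expect_τBc_A, expect_τBc_C]
  have hQc : 1 / (G.kB * G.Tc) * G.Qc
      = 1 / (G.kB * G.Tc) * expect G.τA G.HA + 1 / (G.kB * G.Tc) * expect G.τC G.HC
        - 1 / (G.kB * G.Tc) * expect (trRight (redBc (G.avg G.sF))) G.HA
        - 1 / (G.kB * G.Tc) * expect (trLeft (redBc (G.avg G.sF))) G.HC := by
    rw [Qc, eτ, eBc]; ring
  have hQh : 1 / (G.kB * G.Th) * G.Qh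
      = 1 / (G.kB * G.Th) * expect G.τB G.HB
        - 1 / (G.kB * G.Th) * expect (redBh (G.avg G.sF)) G.HB := by
    rw [Qh]; ring
  have b1' : entropy G.τB = 1 / (G.kB * G.Th) * expect G.τB G.HB + logZ (1 / (G.kB * G.Th)) G.HB :=
    b1
  have c1' : entropy G.τC = 1 / (G.kB * G.Tc) * expect G.τC G.HC + logZ (1 / (G.kB * G.Tc)) G.HC :=
    c1
  have hSe : G.Se = entropy (redRS (G.avg G.sF)) := rfl
  linarith

/-- The information-theoretic part of the trade-off. -/
theorem second_law :
    1 / (G.kB * G.Tc) * G.Qc + 1 / (G.kB * G.Th) * G.Qh - G.HYX - G.HXE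
      + ∑ x, G.pX x * (-Real.log (efficacy (G.instr x) (G.e1 x))) ≤ G.Se := by
  have h1 : ∑ x, G.pX x * (entropy (G.e1 x) - Real.log (efficacy (G.instr x) (G.e1 x)))
      ≤ ∑ x, G.pX x * (entropy (trRight (G.sF x)) + entropy (redY (G.s2 x))) :=
    Finset.sum_le_sum fun x _ =>
      mul_le_mul_of_nonneg_left (G.entropy_e1_sub_log_le x) (G.pX_nonneg x)
  simp only [entropy_e1, sub_eq_add_neg, mul_add, Finset.sum_add_distrib, ← Finset.sum_mul,
    G.sum_pX, one_mul] at h1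
  have h2 := G.entropy_final_le
  rw [HXE_eq, HYX_eq]
  linarith

end EntropyBalance

/-! ### Heat absorbed from the apparatus -/

section Measurement

/-- Expanding I(P:Q|K) as H(P|K) - H(PQK) + H(QK) leaves the first term intact, to be cancelled by
the same conditional entropy in the definition of the measurement heat. -/
theorem condMutualInfo_eq {P Q K : Type*} [Fintype P] [Fintype Q] [Fintype K] [DecidableEq P]
    [DecidableEq Q] [DecidableEq K] {ρ : Matrix ((P × Q) × K) ((P × Q) × K) ℂ}
    (h : ρ.IsHermitian) :
    condMutualInfo ρ = condEntropy (ptrace (fun (t : P × K) (q : Q) => ((t.1, q), t.2)) ρ)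
      - (entropy ρ - entropy (ptrace (fun (t : Q × K) (p : P) => ((p, t.1), t.2)) ρ)) := by
  rw [condMutualInfo]
  congr 1
  rw [condEntropy]
  congr 1
  · have : ptrace (fun (t : P × (Q × K)) (_ : Unit) => ((t.1, t.2.1), t.2.2)) ρ
        = ρ.submatrix (Equiv.prodAssoc P Q K).symm (Equiv.prodAssoc P Q K).symm := by
      ext i j; simp [ptrace]
    rw [this, entropy_submatrix h]
  · congr 1
    ext i j; simp [ptrace]

/-- Orthogonality of the projectors kills the cross terms, permutation matrices are unitary, and the
projectors add up to 1. -/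
theorem Vmem_unitary (x : A) :
    (G.Vmem x : Matrix ((EIdx R S A B C × M) × Y) _ ℂ)ᴴ * G.Vmem x = 1 := by
  have h1 : ∀ y y' : Y, (((1 : Matrix (EIdx R S A B C) (EIdx R S A B C) ℂ) ⊗ₖ G.proj x y) ⊗ₖ
      (Equiv.swap G.y0 y).permMatrix ℂ)ᴴ
      * (((1 : Matrix (EIdx R S A B C) (EIdx R S A B C) ℂ) ⊗ₖ G.proj x y') ⊗ₖ
      (Equiv.swap G.y0 y').permMatrix ℂ)
      = if y = y' then ((1 : Matrix (EIdx R S A B C) (EIdx R S A B C) ℂ) ⊗ₖ G.proj x y) ⊗ₖ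
        (1 : Matrix Y Y ℂ) else 0 := by
    intro y y'
    rw [Matrix.conjTranspose_kronecker, Matrix.conjTranspose_kronecker,
      ← Matrix.mul_kronecker_mul, ← Matrix.mul_kronecker_mul, (G.proj_herm x y).eq, G.proj_mul,
      Matrix.conjTranspose_one, one_mul]
    split_ifs with h
    · subst h
      congr 1
      rw [Matrix.conjTranspose_permMatrix, ← Matrix.permMatrix_mul]
      simp
    · simp
  rw [Vmem, Matrix.conjTranspose_sum, Matrix.sum_mul]
  simp only [Matrix.mul_sum, h1, Finset.sum_ite_eq, Finset.mem_univ, if_true]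
  have h2 : ∑ y, (((1 : Matrix (EIdx R S A B C) (EIdx R S A B C) ℂ) ⊗ₖ G.proj x y) ⊗ₖ
      (1 : Matrix Y Y ℂ)) = ((1 : Matrix (EIdx R S A B C) (EIdx R S A B C) ℂ) ⊗ₖ
        ∑ y, G.proj x y) ⊗ₖ (1 : Matrix Y Y ℂ) := by
    ext i j
    simp [Matrix.sum_apply, Finset.mul_sum, Finset.sum_mul]
  rw [h2, G.proj_sum, Matrix.one_kronecker_one, Matrix.one_kronecker_one]

theorem permMatrix_conj_ketbra (y y' : Y) :
    (Equiv.swap G.y0 y).permMatrix ℂ * ketbra G.y0 * ((Equiv.swap G.y0 y').permMatrix ℂ)ᴴ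
      = Matrix.single y y' 1 := by
  rw [Matrix.conjTranspose_permMatrix, Equiv.Perm.permMatrix, Equiv.Perm.permMatrix,
    PEquiv.toMatrix_toPEquiv_mul, PEquiv.mul_toMatrix_toPEquiv]
  ext i j
  have h : ∀ a b : Y, G.y0 = Equiv.swap G.y0 a b ↔ a = b := fun a b => by
    rw [eq_comm, Equiv.swap_apply_eq_iff, Equiv.swap_apply_left, eq_comm]
  simp [ketbra, Matrix.single_apply, h]

variable [Nonempty A] [Nonempty B] [Nonempty C] [Nonempty M]

theorem sum_sum_kron_single_apply {T P : Type*} [Fintype P] [DecidableEq P]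
    (Z : P → P → Matrix T T ℂ) (e e' : T) (y y' : P) :
    (∑ a, ∑ b, Z a b ⊗ₖ Matrix.single a b (1 : ℂ)) (e, y) (e', y') = Z y y' e e' := by
  simp only [Matrix.sum_apply, Matrix.kroneckerMap_apply, Matrix.single_apply]
  rw [Finset.sum_eq_single y, Finset.sum_eq_single y']
  · simp
  · intro b _ hb; simp [hb]
  · simp
  · intro b _ hb; simp [hb]
  · simp

theorem m2_apply (x : A) (e e' : EIdx R S A B C × M) (y y' : Y) :
    G.m2 x (e, y) (e', y')
      = (((1 : Matrix (EIdx R S A B C) (EIdx R S A B C) ℂ) ⊗ₖ G.proj x y)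
        * G.interact x (G.e1 x)
        * ((1 : Matrix (EIdx R S A B C) (EIdx R S A B C) ℂ) ⊗ₖ G.proj x y')) e e' := by
  have h : G.m2 x = ∑ a, ∑ b, (((1 : Matrix (EIdx R S A B C) (EIdx R S A B C) ℂ) ⊗ₖ G.proj x a)
        * G.interact x (G.e1 x)
        * ((1 : Matrix (EIdx R S A B C) (EIdx R S A B C) ℂ) ⊗ₖ G.proj x b))
        ⊗ₖ Matrix.single a b (1 : ℂ) := by
    rw [m2, Vmem, Matrix.conjTranspose_sum, Matrix.sum_mul, Matrix.sum_mul]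
    refine Finset.sum_congr rfl fun a _ => ?_
    rw [Matrix.mul_sum]
    refine Finset.sum_congr rfl fun b _ => ?_
    rw [Matrix.conjTranspose_kronecker, Matrix.conjTranspose_kronecker,
      Matrix.conjTranspose_one, (G.proj_herm _ _).eq, ← Matrix.mul_kronecker_mul,
      ← Matrix.mul_kronecker_mul, permMatrix_conj_ketbra]
  rw [h, sum_sum_kron_single_apply]

theorem isState_m2 (x : A) : IsState (G.m2 x) :=
  ((G.isState_interact x (G.isState_e1 x)).kron (isState_single G.y0)).conj (G.Vmem_unitary x)

/-- The unitary model reproduces the instrument. Tracing out M brings the projectors for y' and y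
together, so coherences between different memory states vanish. -/
theorem ptrace_m2 (x : A) :
    ptrace (fun (t : EIdx R S A B C × Y) (k : M) => ((t.1, k), t.2)) (G.m2 x) = G.s2 x := by
  ext ⟨e, y⟩ ⟨e', y'⟩
  rw [s2, instr_eq_block]
  simp only [ptrace, Matrix.of_apply, m2_apply, block]
  change trRight (_ * _ * _) e e' = _
  rw [mul_assoc, trRight_one_kron_comm, mul_assoc, ← Matrix.mul_kronecker_mul, one_mul,
    G.proj_mul]
  by_cases h : y = y'
  · subst h
    simp only [if_true, Complex.ofReal_one, one_mul]
    rfl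
  · rw [if_neg (Ne.symm h), if_neg h]
    simp [ptrace]

theorem ptrace_redYMX :
    ptrace (fun (t : Y × A) (q : M) => ((t.1, q), t.2)) (redYMX (G.withX G.m2))
      = redYX (G.withX G.s2) := by
  ext ⟨y, x⟩ ⟨y', x'⟩
  simp only [ptrace, redYMX, redYX, withX, Matrix.of_apply]
  by_cases h : x = x'
  · subst h
    simp only [if_true, ← ptrace_m2, ptrace, Matrix.of_apply, Finset.mul_sum]
    exact Finset.sum_comm
  · simp [h]

theorem ptrace_redRSAM :
    ptrace (fun (t : ((R × S) × A) × (A × Y)) (q : M) => ((t.1, q), t.2))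
      (redRSAM (G.withX G.m2)) = redRSA (G.withX G.s2) := by
  ext ⟨r, x, y⟩ ⟨r', x', y'⟩
  simp only [ptrace, redRSAM, redRSA, withX, Matrix.of_apply]
  by_cases h : x = x'
  · subst h
    simp only [if_true, ← ptrace_m2, ptrace, Matrix.of_apply, Finset.mul_sum]
    exact Finset.sum_comm
  · simp [h]

/-- Regrouping of `E M Y` as `RSA M Y` and the baths. -/
def splitBaths : (((((R × S) × A) × M) × Y) × (B × (A × C))) ≃ (EIdx R S A B C × M) × Y where
  toFun t := ((((t.1.1.1, t.2.1), t.2.2), t.1.1.2), t.1.2)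
  invFun t := (((t.1.1.1.1, t.1.2), t.2), (t.1.1.1.2, t.1.1.2))
  left_inv _ := rfl
  right_inv _ := rfl

/-- Reduced state of `RSA M Y`. -/
def redRSAMY (ρ : Matrix ((EIdx R S A B C × M) × Y) ((EIdx R S A B C × M) × Y) ℂ) :
    Matrix ((((R × S) × A) × M) × Y) ((((R × S) × A) × M) × Y) ℂ :=
  ptrace (fun p q => splitBaths (p, q)) ρ

/-- The identity can be read off in the block of one fixed label q, hence the need for `Nonempty Q`.
-/
theorem unitary_of_kron_one {P Q : Type*} [Fintype P] [Fintype Q] [DecidableEq P]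
    [DecidableEq Q] [Nonempty Q] {l : Matrix P P ℂ}
    (h : (l ⊗ₖ (1 : Matrix Q Q ℂ))ᴴ * (l ⊗ₖ (1 : Matrix Q Q ℂ)) = 1) : lᴴ * l = 1 := by
  rw [Matrix.conjTranspose_kronecker, ← Matrix.mul_kronecker_mul, Matrix.conjTranspose_one,
    one_mul] at h
  obtain ⟨q⟩ := ‹Nonempty Q›
  ext i j
  have := congrFun (congrFun h (i, q)) (j, q)
  simpa [Matrix.one_apply] using this

theorem entropy_ptrace_conj {T P Q : Type*} [Fintype T] [Fintype P] [Fintype Q] [DecidableEq T]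
    [DecidableEq P] [DecidableEq Q] [Nonempty Q] (e : P × Q ≃ T) {L ρ : Matrix T T ℂ}
    {l : Matrix P P ℂ} (hρ : IsState ρ) (hU : Lᴴ * L = 1)
    (hL : L.submatrix e e = l ⊗ₖ (1 : Matrix Q Q ℂ)) :
    entropy (ptrace (fun p q => e (p, q)) (L * ρ * Lᴴ))
      = entropy (ptrace (fun p q => e (p, q)) ρ) := by
  rw [ptrace_conj e hL]
  refine entropy_conj (hρ.ptrace e).herm (unitary_of_kron_one (Q := Q) ?_)
  rw [← hL, Matrix.conjTranspose_submatrix, Matrix.submatrix_mul_equiv, hU,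
    Matrix.submatrix_one_equiv]

/-- Given x, the whole measurement stage is unitary on RSAMY and ignores the baths, so this entropy
keeps its value from before the measurement, where M is thermal and Y pure. -/
theorem entropy_redRSAMY (x : A) :
    entropy (redRSAMY (G.m2 x)) = entropy (trRight (trRight (G.e1 x))) + entropy G.τM := by
  have hst : IsState ((G.e1 x ⊗ₖ G.τM) ⊗ₖ ketbra G.y0) :=
    ((G.isState_e1 x).kron G.isState_τM).kron (isState_single _)
  have hU : ((liftSAM (R := R) (B := B) (C := C) (G.Umeas x).1) ⊗ₖ (1 : Matrix Y Y ℂ))ᴴ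
      * (liftSAM (G.Umeas x).1 ⊗ₖ (1 : Matrix Y Y ℂ)) = 1 := by
    rw [Matrix.conjTranspose_kronecker, ← Matrix.mul_kronecker_mul, liftSAM_unitary,
      Matrix.conjTranspose_one, one_mul, Matrix.one_kronecker_one]
  have hm : G.m2 x = G.Vmem x * ((liftSAM (G.Umeas x).1 ⊗ₖ (1 : Matrix Y Y ℂ))
      * ((G.e1 x ⊗ₖ G.τM) ⊗ₖ ketbra G.y0)
      * (liftSAM (G.Umeas x).1 ⊗ₖ (1 : Matrix Y Y ℂ))ᴴ) * (G.Vmem x)ᴴ := by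
    rw [m2, interact, Matrix.conjTranspose_kronecker, ← Matrix.mul_kronecker_mul,
      ← Matrix.mul_kronecker_mul, Matrix.conjTranspose_one, one_mul, mul_one]
  -- Each `l` is the corresponding unitary with the baths removed: first the controlled unitary on
  -- MY, then the interaction on SAM.
  rw [redRSAMY, hm,
    entropy_ptrace_conj splitBaths (hst.conj hU) (G.Vmem_unitary x)
      (l := ∑ y, ((1 : Matrix ((R × S) × A) ((R × S) × A) ℂ) ⊗ₖ G.proj x y) ⊗ₖ
        (Equiv.swap G.y0 y).permMatrix ℂ) ?_,
    entropy_ptrace_conj splitBaths hst hU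
      (l := (lift (fun t : ((R × S) × A) × M => (((t.1.1.2, t.1.2), t.2), t.1.1.1))
        (G.Umeas x).1) ⊗ₖ (1 : Matrix Y Y ℂ)) ?_]
  · have : ptrace (fun p q => splitBaths (p, q)) ((G.e1 x ⊗ₖ G.τM) ⊗ₖ ketbra G.y0)
        = (trRight (trRight (G.e1 x)) ⊗ₖ G.τM) ⊗ₖ ketbra G.y0 := by
      ext i j
      simp only [ptrace, splitBaths, Matrix.of_apply, Matrix.kroneckerMap_apply,
        Equiv.coe_fn_mk, Fintype.sum_prod_type, Finset.sum_mul]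
    rw [this, ketbra, entropy_kron ((G.isState_e1 x).trRight.trRight.kron G.isState_τM)
      (isState_single _), entropy_kron (G.isState_e1 x).trRight.trRight G.isState_τM,
      entropy_single, add_zero]
  · ext t t'
    simp only [splitBaths, liftSAM, lift_apply, Matrix.kroneckerMap_apply, Matrix.one_apply,
      Matrix.submatrix_apply, Equiv.coe_fn_mk, Prod.ext_iff]
    split_ifs <;> simp_all
  · ext t t'
    simp only [splitBaths, Vmem, Matrix.submatrix_apply, Matrix.sum_apply,
      Matrix.kroneckerMap_apply, Equiv.coe_fn_mk, Finset.sum_mul]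
    refine Finset.sum_congr rfl fun y _ => ?_
    simp only [Matrix.one_apply, Prod.ext_iff]
    split_ifs <;> simp_all

theorem redRSA_withX (s : A → Matrix (EIdx R S A B C × Y) (EIdx R S A B C × Y) ℂ) :
    let e : ((R × S) × A) × (A × Y) ≃ (((R × S) × A) × Y) × A :=
      ⟨fun t => ((t.1, t.2.2), t.2.1), fun t => (t.1.1, (t.2, t.1.2)), fun _ => rfl, fun _ => rfl⟩
    redRSA (G.withX s) = (block G.pX fun x =>
      ptrace (fun (p : ((R × S) × A) × Y) (q : B × (A × C)) => (((p.1, q.1), q.2), p.2))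
        (s x)).submatrix e e := by
  ext ⟨r, x, y⟩ ⟨r', x', y'⟩
  simp only [redRSA, withX, block, ptrace, Matrix.of_apply, Matrix.submatrix_apply,
    Equiv.coe_fn_mk]
  split_ifs with h
  · subst h; rw [Finset.mul_sum]
  · simp

theorem redRSAM_withX
    (s : A → Matrix ((EIdx R S A B C × M) × Y) ((EIdx R S A B C × M) × Y) ℂ) :
    let e : (((R × S) × A) × M) × (A × Y) ≃ ((((R × S) × A) × M) × Y) × A :=
      ⟨fun t => ((t.1, t.2.2), t.2.1), fun t => (t.1.1, (t.2, t.1.2)), fun _ => rfl, fun _ => rfl⟩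
    redRSAM (G.withX s) = (block G.pX fun x => redRSAMY (s x)).submatrix e e := by
  ext ⟨r, x, y⟩ ⟨r', x', y'⟩
  simp only [redRSAM, withX, block, redRSAMY, splitBaths, ptrace, Matrix.of_apply,
    Matrix.submatrix_apply, Equiv.coe_fn_mk]
  split_ifs with h
  · subst h; rw [Finset.mul_sum]
  · simp

theorem redYMX_withX
    (s : A → Matrix ((EIdx R S A B C × M) × Y) ((EIdx R S A B C × M) × Y) ℂ) :
    let e : (Y × M) × A ≃ (M × Y) × A :=
      ⟨fun t => ((t.1.2, t.1.1), t.2), fun t => ((t.1.2, t.1.1), t.2), fun _ => rfl, fun _ => rfl⟩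
    redYMX (G.withX s) = (block G.pX fun x =>
      ptrace (fun (p : M × Y) (q : EIdx R S A B C) => ((q, p.1), p.2)) (s x)).submatrix e e := by
  ext ⟨⟨y, k⟩, x⟩ ⟨⟨y', k'⟩, x'⟩
  simp only [redYMX, withX, block, ptrace, Matrix.of_apply, Matrix.submatrix_apply,
    Equiv.coe_fn_mk]
  split_ifs with h
  · subst h; rw [Finset.mul_sum]
  · simp

/-- The two parts of the measurement heat add up to the entropy decrease of the apparatus. -/
theorem QmeasY_add_QmeasRSA :
    G.QmeasY + G.QmeasRSA
      = G.kB * G.Tm * (entropy G.τM - ∑ x, G.pX x * entropy (redM (G.m2 x))) := by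
  let eM : (M × Y) × EIdx R S A B C ≃ (EIdx R S A B C × M) × Y :=
    ⟨fun t => ((t.2, t.1.1), t.1.2), fun t => ((t.1.2, t.2), t.1.1), fun _ => rfl, fun _ => rfl⟩
  let eM' : M × (EIdx R S A B C × Y) ≃ (EIdx R S A B C × M) × Y :=
    ⟨fun t => ((t.2.1, t.1), t.2.2), fun t => (t.1.2, (t.1.1, t.2)), fun _ => rfl, fun _ => rfl⟩
  let eR : (((R × S) × A) × Y) × (B × (A × C)) ≃ EIdx R S A B C × Y :=
    ⟨fun t => (((t.1.1, t.2.1), t.2.2), t.1.2), fun t => ((t.1.1.1, t.2), (t.1.1.2, t.1.2)),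
      fun _ => rfl, fun _ => rfl⟩
  have hs1 : ∀ x, IsState (G.s1 x) := fun x => (G.isState_e1 x).kron (isState_single _)
  have hMY : ∀ x, IsState
      (ptrace (fun (p : M × Y) (q : EIdx R S A B C) => ((q, p.1), p.2)) (G.m2 x)) :=
    fun x => (G.isState_m2 x).ptrace eM
  have hM : ∀ x, IsState (redM (G.m2 x)) := fun x => (G.isState_m2 x).ptrace eM'
  have hRM : ∀ x, IsState (redRSAMY (G.m2 x)) := fun x => (G.isState_m2 x).ptrace splitBaths
  have hR1 : ∀ x, IsState
      (ptrace (fun (p : ((R × S) × A) × Y) (q : B × (A × C)) => (((p.1, q.1), q.2), p.2))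
        (G.s1 x)) := fun x => (hs1 x).ptrace eR
  have sYMX : (redYMX (G.withX G.m2)).IsHermitian := by
    rw [redYMX_withX]; exact (isState_block G.pX_nonneg G.sum_pX hMY).herm.submatrix _
  have sRSAM : (redRSAM (G.withX G.m2)).IsHermitian := by
    rw [redRSAM_withX]; exact (isState_block G.pX_nonneg G.sum_pX hRM).herm.submatrix _
  have mMX : ptrace (fun (t : M × A) (p : Y) => ((p, t.1), t.2)) (redYMX (G.withX G.m2))
      = block G.pX fun x => redM (G.m2 x) := by
    ext ⟨k, x⟩ ⟨k', x'⟩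
    simp only [ptrace, redYMX, withX, block, redM, Matrix.of_apply]
    split_ifs with h
    · subst h
      rw [Finset.mul_sum, Fintype.sum_prod_type]
      exact Finset.sum_comm
    · simp
  let eX : M × (A × Y) ≃ (Y × M) × A :=
    ⟨fun t => ((t.2.2, t.1), t.2.1), fun t => (t.1.2, (t.2, t.1.1)), fun _ => rfl, fun _ => rfl⟩
  -- The same entropy of MXY occurs in both mutual informations with opposite signs; this is the
  -- chain rule I(Y:M|X) + I(RSA:M|XY) = I(RSAY:M|X).
  have mMXY : ptrace (fun (t : M × (A × Y)) (p : (R × S) × A) => ((p, t.1), t.2))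
      (redRSAM (G.withX G.m2)) = (redYMX (G.withX G.m2)).submatrix eX eX := by
    ext ⟨k, x, y⟩ ⟨k', x', y'⟩
    simp only [ptrace, redRSAM, redYMX, Matrix.of_apply, Matrix.submatrix_apply, eX,
      Equiv.coe_fn_mk, Fintype.sum_prod_type]
  have mXY : ptrace (fun (k : A × Y) (p : (R × S) × A) => (p, k)) (redRSA (G.withX G.s1))
      = (redYX (G.withX G.s1)).submatrix (Equiv.prodComm _ _) (Equiv.prodComm _ _) := by
    ext ⟨x, y⟩ ⟨x', y'⟩
    simp only [ptrace, redRSA, redYX, Matrix.of_apply, Matrix.submatrix_apply,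
      Equiv.prodComm_apply, Prod.swap_prod_mk, Fintype.sum_prod_type]
  have hY1 : ∀ x, redY (G.s1 x) = ketbra G.y0 := fun x => redY_kron _ (G.isState_e1 x).2 _
  have hY1s : ∀ x, IsState (redY (G.s1 x)) := fun x => (hs1 x).trLeft
  have zero : ∑ x, G.pX x * entropy (redY (G.s1 x)) = 0 := by
    simp [hY1, ketbra, entropy_single]
  have c1 : condEntropy (redYX (G.withX G.s1)) = 0 := by
    rw [redYX_withX, condEntropy_block _ hY1s, zero]
  have r1 : ∀ x, entropy (ptrace (fun (p : ((R × S) × A) × Y) (q : B × (A × C)) =>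
      (((p.1, q.1), q.2), p.2)) (G.s1 x)) = entropy (trRight (trRight (G.e1 x))) := by
    intro x
    have : ptrace (fun (p : ((R × S) × A) × Y) (q : B × (A × C)) =>
        (((p.1, q.1), q.2), p.2)) (G.s1 x) = trRight (trRight (G.e1 x)) ⊗ₖ ketbra G.y0 := by
      ext i j
      simp only [ptrace, s1, Matrix.of_apply, Matrix.kroneckerMap_apply,
        Fintype.sum_prod_type, Finset.sum_mul]
    rw [this, ketbra, entropy_kron (G.isState_e1 x).trRight.trRight (isState_single _),
      entropy_single, add_zero]
  have c2 : condEntropy (redRSA (G.withX G.s1))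
      = ∑ x, G.pX x * entropy (trRight (trRight (G.e1 x))) := by
    rw [condEntropy, mXY, entropy_submatrix, redYX_withX, entropy_block hY1s, zero, redRSA_withX,
      entropy_submatrix (isState_block G.pX_nonneg G.sum_pX hR1).herm, entropy_block hR1]
    · simp only [r1]; ring
    · rw [redYX_withX]; exact (isState_block G.pX_nonneg G.sum_pX hY1s).herm
  have c3 : entropy (redRSAM (G.withX G.m2)) = ∑ x, Real.negMulLog (G.pX x)
      + (∑ x, G.pX x * entropy (trRight (trRight (G.e1 x))) + entropy G.τM) := by
    rw [redRSAM_withX, entropy_submatrix (isState_block G.pX_nonneg G.sum_pX hRM).herm,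
      entropy_block hRM]
    simp only [entropy_redRSAMY, mul_add, Finset.sum_add_distrib, ← Finset.sum_mul, G.sum_pX,
      one_mul]
  rw [QmeasY, QmeasRSA, condMutualInfo_eq sYMX, condMutualInfo_eq sRSAM, ptrace_redYMX,
    ptrace_redRSAM, mMX, mMXY, entropy_submatrix sYMX, entropy_block hM, c1, c2, c3]
  ring

/-- The Gibbs variational principle for M given each x, averaged over x: the thermal state attains
the bound and the final states obey it, so the energy lost is at most k_B T_m times the entropy
decrease. -/
theorem Qmeas_le : G.Qmeas ≤ G.QmeasY + G.QmeasRSA := by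
  let eM' : M × (EIdx R S A B C × Y) ≃ (EIdx R S A B C × M) × Y :=
    ⟨fun t => ((t.2.1, t.1), t.2.2), fun t => (t.1.2, (t.1.1, t.2)), fun _ => rfl, fun _ => rfl⟩
  have hM : ∀ x, IsState (redM (G.m2 x)) := fun x => (G.isState_m2 x).ptrace eM'
  obtain ⟨-, a1, a2⟩ := thermal_facts G.HM_herm (1 / (G.kB * G.Tm))
  have a1' : entropy G.τM = 1 / (G.kB * G.Tm) * expect G.τM G.HM + logZ (1 / (G.kB * G.Tm)) G.HM :=
    a1
  have hk : 0 < G.kB * G.Tm := mul_pos G.kB_pos G.Tm_pos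
  have h1 : ∑ x, G.pX x * entropy (redM (G.m2 x))
      ≤ ∑ x, G.pX x * (1 / (G.kB * G.Tm) * expect (redM (G.m2 x)) G.HM
        + logZ (1 / (G.kB * G.Tm)) G.HM) :=
    Finset.sum_le_sum fun x _ => mul_le_mul_of_nonneg_left (a2 _ (hM x)) (G.pX_nonneg x)
  have h2 : ∑ x, G.pX x * (1 / (G.kB * G.Tm) * expect (redM (G.m2 x)) G.HM
        + logZ (1 / (G.kB * G.Tm)) G.HM)
      = 1 / (G.kB * G.Tm) * expect (redM (G.avg G.m2)) G.HM + logZ (1 / (G.kB * G.Tm)) G.HM := by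
    have h3 : expect (redM (G.avg G.m2)) G.HM
        = ∑ x, G.pX x * expect (redM (G.m2 x)) G.HM := G.expect_ptrace_avg _ _ _
    rw [h3, Finset.mul_sum]
    simp only [mul_add, Finset.sum_add_distrib, ← Finset.sum_mul, G.sum_pX, one_mul]
    congr 1
    exact Finset.sum_congr rfl fun x _ => by ring
  have h4 : G.Qmeas = G.kB * G.Tm * (1 / (G.kB * G.Tm) * expect G.τM G.HM
      - 1 / (G.kB * G.Tm) * expect (redM (G.avg G.m2)) G.HM) := by
    rw [Qmeas, ← mul_sub, ← mul_assoc, mul_one_div_cancel hk.ne', one_mul]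
  rw [QmeasY_add_QmeasRSA, h4]
  refine mul_le_mul_of_nonneg_left ?_ hk.le
  linarith

end Measurement

end QEC.Engine

/-! ### The triple trade-off -/

theorem mainTheorem6 {R S A B C M Y : Type*}
    [Fintype R] [Fintype S] [Fintype A] [Fintype B] [Fintype C] [Fintype M] [Fintype Y]
    [DecidableEq R] [DecidableEq S] [DecidableEq A] [DecidableEq B] [DecidableEq C]
    [DecidableEq M] [DecidableEq Y]
    [Nonempty A] [Nonempty B] [Nonempty C] [Nonempty M]
    (G : QEC.Engine R S A B C M Y)
    -- the working fluid absorbs positive heat, and the measured system releases heat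
    (hQinput : 0 < G.Qinput) (hQmeas : G.QmeasRSA ≤ 0)
    (ε₁ ε₂ ε₃ : ℝ)
    -- high fidelity: the net change of the internal energy is small against the input heat
    (h1 : |G.ΔU| ≤ ε₁ * G.Qinput)
    -- before the erasure, the entropy of `X` is small against that of `Y`
    (h2 : G.HXE ≤ ε₂ * G.HYEX)
    -- the Landauer bound is approximately reached
    (h3 : |(|G.Qerase| - G.kB * G.Tc * G.HYX)| ≤ ε₃ * (G.kB * G.Tc * G.HYX))
    -- the measured system releases enough heat to the apparatus
    (h4 : G.Tc / G.Th * G.QmeasY ≤ |G.QmeasRSA|) :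
    (G.Qinput / (G.kB * G.Th) * ((G.η - G.ηC) / (1 - G.ηC))
        + ∑ x, G.pX x * (-Real.log (QEC.efficacy (G.instr x) (G.e1 x)))
        - (ε₁ * G.Qinput / (G.kB * G.Tc) + ε₂ * G.HYEX + ε₃ * G.HYX)
      ≤ Real.binEntropy G.Fe
        + (1 - G.Fe) * Real.log ((Fintype.card (R × S) : ℝ) ^ 2 - 1)) ∧
    G.Fe ≤ QEC.maxFidelity (Fintype.card (R × S)) G.Se ∧
    (G.Qinput / (G.kB * G.Th) * ((G.η - G.ηC) / (1 - G.ηC))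
        + ∑ x, G.pX x * (-Real.log (QEC.efficacy (G.instr x) (G.e1 x)))
        - (ε₁ * G.Qinput / (G.kB * G.Tc) + ε₂ * G.HYEX + ε₃ * G.HYX)
      ≤ QEC.fano (Fintype.card (R × S)) (QEC.maxFidelity (Fintype.card (R × S)) G.Se)) := by
  have hF := QEC.entropy_le_fano (ρ := QEC.Engine.redRS (G.avg G.sF))
    (by
      rw [← QEC.Engine.redRS_eq]
      exact (G.isState_avg G.isState_sF).trRight.trRight.trRight.trRight)
    G.ψ_norm
  have hFano : G.Se ≤ QEC.fano (Fintype.card (R × S)) G.Fe := hF.2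
  obtain ⟨hmax, hmax'⟩ := QEC.maxFidelity_spec hF.1 hFano
  have key : G.Qinput / (G.kB * G.Th) * ((G.η - G.ηC) / (1 - G.ηC))
        + ∑ x, G.pX x * (-Real.log (QEC.efficacy (G.instr x) (G.e1 x)))
        - (ε₁ * G.Qinput / (G.kB * G.Tc) + ε₂ * G.HYEX + ε₃ * G.HYX) ≤ G.Se := by
    have hc : 0 < G.kB * G.Tc := mul_pos G.kB_pos G.Tc_pos
    have hcan : 1 / (G.kB * G.Tc) * (G.kB * G.Tc) = 1 := one_div_mul_cancel hc.ne'
    have second := G.second_law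
    have first := G.first_law
    have hmeas := G.Qmeas_le
    have hc' : 0 ≤ 1 / (G.kB * G.Tc) := (one_div_pos.2 hc).le
    -- With 1 - η_C = T_c/T_h the efficiency ratio becomes linear in work and heat once Q_input is
    -- cancelled; this uses that Q_input is nonzero.
    have e1 : G.Qinput / (G.kB * G.Th) * ((G.η - G.ηC) / (1 - G.ηC))
        = 1 / (G.kB * G.Tc) * (-G.Wtot - G.Qinput) + 1 / (G.kB * G.Th) * G.Qinput := by
      have := G.kB_pos.ne'
      have := G.Th_pos.ne'
      have := G.Tc_pos.ne'
      have := hQinput.ne'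
      have e : 1 - G.ηC = G.Tc / G.Th := by rw [QEC.Engine.ηC]; ring
      rw [e, QEC.Engine.η, QEC.Engine.ηC]
      field_simp
      ring
    -- The factor T_c/T_h in condition 4 turns β_c into β_h, so that the heat released by RSA
    -- compensates the term β_h Q_meas^Y.
    have e2 : 1 / (G.kB * G.Tc) * G.QmeasRSA ≤ -(1 / (G.kB * G.Th) * G.QmeasY) := by
      rw [abs_of_nonpos hQmeas] at h4
      have h5 := mul_le_mul_of_nonneg_left h4 hc'
      have h6 : 1 / (G.kB * G.Tc) * (G.Tc / G.Th * G.QmeasY) = 1 / (G.kB * G.Th) * G.QmeasY := by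
        have := G.kB_pos.ne'
        have := G.Th_pos.ne'
        have := G.Tc_pos.ne'
        field_simp
      linarith
    have e3 : 1 / (G.kB * G.Tc) * G.Qerase ≤ -G.HYX + ε₃ * G.HYX := by
      rw [abs_of_nonpos G.Qerase_nonpos] at h3
      have h5 := mul_le_mul_of_nonneg_left (abs_le.1 h3).1 hc'
      have h6 : 1 / (G.kB * G.Tc) * -(ε₃ * (G.kB * G.Tc * G.HYX)) = -(ε₃ * G.HYX) := by
        linear_combination (-(ε₃ * G.HYX)) * hcan
      have h7 : 1 / (G.kB * G.Tc) * (-G.Qerase - G.kB * G.Tc * G.HYX)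
          = -(1 / (G.kB * G.Tc) * G.Qerase) - G.HYX := by
        linear_combination (-G.HYX) * hcan
      linarith
    have e4 : -(1 / (G.kB * G.Tc) * G.ΔU) ≤ ε₁ * G.Qinput / (G.kB * G.Tc) := by
      have h5 := mul_le_mul_of_nonneg_left (abs_le.1 h1).1 hc'
      have h6 : 1 / (G.kB * G.Tc) * -(ε₁ * G.Qinput) = -(ε₁ * G.Qinput / (G.kB * G.Tc)) := by
        ring
      linarith
    have e5 := mul_le_mul_of_nonneg_left hmeas hc'
    -- The work is eliminated by the first law, and β_c `QmeasRSA` is subtracted and added back: the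
    -- first difference is nonpositive by `Qmeas_le`, and the added term is the one bounded in `e2`.
    have e6 : 1 / (G.kB * G.Tc) * (-G.Wtot - G.Qinput) + 1 / (G.kB * G.Th) * G.Qinput
        = 1 / (G.kB * G.Tc) * G.Qmeas - 1 / (G.kB * G.Tc) * (G.QmeasY + G.QmeasRSA)
          + 1 / (G.kB * G.Tc) * G.QmeasRSA + 1 / (G.kB * G.Tc) * G.Qc
          + 1 / (G.kB * G.Tc) * G.Qerase - 1 / (G.kB * G.Tc) * G.ΔU
          + 1 / (G.kB * G.Th) * G.Qh + 1 / (G.kB * G.Th) * G.QmeasY := by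
      rw [first, QEC.Engine.Qinput]; ring
    rw [e1, e6]
    linarith
  exact ⟨key.trans hFano, hmax, key.trans hmax'⟩
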